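/- **Definitions.** For a càdlàg function $f:[0,1]\to\mathbb{R}$ put $f(0-)=0$, $f(t-)=\lim_{s\uparrow t}f(s)$ for $t\in(0,1]$, and $\Delta_t=f(t)-f(t-)$ (so $\Delta_0=f(0)$). An *excursion* is a càdlàg $f:[0,1]\to[0,\infty)$ with $f(1)=0$ and $\Delta_t\ge 0$ for all $t\in[0,1]$; $f$ *jumps* at $t$ when $\Delta_t>0$. For $s,t\in[0,1]$ write $s\preceq t$ if $s\le t$ and $f(s-)\le\inf_{[s,t]}f$, and $s\prec t$ if moreover $s<t$. This is a partial order in which any two points $s,t$ have a unique most recent common ancestor $s\wedge t$, i.e. $r\preceq s\wedge t\iff r\preceq s$ and $r\preceq t$. Set $x_s^t=\mathbf 1_{s\le t}\max(\inf_{[s,t]}f-f(s-),0)\in[0,\Delta_s]$. The excursion $f$ is *pure-jump-growth (PJG)* if $f(t)=\sum_{r\preceq t}x_r^t$ for all $t\in[0,1]$. Let $\mathcal C$ be the metric circle of perimeter $1$, i.e. $[0,1]$ with the pseudo-distance $\delta(a,b)=\min(|a-b|,1-|a-b|)$, the points $0$ and $1$ being identified. Let $\Lambda$ be the set of increasing bijections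 of $[0,1]$ onto itself. The Skorokhod distance between two functions $g_1,g_2$ on $[0,1]$ with values in a metric space $(E,d_E)$ is $\inf_{\lambda\in\Lambda}\max(\|\lambda-\mathrm{id}\|_\infty,\sup_x d_E(g_1(x),g_2(\lambda(x))))$; it is used both for real càdlàg functions and for $\mathcal C$-valued càglàd functions (left-continuous with right limits). For a càdlàg function $f$ let $\Theta f(t)=\mathbf 1_{2t\ge1}f(2t-1)$; $f_n\to f$ *in the relaxed Skorokhod topology* means that $\Theta f_n\to\Theta f$ in the Skorokhod topology. A *shuffle* $\Phi$ is a Borel map $\Delta\mapsto\phi_\Delta$ from $(0,\infty)$ to the càglàd functions $[0,1]\to\mathcal C$ (with the Skorokhod distance) such that every $\phi_\Delta$ is surjective, $\sup_{u\in(0,\Delta]}\sup_{x\in(0,1]}\left|\frac2x\delta(\phi_u(0),\phi_u(x))-1\right|<\infty$ for every $\Delta>0$, and $\sup_{x\in(0,1]}\left|\frac2x\delta(\phi_\Delta(0),\phi_\Delta(x))-1\right|\to0$ as $\Delta\to0+$. Let $\mathbb B(\Phi)$ consist of the $\Delta>0$ at which $\Phi$ is discontinuous, together with the pairs $(\Delta,x)$,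 $\Delta>0$, $x\in[0,1]$, such that $\phi_\Delta$ is discontinuous at $x$. For an excursion $f$, let $B_f$ consist of the heights $\Delta_t>0$ of the jumps of $f$, together with the pairs $(\Delta_r,x_r^t/\Delta_r)$ for $r,s,t\in[0,1]$ with $s\ne t$, $\Delta_r>0$ and $x_r^t=x_r^s>0$. For $a,b\in[0,\Delta_t]$ put $\delta_t(a,b)=\min(|a-b|,\Delta_t-|a-b|)$, and $\tilde\delta_t(a,b)=\Delta_t\,\delta(\phi_{\Delta_t}(a/\Delta_t),\phi_{\Delta_t}(b/\Delta_t))$ if $\Delta_t>0$, $\tilde\delta_t(0,0)=0$ if $\Delta_t=0$. For $s\preceq t$ put $$d^0_L(s,t)=\sum_{s\prec r\preceq t}\delta_r(0,x_r^t),\qquad \tilde d^0_L(s,t)=\sum_{s\prec r\preceq t}\tilde\delta_r(0,x_r^t),\qquad d_T(s,t)=f(t)-\inf_{[s,t]}f-\sum_{s\prec r\preceq t}x_r^t,$$ and for all $s,t\in[0,1]$, with $u=s\wedge t$, $$d_L(s,t)=\delta_u(x_u^s,x_u^t)+d^0_L(u,s)+d^0_L(u,t),\qquad \tilde d_L(s,t)=\tilde\delta_u(x_u^s,x_u^t)+\tilde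 d^0_L(u,s)+\tilde d^0_L(u,t),$$ $$d_T(s,t)=d_T(u,s)+d_T(u,t),\qquad d_V=d_T+2d_L,\qquad \tilde d_V=d_T+2\tilde d_L.$$ The *looptree* $\mathscr L[f]$, the *tree* $\mathscr T[f]$, the *vernation tree* $\mathscr V[f]$ and the *shuffled vernation tree* $\tilde{\mathscr V}[f]$ (which depends on $\Phi$) coded by $f$ are the quotients $[0,1]/\{d=0\}$ for the pseudo-distances $d=d_L,d_T,d_V,\tilde d_V$ respectively, each endowed with the induced distance, rooted at the class of $1$, and equipped with the image of the Lebesgue measure on $[0,1]$. Let $\partial$ be the one-point space. The pointed Gromov–Hausdorff–Prokhorov (GHP) distance between two compact metric spaces $X_1,X_2$ with roots $a_i$ and Borel probability measures $\mu_i$ is $\inf_{\mathcal R,\nu}\max(\tfrac12\mathrm{dis}(\mathcal R),1-\nu(\mathcal R))$, over all couplings $\nu$ of $\mu_1,\mu_2$ and all compact correspondences $\mathcal R\subset X_1\times X_2$ containing $(a_1,a_2)$, where $\mathrm{dis}(\mathcal R)=\sup\{|d_1(x_1,y_1)-d_2(x_2,y_2)|:(x_1,x_2),(y_1,y_2)\in\mathcal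 R\}$. **Theorem.** Let $f$ be an excursion and let $(f_n)$ be a sequence of excursions such that $f_n\to f$ in the relaxed Skorokhod topology. (i) For every shuffle $\Phi$ with $B_f\cap\mathbb B(\Phi)=\emptyset$, $\tilde{\mathscr V}[f_n]\to\tilde{\mathscr V}[f]$ in the pointed GHP topology. (ii) If there is $N\ge1$ such that every $f_n$ has at most $N$ jumps, then $\mathscr L[f_n]\to\mathscr L[f]$, $\mathscr T[f_n]\to\mathscr T[f]$ and $\mathscr V[f_n]\to\mathscr V[f]$ in the pointed GHP topology. (iii) If $f$ is PJG, then $\mathscr L[f_n]\to\mathscr L[f]$, $\mathscr T[f_n]\to\partial$ and $\mathscr V[f_n]\to\mathscr V[f]$ in the pointed GHP topology. The convergences include the assertion that the functions $d$ involved are pseudo-distances whose quotients, with the stated root and measure, are compact metric spaces with a Borel probability measure. -/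

import Mathlib

open Set Filter Topology MeasureTheory
open scoped unitInterval ENNReal

noncomputable section

namespace Vernation

/-! ### Skorokhod spaces on `[0,1]` -/

/-- The Skorokhod distance between two functions on `[0,1]`, as an extended nonnegative number.
The increasing bijections from `[0,1]` onto itself are the order isomorphisms `I ≃o I`. -/
def skorokhodEDist {E : Type*} [PseudoEMetricSpace E] (f g : I → E) : ℝ≥0∞ :=
  ⨅ l : I ≃o I, max (⨆ t, edist (l t) t) (⨆ t, edist (f t) (g (l t)))

theorem skorokhodEDist_self {E : Type*} [PseudoEMetricSpace E] (f : I → E) :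
    skorokhodEDist f f = 0 := by
  refine le_antisymm ?_ bot_le
  refine (iInf_le _ (OrderIso.refl I)).trans ?_
  simp

theorem skorokhodEDist_comm {E : Type*} [PseudoEMetricSpace E] (f g : I → E) :
    skorokhodEDist f g = skorokhodEDist g f := by
  have key : ∀ f g : I → E, skorokhodEDist f g ≤ skorokhodEDist g f := by
    intro f g
    refine le_iInf fun l => (iInf_le _ l.symm).trans ?_
    apply max_le_max
    · refine iSup_le fun t => ?_
      refine le_trans (le_of_eq ?_) (le_iSup (fun t => edist (l t) t) (l.symm t))
      simp [edist_comm]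
    · refine iSup_le fun t => ?_
      refine le_trans (le_of_eq ?_) (le_iSup (fun t => edist (g t) (f (l t))) (l.symm t))
      simp [edist_comm]
  exact le_antisymm (key f g) (key g f)

theorem skorokhodEDist_triangle {E : Type*} [PseudoEMetricSpace E] (f g h : I → E) :
    skorokhodEDist f h ≤ skorokhodEDist f g + skorokhodEDist g h := by
  refine ENNReal.le_iInf_add_iInf fun l m => (iInf_le _ (l.trans m)).trans ?_
  apply max_le
  · refine iSup_le fun t => ?_
    calc edist ((l.trans m) t) t ≤ edist (m (l t)) (l t) + edist (l t) t :=
          edist_triangle _ _ _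
      _ = edist (l t) t + edist (m (l t)) (l t) := add_comm _ _
      _ ≤ _ := add_le_add
          ((le_iSup (fun t => edist (l t) t) t).trans (le_max_left _ _))
          ((le_iSup (fun t => edist (m t) t) (l t)).trans (le_max_left _ _))
  · refine iSup_le fun t => ?_
    calc edist (f t) (h ((l.trans m) t)) ≤ edist (f t) (g (l t)) + edist (g (l t)) (h (m (l t))) :=
          edist_triangle _ _ _
      _ ≤ _ := add_le_add
          ((le_iSup (fun t => edist (f t) (g (l t))) t).trans (le_max_right _ _))
          ((le_iSup (fun t => edist (g t) (h (m t))) (l t)).trans (le_max_right _ _))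

/-- Right-continuous functions on `[0,1]` with left limits everywhere. -/
structure Cadlag (E : Type*) [PseudoEMetricSpace E] where
  toFun : I → E
  right_continuous : ∀ t, ContinuousWithinAt toFun (Ici t) t
  exists_left_limit : ∀ t, ∃ l, Tendsto toFun (𝓝[<] t) (𝓝 l)

/-- Left-continuous functions on `[0,1]` with right limits everywhere. -/
structure Caglad (E : Type*) [PseudoEMetricSpace E] where
  toFun : I → E
  left_continuous : ∀ t, ContinuousWithinAt toFun (Iic t) t
  exists_right_limit : ∀ t, ∃ l, Tendsto toFun (𝓝[>] t) (𝓝 l)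

instance {E : Type*} [PseudoEMetricSpace E] : CoeFun (Cadlag E) (fun _ => I → E) := ⟨Cadlag.toFun⟩

instance {E : Type*} [PseudoEMetricSpace E] : CoeFun (Caglad E) (fun _ => I → E) := ⟨Caglad.toFun⟩

/-- The Skorokhod topology on càdlàg functions. -/
instance {E : Type*} [PseudoEMetricSpace E] : PseudoEMetricSpace (Cadlag E) where
  edist f g := skorokhodEDist f g
  edist_self f := skorokhodEDist_self f
  edist_comm f g := skorokhodEDist_comm f g
  edist_triangle f g h := skorokhodEDist_triangle f g h

/-- The Skorokhod topology on càglàd functions. -/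
instance {E : Type*} [PseudoEMetricSpace E] : PseudoEMetricSpace (Caglad E) where
  edist f g := skorokhodEDist f g
  edist_self f := skorokhodEDist_self f
  edist_comm f g := skorokhodEDist_comm f g
  edist_triangle f g h := skorokhodEDist_triangle f g h

instance {E : Type*} [PseudoEMetricSpace E] : MeasurableSpace (Caglad E) := borel _

instance {E : Type*} [PseudoEMetricSpace E] : BorelSpace (Caglad E) := ⟨rfl⟩

/-- The map `t ↦ 2t - 1`, clamped to `[0,1]`. -/
def stretch (t : I) : I := projIcc 0 1 zero_le_one (2 * (t : ℝ) - 1)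

theorem continuous_stretch : Continuous stretch := by
  unfold stretch; fun_prop

theorem stretch_coe {t : I} (h : 1 ≤ 2 * (t : ℝ)) : (stretch t : ℝ) = 2 * (t : ℝ) - 1 := by
  have h1 := t.2.2
  have : 2 * (t : ℝ) - 1 ∈ Icc (0 : ℝ) 1 := ⟨by linarith, by linarith⟩
  rw [stretch, projIcc_of_mem _ this]

/-- `Θ f (t) = 1_{2t ≥ 1} f (2t - 1)`. -/
def Theta (f : Cadlag ℝ) : Cadlag ℝ where
  toFun t := if 1 ≤ 2 * (t : ℝ) then f (stretch t) else 0
  right_continuous t := by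
    by_cases h : 1 ≤ 2 * (t : ℝ)
    · have hs : ContinuousWithinAt (fun u => f (stretch u)) (Ici t) t := by
        refine (f.right_continuous (stretch t)).comp continuous_stretch.continuousWithinAt ?_
        intro u hu
        have : (t : ℝ) ≤ u := hu
        exact monotone_projIcc _ (show 2 * (t : ℝ) - 1 ≤ 2 * (u : ℝ) - 1 by linarith)
      refine hs.congr (fun u hu => ?_) ?_
      · have : (t : ℝ) ≤ u := hu
        exact if_pos (by linarith)
      · exact if_pos h
    · have ho : ∀ᶠ u : I in 𝓝 t, 2 * (u : ℝ) < 1 := by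
        apply (isOpen_lt (by fun_prop) continuous_const).mem_nhds
        simpa using h
      apply ContinuousAt.continuousWithinAt
      refine (continuousAt_const (y := (0 : ℝ))).congr ?_
      filter_upwards [ho] with u hu
      exact (if_neg (by linarith)).symm
  exists_left_limit t := by
    by_cases h : 1 < 2 * (t : ℝ)
    · obtain ⟨l, hl⟩ := f.exists_left_limit (stretch t)
      refine ⟨l, ?_⟩
      have ho : ∀ᶠ u : I in 𝓝 t, 1 < 2 * (u : ℝ) :=
        (isOpen_lt continuous_const (by fun_prop)).mem_nhds h
      have hs : Tendsto stretch (𝓝[<] t) (𝓝[<] (stretch t)) := by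
        apply tendsto_nhdsWithin_iff.2
        refine ⟨continuous_stretch.continuousAt.tendsto.mono_left nhdsWithin_le_nhds, ?_⟩
        filter_upwards [nhdsWithin_le_nhds ho, self_mem_nhdsWithin] with u hu hut
        have h1 : (u : ℝ) < t := hut
        show (stretch u : ℝ) < stretch t
        rw [stretch_coe hu.le, stretch_coe h.le]
        linarith
      refine (hl.comp hs).congr' ?_
      filter_upwards [nhdsWithin_le_nhds ho] with u hu
      exact (if_pos hu.le).symm
    · refine ⟨0, tendsto_const_nhds.congr' ?_⟩
      filter_upwards [self_mem_nhdsWithin] with u hu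
      have h1 : (u : ℝ) < t := hu
      exact (if_neg (by linarith)).symm

/-! ### Excursions and their genealogy -/

/-- The left limit `f(t-)`, with the convention `f(0-) = 0`. -/
def leftVal (f : I → ℝ) (t : I) : ℝ := if t = 0 then 0 else Function.leftLim f t

/-- The jump `Δ_t = f(t) - f(t-)`; in particular `Δ_0 = f(0)`. -/
def jump (f : I → ℝ) (t : I) : ℝ := f t - leftVal f t

/-- Excursions: nonnegative càdlàg functions with `f(1) = 0` and nonnegative jumps. -/
structure Excursion extends Cadlag ℝ where
  nonneg : ∀ t, 0 ≤ toFun t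
  map_one : toFun 1 = 0
  jump_nonneg : ∀ t, 0 ≤ jump toFun t

instance : CoeFun Excursion (fun _ => I → ℝ) := ⟨fun f => f.toFun⟩

/-- Convergence of excursions for the relaxed Skorokhod topology. -/
def RelaxedTendsto (fn : ℕ → Excursion) (f : Excursion) : Prop :=
  Tendsto (fun n => Theta (fn n).toCadlag) atTop (𝓝 (Theta f.toCadlag))

/-- `inf_{[s,t]} f`. -/
def infOn (f : I → ℝ) (s t : I) : ℝ := sInf (f '' Icc s t)

/-- `s ≼ t`. -/
def Anc (f : I → ℝ) (s t : I) : Prop := s ≤ t ∧ leftVal f s ≤ infOn f s t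

/-- `s ≺ t`. -/
def StrictAnc (f : I → ℝ) (s t : I) : Prop := Anc f s t ∧ s < t

theorem tendsto_leftVal (f : Excursion) {t : I} (ht : t ≠ 0) :
    Tendsto f (𝓝[<] t) (𝓝 (leftVal f t)) := by
  obtain ⟨l, hl⟩ := f.exists_left_limit t
  have hne : (𝓝[<] t).NeBot :=
    nhdsLT_neBot_of_exists_lt ⟨0, unitInterval.pos_iff_ne_zero.2 ht⟩
  rw [leftVal, if_neg ht, leftLim_eq_of_tendsto hl]
  exact hl

theorem bddBelow_image (f : Excursion) (s : Set I) : BddBelow (f '' s) :=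
  ⟨0, by rintro _ ⟨u, _, rfl⟩; exact f.nonneg u⟩

theorem anc_iff (f : Excursion) {s t : I} :
    Anc f s t ↔ s ≤ t ∧ ∀ u, s ≤ u → u ≤ t → leftVal f s ≤ f u := by
  constructor
  · rintro ⟨h, h'⟩
    exact ⟨h, fun u hu hu' => h'.trans (csInf_le (bddBelow_image f _) ⟨u, ⟨hu, hu'⟩, rfl⟩)⟩
  · rintro ⟨h, h'⟩
    refine ⟨h, le_csInf ⟨f s, s, ⟨le_rfl, h⟩, rfl⟩ ?_⟩
    rintro _ ⟨u, hu, rfl⟩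
    exact h' u hu.1 hu.2

theorem zero_anc (f : Excursion) (t : I) : Anc f 0 t :=
  (anc_iff f).2 ⟨t.2.1, fun u _ _ => by simpa [leftVal] using f.nonneg u⟩

theorem anc_of_isLUB (f : Excursion) {S : Set I} {u t : I} (hu : IsLUB S u) (hne : S.Nonempty)
    (hS : ∀ r ∈ S, Anc f r t) : Anc f u t := by
  have hut : u ≤ t := hu.2 fun r hr => (hS r hr).1
  by_cases hmem : u ∈ S
  · exact hS u hmem
  refine (anc_iff f).2 ⟨hut, fun v huv hvt => ?_⟩
  by_contra! hlt
  have hu0 : u ≠ 0 := by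
    rintro rfl
    obtain ⟨r, hr⟩ := hne
    exact hmem (le_antisymm (hu.1 hr) r.2.1 ▸ hr)
  obtain ⟨c, hc1, hc2⟩ := exists_between hlt
  have hev : ∀ᶠ r in 𝓝[<] u, c < f r := (tendsto_leftVal f hu0).eventually_const_lt hc2
  obtain ⟨a, ha, hau⟩ := (mem_nhdsLT_iff_exists_Ioo_subset'
    (unitInterval.pos_iff_ne_zero.2 hu0)).1 hev
  obtain ⟨r, hrS, har⟩ := (lt_isLUB_iff hu).1 ha
  have hru : r < u := lt_of_le_of_ne (hu.1 hrS) (fun h => hmem (h ▸ hrS))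
  have hr0 : r ≠ 0 := unitInterval.pos_iff_ne_zero.1 (lt_of_le_of_lt a.2.1 har)
  have hne' : (𝓝[<] r).NeBot := nhdsLT_neBot_of_exists_lt ⟨a, har⟩
  have h1 : c ≤ leftVal f r := by
    refine ge_of_tendsto (tendsto_leftVal f hr0) ?_
    filter_upwards [Ioo_mem_nhdsLT har] with w hw
    exact (hau ⟨hw.1, hw.2.trans hru⟩ : c < f w).le
  have h2 := ((anc_iff f).1 (hS r hrS)).2 v (hru.le.trans huv) hvt
  linarith

/-- Two points have a most recent common ancestor (which is unique by antisymmetry). -/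
theorem exists_mrca (f : Excursion) (s t : I) :
    ∃ u, ∀ r, Anc f r u ↔ Anc f r s ∧ Anc f r t := by
  have hne : {r | Anc f r s ∧ Anc f r t}.Nonempty := ⟨0, zero_anc f s, zero_anc f t⟩
  obtain ⟨u, hu⟩ : ∃ u, IsLUB {r | Anc f r s ∧ Anc f r t} u := ⟨_, isLUB_sSup _⟩
  have hus := anc_of_isLUB f hu hne fun r hr => hr.1
  have hut := anc_of_isLUB f hu hne fun r hr => hr.2
  refine ⟨u, fun r => ⟨fun h => ?_, fun h => ?_⟩⟩
  · have hru := (anc_iff f).1 h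
    have key : ∀ {w}, Anc f u w → Anc f r w := by
      intro w hw
      have hw' := (anc_iff f).1 hw
      refine (anc_iff f).2 ⟨hru.1.trans hw'.1, fun v hv hvw => ?_⟩
      rcases le_total v u with hvu | huv
      · exact hru.2 v hv hvu
      · have h3 : leftVal f r ≤ leftVal f u := by
          rcases eq_or_lt_of_le hru.1 with e | hlt
          · rw [e]
          · have hu0 : u ≠ 0 := unitInterval.pos_iff_ne_zero.1 (lt_of_le_of_lt r.2.1 hlt)
            have hne' : (𝓝[<] u).NeBot := nhdsLT_neBot_of_exists_lt ⟨r, hlt⟩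
            refine ge_of_tendsto (tendsto_leftVal f hu0) ?_
            filter_upwards [Ioo_mem_nhdsLT hlt] with w hw
            exact hru.2 w hw.1.le hw.2.le
        exact h3.trans (hw'.2 v huv hvw)
    exact ⟨key hus, key hut⟩
  · have hru : r ≤ u := hu.1 h
    have h' := (anc_iff f).1 h.1
    exact (anc_iff f).2 ⟨hru, fun v hv hvu => h'.2 v hv (hvu.trans hus.1)⟩

/-- The most recent common ancestor `s ∧ t`. -/
def mrca (f : Excursion) (s t : I) : I := (exists_mrca f s t).choose

/-- `x_s^t = 1_{s ≤ t} max (inf_{[s,t]} f - f(s-)) 0`. -/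
def relPos (f : I → ℝ) (s t : I) : ℝ := if s ≤ t then max (infOn f s t - leftVal f s) 0 else 0

/-- Pure jump growth excursions: `f(t) = ∑_{r ≼ t} x_r^t` for all `t`. -/
def IsPJG (f : Excursion) : Prop :=
  ∀ t, HasSum (fun r : {r : I // Anc f r t} => relPos f r t) (f t)

/-! ### Shuffles -/

/-- A shuffle: a Borel map `Δ ↦ φ_Δ` from `(0,∞)` to the càglàd functions from `[0,1]` to the
metric circle of perimeter `1`. On `UnitAddCircle`, the distance between the classes of
`a, b ∈ [0,1]` is `min |a - b| (1 - |a - b|)`. -/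
structure Shuffle where
  toFun : Ioi (0 : ℝ) → Caglad UnitAddCircle
  measurable : Measurable toFun
  surjective : ∀ D, Function.Surjective (toFun D)
  bounded : ∀ D : Ioi (0 : ℝ), ∃ K : ℝ, ∀ u : Ioi (0 : ℝ), u ≤ D → ∀ x : I, 0 < x →
    |2 / (x : ℝ) * dist (toFun u 0) (toFun u x) - 1| ≤ K
  small : ∀ ε : ℝ, 0 < ε → ∃ η : ℝ, 0 < η ∧ ∀ u : Ioi (0 : ℝ), (u : ℝ) < η → ∀ x : I, 0 < x →
    |2 / (x : ℝ) * dist (toFun u 0) (toFun u x) - 1| ≤ ε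

/-- The set `𝔹(Φ)`: the `Δ > 0` at which `Φ` is discontinuous for the Skorokhod topology, together
with the pairs `(Δ, x)` such that `x` is a discontinuity point of `φ_Δ`. -/
def shuffleBadSet (Φ : Shuffle) : Set (ℝ ⊕ ℝ × ℝ) :=
  Sum.inl '' {D | ∃ h : 0 < D, ¬ ContinuousAt Φ.toFun ⟨D, h⟩} ∪
  Sum.inr '' {p | ∃ (h : 0 < p.1) (x : I), p.2 = x ∧ ¬ ContinuousAt (Φ.toFun ⟨p.1, h⟩) x}

/-- The set `B_f`: the heights of the jumps of `f`, together with the pairs `(Δ_r, x_r^t / Δ_r)`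
with `Δ_r > 0` and `x_r^t = x_r^s > 0` for some `s ≠ t`. -/
def excursionBadSet (f : Excursion) : Set (ℝ ⊕ ℝ × ℝ) :=
  Sum.inl '' {D | ∃ t, 0 < jump f t ∧ D = jump f t} ∪
  Sum.inr '' {p | ∃ r s t, s ≠ t ∧ 0 < jump f r ∧ relPos f r t = relPos f r s ∧
    0 < relPos f r s ∧ p = (jump f r, relPos f r t / jump f r)}

/-! ### The pseudo-distances coded by an excursion -/

/-- `δ_t(a,b)` for `a, b ∈ [0, Δ_t]`. -/
def loopDelta (f : I → ℝ) (t : I) (a b : ℝ) : ℝ := min |a - b| (jump f t - |a - b|)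

open Classical in
/-- The shuffled `δ_t(a,b) = Δ_t δ(φ_{Δ_t}(a/Δ_t), φ_{Δ_t}(b/Δ_t))` for `a, b ∈ [0, Δ_t]`
if `Δ_t > 0`, and `0` otherwise. The clamping `projIcc` has no effect for such `a, b`. -/
def shuffledDelta (Φ : Shuffle) (f : I → ℝ) (t : I) (a b : ℝ) : ℝ :=
  if h : 0 < jump f t then
    jump f t * dist (Φ.toFun ⟨jump f t, h⟩ (projIcc 0 1 zero_le_one (a / jump f t)))
      (Φ.toFun ⟨jump f t, h⟩ (projIcc 0 1 zero_le_one (b / jump f t)))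
  else 0

/-- `∑_{s ≺ r ≼ t} δ_r(0, x_r^t)`. -/
def loopDist₀ (f : Excursion) (s t : I) : ℝ :=
  ∑' r : {r : I // StrictAnc f s r ∧ Anc f r t}, loopDelta f r 0 (relPos f r t)

/-- The same sum with the shuffled `δ_r`. -/
def shuffledLoopDist₀ (Φ : Shuffle) (f : Excursion) (s t : I) : ℝ :=
  ∑' r : {r : I // StrictAnc f s r ∧ Anc f r t}, shuffledDelta Φ f r 0 (relPos f r t)

/-- The pseudo-distance of the looptree coded by `f`. -/
def loopDist (f : Excursion) (s t : I) : ℝ :=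
  loopDelta f (mrca f s t) (relPos f (mrca f s t) s) (relPos f (mrca f s t) t)
    + loopDist₀ f (mrca f s t) s + loopDist₀ f (mrca f s t) t

/-- The pseudo-distance of the shuffled looptree coded by `f`. -/
def shuffledLoopDist (Φ : Shuffle) (f : Excursion) (s t : I) : ℝ :=
  shuffledDelta Φ f (mrca f s t) (relPos f (mrca f s t) s) (relPos f (mrca f s t) t)
    + shuffledLoopDist₀ Φ f (mrca f s t) s + shuffledLoopDist₀ Φ f (mrca f s t) t

/-- The tree pseudo-distance between `t` and an ancestor `s ≼ t`. -/
def treeDist₀ (f : Excursion) (s t : I) : ℝ :=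
  f t - infOn f s t - ∑' r : {r : I // StrictAnc f s r ∧ Anc f r t}, relPos f r t

/-- The pseudo-distance of the tree coded by `f`. -/
def treeDist (f : Excursion) (s t : I) : ℝ :=
  treeDist₀ f (mrca f s t) s + treeDist₀ f (mrca f s t) t

/-- The pseudo-distance of the vernation tree coded by `f`. -/
def vernDist (f : Excursion) (s t : I) : ℝ := treeDist f s t + 2 * loopDist f s t

/-- The pseudo-distance of the shuffled vernation tree coded by `f`. -/
def shuffledVernDist (Φ : Shuffle) (f : Excursion) (s t : I) : ℝ :=
  treeDist f s t + 2 * shuffledLoopDist Φ f s t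

/-! ### Pointed weighted compact metric spaces and the GHP distance -/

/-- A compact metric space with a root and a Borel probability measure. -/
structure PWSpace where
  carrier : Type
  [metricSpace : MetricSpace carrier]
  [compactSpace : CompactSpace carrier]
  [measurableSpace : MeasurableSpace carrier]
  [borelSpace : BorelSpace carrier]
  root : carrier
  measure : Measure carrier
  [isProbabilityMeasure : IsProbabilityMeasure measure]

attribute [instance] PWSpace.metricSpace PWSpace.compactSpace PWSpace.measurableSpace
  PWSpace.borelSpace PWSpace.isProbabilityMeasure

/-- Correspondences between two sets. -/
def IsCorrespondence {X Y : Type*} (R : Set (X × Y)) : Prop :=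
  (∀ x, ∃ y, (x, y) ∈ R) ∧ ∀ y, ∃ x, (x, y) ∈ R

/-- The distortion of a correspondence. -/
def distortion {X Y : Type*} [MetricSpace X] [MetricSpace Y] (R : Set (X × Y)) : ℝ :=
  sSup {c | ∃ p ∈ R, ∃ q ∈ R, c = |dist p.1 q.1 - dist p.2 q.2|}

/-- The pointed Gromov–Hausdorff–Prokhorov distance: the infimum of
`max (dis R / 2) (1 - ν R)` over the compact correspondences `R` containing the pair of roots and
the couplings `ν` of the two measures. -/
def ghpDist (X Y : PWSpace) : ℝ :=
  sInf {c | ∃ (R : Set (X.carrier × Y.carrier)) (ν : Measure (X.carrier × Y.carrier)),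
    IsCompact R ∧ IsCorrespondence R ∧ (X.root, Y.root) ∈ R ∧
    ν.map Prod.fst = X.measure ∧ ν.map Prod.snd = Y.measure ∧
    c = max (distortion R / 2) (1 - ν.real R)}

/-- The space `∂` with a unique point. -/
def onePoint : PWSpace :=
  letI : MeasurableSpace Unit := borel Unit
  haveI : BorelSpace Unit := ⟨rfl⟩
  { carrier := Unit, root := (), measure := Measure.dirac () }

/-! ### Quotients of `[0,1]` by a pseudo-distance -/

/-- Pseudo-distances on `[0,1]`. -/
structure IsPseudoDist (d : I → I → ℝ) : Prop where
  self : ∀ s, d s s = 0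
  comm : ∀ s t, d s t = d t s
  triangle : ∀ r s t, d r t ≤ d r s + d s t

/-- The set `[0,1]`, endowed with the pseudo-distance `d` instead of the usual one. -/
def PseudoI (d : I → I → ℝ) (_ : IsPseudoDist d) : Type := I

instance (d : I → I → ℝ) (h : IsPseudoDist d) : PseudoMetricSpace (PseudoI d h) where
  dist := d
  dist_self := h.self
  dist_comm := h.comm
  dist_triangle := h.triangle

/-- The metric space `[0,1]/{d = 0}`. -/
abbrev QuotientI (d : I → I → ℝ) (h : IsPseudoDist d) : Type := SeparationQuotient (PseudoI d h)

/-- The canonical projection from `[0,1]` to `[0,1]/{d = 0}`. -/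
def proj (d : I → I → ℝ) (h : IsPseudoDist d) (t : I) : QuotientI d h :=
  SeparationQuotient.mk (X := PseudoI d h) t

/-- `d` is a pseudo-distance on `[0,1]` whose quotient metric space is compact and whose canonical
projection is Borel, so that the quotient is a pointed weighted compact metric space. -/
structure IsCode (d : I → I → ℝ) : Prop where
  isPseudoDist : IsPseudoDist d
  compactSpace : CompactSpace (QuotientI d isPseudoDist)
  measurable : @Measurable _ _ _ (borel _) (proj d isPseudoDist)

/-- The pointed weighted metric space `[0,1]/{d = 0}`, rooted at the projection of `1` and endowed
with the image of the Lebesgue measure. -/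
def quotientSpace (d : I → I → ℝ) (h : IsCode d) : PWSpace :=
  letI : MeasurableSpace (QuotientI d h.isPseudoDist) := borel _
  haveI : BorelSpace (QuotientI d h.isPseudoDist) := ⟨rfl⟩
  haveI := h.compactSpace
  { carrier := QuotientI d h.isPseudoDist
    root := proj d h.isPseudoDist 1
    measure := (volume : Measure I).map (proj d h.isPseudoDist)
    isProbabilityMeasure := Measure.isProbabilityMeasure_map h.measurable.aemeasurable }

/-- The `[0,1]/{d_n = 0}` are pointed weighted compact metric spaces which converge to `X` for the
pointed Gromov–Hausdorff–Prokhorov topology. -/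
def GHPTendsto (dn : ℕ → I → I → ℝ) (X : PWSpace) : Prop :=
  ∃ hn : ∀ n, IsCode (dn n),
    Tendsto (fun n => ghpDist (quotientSpace (dn n) (hn n)) X) atTop (𝓝 0)

/-- The `[0,1]/{d_n = 0}` and `[0,1]/{d = 0}` are pointed weighted compact metric spaces, and the
former converge to the latter for the pointed Gromov–Hausdorff–Prokhorov topology. -/
def QuotientsTendsto (dn : ℕ → I → I → ℝ) (d : I → I → ℝ) : Prop :=
  ∃ h : IsCode d, GHPTendsto dn (quotientSpace d h)

end Vernation

end

/-!
Convergence of looptrees, trees and vernation trees coded by excursions.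

*One formula for all the distances.* A strict ancestor of `s ∧ t` sees `s` and `t` at the same
position, and a time that is not an ancestor of `t` sees `t` at position `0`. Therefore the common
ancestor can be eliminated from the definitions (`Excursion.mrca_sum_eq_tsum`): the loop distance is
`∑_r e_r(x_r^s, x_r^t)` over all times `r`, where `e_r` is the distance on the loop of the jump
at `r`, and `d_T(s,t) = f(s) + f(t) - 2 inf f - ∑_r |x_r^s - x_r^t|`. Everything is
controlled by the packing inequality `Excursion.sum_infOn_sub_le`: the jumps of the ancestors of `v`
occupy disjoint intervals of heights below `f(v)`. It makes the sums converge, and shows that `f` cut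
at finitely many jumps codes a real tree (`Excursion.infBetween_cut`), whence the triangle inequality
for `d_T`. Standard loops and shuffled loops are both instances of a `LoopShape`, and
`d_L`, `d_T`, `d_V` and the shuffled `d_V` are of the form `LoopShape.gdist`, that is
`α d_T + β d_L`.

*Compactness.* The map from `[0,1]` to the quotient is right-continuous and has left limits in the
quotient (`LoopShape.tendsto_gdist_right`, `LoopShape.exists_tendsto_gdist_left`), which makes the
quotient compact and the projection measurable (`isCode_of_tendsto`).

*Convergence.* `Theta f` is again an excursion and codes the same spaces, and changes of time do not
affect the distances (`LoopShape.gdist_timeChange`); so one may assume that the excursions `F n`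
converge to `f` uniformly. If the loops of small jumps contribute to the distance almost as segments
would, uniformly in `n` (`LoopShape.TailControl`), then only finitely many jumps matter
(`LoopShape.abs_gdist_sub_le`): besides these, at most one small jump separates `s` and `t` at two
positive positions. For each of the finitely many big jumps, the positions on the loop converge
uniformly away from finitely many critical times, at which a loop may be discontinuous
(`LoopShape.exists_finite_pos_tendsto`); by the assumption on the bad sets, a critical time is alone
at its position, so the excursion is continuous there and at its lowest level since the jump. Nearby
times then only travel along that loop, and they are close to one of two given times on either
side of the critical one (`LoopShape.IsCritical.eventually_gdist_le`). Hence the noncritical times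
are dense up to a small error in all the spaces, the distances between them converge uniformly, and
they provide a correspondence of small distortion that carries most of the mass
(`ghpDist_le`, `LoopShape.tendsto_ghpDist`).

*Control of the small jumps.* For a shuffle, `2 δ(φ_D(0), φ_D(x)) / x → 1` as `D → 0`
(`Shuffle.tailControl`). If there are at most `N` jumps, those below `ε / N` contribute at most `ε`
(`smallJumps_of_encard_le`). If `f` has pure jump growth, a compactness argument in the manner of
Dini shows that finitely many jumps account for all heights up to `ε`, for `f` and then for `F n`
(`Excursion.exists_cut_le`); in that case the tree distances tend to `0` uniformly as well
(`Excursion.treeDist_le_cut`).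
-/


noncomputable section

namespace Vernation

/-! ### Infima over intervals and left limits -/

theorem infOn_le {g : I → ℝ} (hg : ∀ t, 0 ≤ g t) {s t v : I} (h1 : s ≤ v) (h2 : v ≤ t) :
    infOn g s t ≤ g v :=
  csInf_le ⟨0, by rintro _ ⟨u, _, rfl⟩; exact hg u⟩ ⟨v, ⟨h1, h2⟩, rfl⟩

theorem le_infOn {g : I → ℝ} {s t : I} (h : s ≤ t) {c : ℝ}
    (H : ∀ v, s ≤ v → v ≤ t → c ≤ g v) : c ≤ infOn g s t := by
  refine le_csInf ⟨g s, s, ⟨le_rfl, h⟩, rfl⟩ ?_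
  rintro _ ⟨u, hu, rfl⟩
  exact H u hu.1 hu.2

theorem exists_lt_of_infOn_lt {g : I → ℝ} {s t : I} (h : s ≤ t) {c : ℝ} (H : infOn g s t < c) :
    ∃ v, s ≤ v ∧ v ≤ t ∧ g v < c := by
  by_contra! hc
  exact absurd (le_infOn h hc) (not_le.2 H)

theorem infOn_nonneg {g : I → ℝ} (hg : ∀ t, 0 ≤ g t) (s t : I) : 0 ≤ infOn g s t := by
  apply Real.sInf_nonneg
  rintro _ ⟨u, _, rfl⟩
  exact hg u

theorem infOn_self (g : I → ℝ) (t : I) : infOn g t t = g t := by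
  simp [infOn]

theorem infOn_anti {g : I → ℝ} (hg : ∀ t, 0 ≤ g t) {r r' s s' : I} (h1 : r' ≤ r) (h : r ≤ s)
    (h2 : s ≤ s') : infOn g r' s' ≤ infOn g r s :=
  le_infOn h fun _ hv hv' => infOn_le hg (h1.trans hv) (hv'.trans h2)

theorem infOn_split {g : I → ℝ} (hg : ∀ t, 0 ≤ g t) {r s t : I} (h1 : r ≤ s) (h2 : s ≤ t) :
    infOn g r t = min (infOn g r s) (infOn g s t) := by
  apply le_antisymm
  · exact le_min (infOn_anti hg le_rfl h1 h2) (infOn_anti hg h1 h2 le_rfl)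
  · refine le_infOn (h1.trans h2) fun v hv hv' => ?_
    rcases le_total v s with h | h
    · exact (min_le_left _ _).trans (infOn_le hg hv h)
    · exact (min_le_right _ _).trans (infOn_le hg h hv')

theorem abs_infOn_sub_le {g h : I → ℝ} (hg : ∀ t, 0 ≤ g t) (hh : ∀ t, 0 ≤ h t) {ε : ℝ}
    (hε : ∀ t, |g t - h t| ≤ ε) {s t : I} (hst : s ≤ t) : |infOn g s t - infOn h s t| ≤ ε := by
  rw [abs_le]
  constructor
  · have : infOn h s t - ε ≤ infOn g s t := le_infOn hst fun v hv hv' => by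
      have h1 := infOn_le hh hv hv'
      have h2 := abs_le.1 (hε v)
      linarith
    linarith
  · have : infOn g s t - ε ≤ infOn h s t := le_infOn hst fun v hv hv' => by
      have h1 := infOn_le hg hv hv'
      have h2 := abs_le.1 (hε v)
      linarith
    linarith

theorem nhdsLT_neBot {t : I} (ht : 0 < t) : (𝓝[<] t).NeBot :=
  nhdsLT_neBot_of_exists_lt ⟨0, ht⟩

theorem nhdsLT_zero_eq_bot : 𝓝[<] (0 : I) = ⊥ := by
  rw [show Iio (0 : I) = ∅ from Iio_eq_empty_iff.2 fun _ _ => unitInterval.nonneg',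
    nhdsWithin_empty]

theorem nhdsGT_one_eq_bot : 𝓝[>] (1 : I) = ⊥ := by
  rw [show Ioi (1 : I) = ∅ from Ioi_eq_empty_iff.2 fun _ _ => unitInterval.le_one',
    nhdsWithin_empty]

theorem nhdsGT_neBot {t : I} (ht : t < 1) : (𝓝[>] t).NeBot :=
  nhdsGT_neBot_of_exists_gt ⟨1, ht⟩

namespace Excursion

variable (f : Excursion)

theorem leftVal_zero : leftVal f 0 = 0 := by simp [leftVal]

theorem leftVal_le (t : I) : leftVal f t ≤ f t := by
  have := f.jump_nonneg t
  unfold jump at this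
  linarith

theorem tendsto_left {t : I} (ht : 0 < t) : Tendsto f (𝓝[<] t) (𝓝 (leftVal f t)) :=
  tendsto_leftVal f ht.ne'

theorem tendsto_right (t : I) : Tendsto f (𝓝[>] t) (𝓝 (f t)) :=
  (f.right_continuous t).mono_left (nhdsWithin_mono _ Ioi_subset_Ici_self)

theorem le_leftVal {c : ℝ} {s t : I} (hst : s < t) (H : ∀ v, s ≤ v → v < t → c ≤ f v) :
    c ≤ leftVal f t := by
  have ht : 0 < t := lt_of_le_of_lt s.2.1 hst
  have := nhdsLT_neBot ht
  refine ge_of_tendsto (f.tendsto_left ht) ?_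
  filter_upwards [Ioo_mem_nhdsLT hst] with v hv
  exact H v hv.1.le hv.2

theorem leftVal_nonneg (t : I) : 0 ≤ leftVal f t := by
  rcases eq_or_lt_of_le (unitInterval.nonneg' : (0 : I) ≤ t) with h | h
  · rw [← h, leftVal_zero]
  · exact f.le_leftVal h fun v _ _ => f.nonneg v

theorem infOn_le_leftVal {s r t : I} (h1 : s < r) (h2 : r ≤ t) : infOn f s t ≤ leftVal f r :=
  f.le_leftVal h1 fun _ hv hv' => infOn_le f.nonneg hv (hv'.le.trans h2)

theorem exists_lt_left {c : ℝ} {t : I} (ht : 0 < t) (h : c < leftVal f t) :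
    ∃ s < t, ∀ v, s < v → v < t → c < f v := by
  obtain ⟨a, ha, hs⟩ := (mem_nhdsLT_iff_exists_Ioo_subset' ht).1
    ((f.tendsto_left ht).eventually_const_lt h)
  exact ⟨a, ha, fun v h1 h2 => hs ⟨h1, h2⟩⟩

theorem exists_left_lt {c : ℝ} {t : I} (ht : 0 < t) (h : leftVal f t < c) :
    ∃ s < t, ∀ v, s < v → v < t → f v < c := by
  obtain ⟨a, ha, hs⟩ := (mem_nhdsLT_iff_exists_Ioo_subset' ht).1
    ((f.tendsto_left ht).eventually_lt_const h)
  exact ⟨a, ha, fun v h1 h2 => hs ⟨h1, h2⟩⟩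

end Excursion

theorem abs_leftVal_sub_le (f g : Excursion) {ε : ℝ} (hε : ∀ t, |f t - g t| ≤ ε) (t : I) :
    |leftVal f t - leftVal g t| ≤ ε := by
  rcases eq_or_lt_of_le (unitInterval.nonneg' : (0 : I) ≤ t) with h | h
  · rw [← h, f.leftVal_zero, g.leftVal_zero]
    simpa using (abs_nonneg _).trans (hε 0)
  · have := nhdsLT_neBot h
    exact le_of_tendsto ((f.tendsto_left h).sub (g.tendsto_left h)).abs
      (Eventually.of_forall fun v => hε v)

theorem abs_jump_sub_le (f g : Excursion) {ε : ℝ} (hε : ∀ t, |f t - g t| ≤ ε) (t : I) :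
    |jump f t - jump g t| ≤ 2 * ε := by
  have h1 := abs_le.1 (hε t)
  have h2 := abs_le.1 (abs_leftVal_sub_le f g hε t)
  unfold jump
  rw [abs_le]
  constructor <;> linarith

/-! ### The positions `x_r^t` and the genealogical order -/

theorem relPos_nonneg (g : I → ℝ) (r t : I) : 0 ≤ relPos g r t := by
  unfold relPos
  split_ifs
  · exact le_max_right _ _
  · exact le_rfl

theorem relPos_of_le {g : I → ℝ} {r t : I} (h : r ≤ t) :
    relPos g r t = max (infOn g r t - leftVal g r) 0 := if_pos h

theorem relPos_of_lt {g : I → ℝ} {r t : I} (h : t < r) : relPos g r t = 0 :=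
  if_neg (not_le.2 h)

theorem relPos_of_anc {g : I → ℝ} {r t : I} (h : Anc g r t) :
    relPos g r t = infOn g r t - leftVal g r := by
  rw [relPos_of_le h.1, max_eq_left]
  linarith [h.2]

theorem relPos_of_not_anc {g : I → ℝ} {r t : I} (h : ¬ Anc g r t) : relPos g r t = 0 := by
  by_cases hrt : r ≤ t
  · rw [relPos_of_le hrt, max_eq_right]
    by_contra! hc
    exact h ⟨hrt, by linarith⟩
  · exact if_neg hrt

theorem anc_of_relPos_pos {g : I → ℝ} {r t : I} (h : 0 < relPos g r t) : Anc g r t := by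
  by_contra hc
  rw [relPos_of_not_anc hc] at h
  exact lt_irrefl _ h

theorem abs_relPos_sub_le (f g : Excursion) {ε : ℝ} (hε : ∀ t, |f t - g t| ≤ ε) (r t : I) :
    |relPos f r t - relPos g r t| ≤ 2 * ε := by
  by_cases h : r ≤ t
  · rw [relPos_of_le h, relPos_of_le h]
    have h1 := abs_le.1 (abs_infOn_sub_le f.nonneg g.nonneg hε h)
    have h2 := abs_le.1 (abs_leftVal_sub_le f g hε r)
    refine (abs_max_sub_max_le_abs _ _ _).trans ?_
    rw [abs_le]
    constructor <;> linarith
  · have h0 : 0 ≤ ε := (abs_nonneg _).trans (hε 0)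
    rw [relPos_of_lt (not_le.1 h), relPos_of_lt (not_le.1 h)]
    simpa using h0

namespace Excursion

variable (f : Excursion)

theorem relPos_self (t : I) : relPos f t t = jump f t := by
  rw [relPos_of_le le_rfl, infOn_self, max_eq_left]
  · rfl
  · exact f.jump_nonneg t

theorem relPos_anti {r s t : I} (h1 : r ≤ s) (h2 : s ≤ t) : relPos f r t ≤ relPos f r s := by
  rw [relPos_of_le h1, relPos_of_le (h1.trans h2)]
  exact max_le_max (sub_le_sub_right (infOn_anti f.nonneg le_rfl h1 h2) _) le_rfl

theorem relPos_le_jump (r t : I) : relPos f r t ≤ jump f r := by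
  by_cases h : r ≤ t
  · rw [← f.relPos_self r]
    exact f.relPos_anti le_rfl h
  · rw [relPos_of_lt (not_le.1 h)]
    exact f.jump_nonneg r

theorem relPos_one (r : I) : relPos f r 1 = 0 := by
  have h1 : infOn f r 1 ≤ 0 := by
    have := infOn_le f.nonneg (unitInterval.le_one' : r ≤ 1) le_rfl
    rwa [f.map_one] at this
  rw [relPos_of_le unitInterval.le_one', max_eq_right]
  linarith [f.leftVal_nonneg r]

theorem anc_refl (t : I) : Anc f t t := ⟨le_rfl, by rw [infOn_self]; exact f.leftVal_le t⟩

theorem anc_of_anc_le {r s t : I} (h : Anc f r t) (h1 : r ≤ s) (h2 : s ≤ t) : Anc f r s :=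
  ⟨h1, h.2.trans (infOn_anti f.nonneg le_rfl h1 h2)⟩

/-- Beyond a strict ancestor `r'` of `s`, the infimum from `r < r'` no longer decreases. -/
theorem infOn_eq_of_anc {r r' s : I} (h : r < r') (h' : Anc f r' s) :
    infOn f r s = infOn f r r' := by
  rw [infOn_split f.nonneg h.le h'.1, min_eq_left]
  exact (f.infOn_le_leftVal h le_rfl).trans h'.2

theorem relPos_eq_of_anc {r r' s t : I} (h : r < r') (hs : Anc f r' s) (ht : Anc f r' t) :
    relPos f r s = relPos f r t := by
  rw [relPos_of_le (h.le.trans hs.1), relPos_of_le (h.le.trans ht.1), f.infOn_eq_of_anc h hs,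
    f.infOn_eq_of_anc h ht]

/-! ### Packing the jumps of the ancestors below a point -/

/-- The intervals `[f(r-), inf_{[r,v]} f]` attached to the ancestors `r` of `v` are stacked above
each other below `f(v)`; hence any subintervals `[a_r, inf_{[r,v]} f]` above level `c` have total
length at most `f(v) - c`. -/
theorem sum_infOn_sub_le (v : I) (a : I → ℝ) (T : Finset I) :
    ∀ c, c ≤ f v → (∀ r ∈ T, r ≤ v ∧ leftVal f r ≤ a r ∧ a r ≤ infOn f r v ∧ c ≤ a r) →
      ∑ r ∈ T, (infOn f r v - a r) ≤ f v - c := by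
  induction T using Finset.induction_on_min with
  | empty => intro c hc _; simpa using hc
  | insert r T hr ih =>
    intro c hc H
    have hrT : r ∉ T := fun h => lt_irrefl _ (hr r h)
    rw [Finset.sum_insert hrT]
    obtain ⟨h1, h2, h3, h4⟩ := H r (Finset.mem_insert_self _ _)
    have := ih (infOn f r v) (infOn_le f.nonneg h1 le_rfl) fun q hq => by
      obtain ⟨k1, k2, k3, k4⟩ := H q (Finset.mem_insert_of_mem hq)
      exact ⟨k1, k2, k3, (f.infOn_le_leftVal (hr q hq) k1).trans k2⟩
    linarith

/-- The jumps after `s` of the ancestors of `v` fit between the levels `inf_{[s,v]} f` and `f(v)`. -/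
theorem sum_relPos_le_sub {s v : I} (hsv : s ≤ v) (T : Finset I) (hT : ∀ r ∈ T, s < r) :
    ∑ r ∈ T, relPos f r v ≤ f v - infOn f s v := by
  classical
  have h1 : ∑ r ∈ T, relPos f r v = ∑ r ∈ T with Anc f r v, (infOn f r v - leftVal f r) := by
    rw [Finset.sum_filter]
    refine Finset.sum_congr rfl fun r _ => ?_
    split_ifs with h
    · exact relPos_of_anc h
    · exact relPos_of_not_anc h
  rw [h1]
  refine f.sum_infOn_sub_le v _ _ _ (infOn_le f.nonneg hsv le_rfl) fun r hr => ?_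
  rw [Finset.mem_filter] at hr
  exact ⟨hr.2.1, le_rfl, hr.2.2, f.infOn_le_leftVal (hT r hr.1) hr.2.1⟩

theorem sum_relPos_le (v : I) (T : Finset I) : ∑ r ∈ T, relPos f r v ≤ f v := by
  classical
  have h1 : ∑ r ∈ T, relPos f r v = ∑ r ∈ T with Anc f r v, (infOn f r v - leftVal f r) := by
    rw [Finset.sum_filter]
    refine Finset.sum_congr rfl fun r _ => ?_
    split_ifs with h
    · exact relPos_of_anc h
    · exact relPos_of_not_anc h
  rw [h1, ← sub_zero (f v)]
  refine f.sum_infOn_sub_le v _ _ _ (f.nonneg v) fun r hr => ?_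
  rw [Finset.mem_filter] at hr
  exact ⟨hr.2.1, le_rfl, hr.2.2, f.leftVal_nonneg r⟩

theorem summable_relPos (v : I) : Summable fun r => relPos f r v :=
  summable_of_sum_le (fun r => relPos_nonneg f r v) (f.sum_relPos_le v)

theorem min_relPos_le {s t v : I} (h1 : s ≤ v) (h2 : v ≤ t) (r : I) :
    min (relPos f r s) (relPos f r t) ≤ relPos f r v := by
  by_cases h : r ≤ s
  · exact (min_le_right _ _).trans (f.relPos_anti (h.trans h1) h2)
  · rw [relPos_of_lt (not_le.1 h)]
    exact (min_le_left _ _).trans (relPos_nonneg _ _ _)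

/-- For `v` between `s` and `t`, the parts of the jumps below `v` that are in excess of those which
`s` and `t` share lie above the level `inf_{[s,t]} f`. -/
theorem sum_relPos_sub_min_le {s t v : I} (h1 : s ≤ v) (h2 : v ≤ t) (T : Finset I) :
    ∑ r ∈ T, (relPos f r v - min (relPos f r s) (relPos f r t)) ≤ f v - infOn f s t := by
  classical
  set m : I → ℝ := fun r => min (relPos f r s) (relPos f r t) with hm
  have hm0 : ∀ r, 0 ≤ m r := fun r => le_min (relPos_nonneg _ _ _) (relPos_nonneg _ _ _)
  have e1 : ∑ r ∈ T, (relPos f r v - m r)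
      = ∑ r ∈ T with m r < relPos f r v, (infOn f r v - (leftVal f r + m r)) := by
    rw [Finset.sum_filter]
    refine Finset.sum_congr rfl fun r _ => ?_
    split_ifs with h
    · rw [relPos_of_anc (anc_of_relPos_pos ((hm0 r).trans_lt h))]
      ring
    · have := f.min_relPos_le h1 h2 r
      exact sub_eq_zero.2 (le_antisymm (not_lt.1 h) this)
  rw [e1]
  refine f.sum_infOn_sub_le v _ _ _ (infOn_le f.nonneg h1 h2) fun r hr => ?_
  have hlt := (Finset.mem_filter.1 hr).2
  have hanc := anc_of_relPos_pos ((hm0 r).trans_lt hlt)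
  have hx := relPos_of_anc hanc
  refine ⟨hanc.1, by linarith [hm0 r], by linarith, ?_⟩
  -- if `r ≤ s`, the part shared with `t` is less than that of `v`, so the infimum of `f` over `[r,t]`
  -- is reached in `[v,t]`; if `s < r`, the whole jump lies above `inf_{[s,t]} f`
  by_cases hrs : r ≤ s
  · have hmr : m r = relPos f r t := min_eq_right (f.relPos_anti hrs (h1.trans h2))
    have hxt := relPos_of_le (g := f) (hrs.trans (h1.trans h2))
    have hle : infOn f r t ≤ leftVal f r + m r := by
      have := le_max_left (infOn f r t - leftVal f r) 0
      rw [hmr, hxt]; linarith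
    have hsp := infOn_split f.nonneg (hrs.trans h1) h2
    have hlt' : infOn f r t < infOn f r v := by linarith
    have hvt : infOn f r t = infOn f v t := by
      rw [hsp] at hlt' ⊢
      rcases min_choice (infOn f r v) (infOn f v t) with h | h
      · rw [h] at hlt'; exact absurd hlt' (lt_irrefl _)
      · exact h
    exact (infOn_anti f.nonneg h1 h2 le_rfl).trans (hvt ▸ hle)
  · have hsr := not_le.1 hrs
    have := f.infOn_le_leftVal hsr (hanc.1.trans h2)
    linarith [hm0 r]

/-- The tree pseudo-distance is nonnegative: the jumps on which `s` and `t` sit at different positions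
fit between `inf_{[s,t]} f` and the heights of `s` and `t`. -/
theorem sum_abs_relPos_sub_le {s t : I} (h : s ≤ t) (T : Finset I) :
    ∑ r ∈ T, |relPos f r s - relPos f r t| ≤ f s + f t - 2 * infOn f s t := by
  have h1 := f.sum_relPos_sub_min_le le_rfl h T
  have h2 := f.sum_relPos_sub_min_le h le_rfl T
  have : ∑ r ∈ T, |relPos f r s - relPos f r t|
      = ∑ r ∈ T, (relPos f r s - min (relPos f r s) (relPos f r t))
        + ∑ r ∈ T, (relPos f r t - min (relPos f r s) (relPos f r t)) := by
    rw [← Finset.sum_add_distrib]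
    refine Finset.sum_congr rfl fun r _ => ?_
    have a := min_add_max (relPos f r s) (relPos f r t)
    have b := max_sub_min_eq_abs (relPos f r s) (relPos f r t)
    rw [abs_sub_comm] at b
    linarith
  linarith

theorem summable_abs_relPos_sub (s t : I) : Summable fun r => |relPos f r s - relPos f r t| :=
  ((f.summable_relPos s).sub (f.summable_relPos t)).abs

/-! ### Regularity of excursions and of running infima -/

theorem eventually_infOn_eq_or_lt {r t : I} (h : r < t) {ε : ℝ} (hε : 0 < ε) :
    ∃ s₀, r ≤ s₀ ∧ s₀ < t ∧ ∀ s, s₀ < s → s < t → infOn f r s < infOn f r t + ε := by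
  obtain ⟨v, h1, h2, h3⟩ := exists_lt_of_infOn_lt h.le (lt_add_of_pos_right (infOn f r t) hε)
  rcases eq_or_lt_of_le h2 with rfl | hlt
  · obtain ⟨a, ha, hav⟩ := f.exists_left_lt (lt_of_le_of_lt r.2.1 h)
      ((f.leftVal_le v).trans_lt h3)
    refine ⟨max r a, le_max_left _ _, max_lt h ha, fun s hs hs' => ?_⟩
    exact (infOn_le f.nonneg ((le_max_left _ _).trans hs.le) le_rfl).trans_lt
      (hav s ((le_max_right _ _).trans_lt hs) hs')
  · exact ⟨v, h1, hlt, fun s hs _ => (infOn_le f.nonneg h1 hs.le).trans_lt h3⟩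

theorem tendsto_infOn_left {r t : I} (h : r < t) :
    Tendsto (fun s => infOn f r s) (𝓝[<] t) (𝓝 (infOn f r t)) := by
  rw [tendsto_order]
  constructor
  · intro a ha
    filter_upwards [Ioo_mem_nhdsLT h] with s hs
    exact ha.trans_le (infOn_anti f.nonneg le_rfl hs.1.le hs.2.le)
  · intro a ha
    obtain ⟨s₀, _, h2, h3⟩ := f.eventually_infOn_eq_or_lt h (sub_pos.2 ha)
    filter_upwards [Ioo_mem_nhdsLT h2] with s hs
    have := h3 s hs.1 hs.2
    linarith

theorem tendsto_infOn_right {r t : I} (h : r ≤ t) :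
    Tendsto (fun s => infOn f r s) (𝓝[>] t) (𝓝 (infOn f r t)) := by
  rcases eq_or_lt_of_le (unitInterval.le_one' : t ≤ 1) with rfl | ht1
  · rw [nhdsGT_one_eq_bot]; exact tendsto_bot
  rw [tendsto_order]
  constructor
  · intro a ha
    obtain ⟨b, hab, hb⟩ := exists_between ha
    have hft : b < f t := hb.trans_le (infOn_le f.nonneg h le_rfl)
    obtain ⟨u, hu, hs⟩ := (mem_nhdsGT_iff_exists_Ioo_subset' ht1).1
      ((f.tendsto_right t).eventually_const_lt hft)
    filter_upwards [Ioo_mem_nhdsGT hu] with s hs'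
    refine hab.trans_le (le_infOn (h.trans hs'.1.le) fun v hv hv' => ?_)
    rcases le_or_gt v t with hvt | hvt
    · exact hb.le.trans (infOn_le f.nonneg hv hvt)
    · exact le_of_lt (hs ⟨hvt, hv'.trans_lt hs'.2⟩ : b < f v)
  · intro a ha
    filter_upwards [self_mem_nhdsWithin] with s hs
    exact (infOn_anti f.nonneg le_rfl h (le_of_lt hs)).trans_lt ha

theorem tendsto_relPos_left {r t : I} (h : r < t) :
    Tendsto (fun s => relPos f r s) (𝓝[<] t) (𝓝 (relPos f r t)) := by
  rw [relPos_of_le h.le]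
  refine (((f.tendsto_infOn_left h).sub_const _).max tendsto_const_nhds).congr' ?_
  filter_upwards [Ioo_mem_nhdsLT h] with s hs
  exact (relPos_of_le hs.1.le).symm

theorem tendsto_relPos_right (r t : I) :
    Tendsto (fun s => relPos f r s) (𝓝[>] t) (𝓝 (relPos f r t)) := by
  rcases le_or_gt r t with h | h
  · rw [relPos_of_le h]
    refine (((f.tendsto_infOn_right h).sub_const _).max tendsto_const_nhds).congr' ?_
    filter_upwards [self_mem_nhdsWithin] with s hs
    exact (relPos_of_le (h.trans (le_of_lt hs))).symm
  · rw [relPos_of_lt h]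
    refine tendsto_const_nhds.congr' ?_
    filter_upwards [Ioo_mem_nhdsGT h] with s hs
    exact (relPos_of_lt hs.2).symm

theorem continuousOn_relPos (r : I) : ContinuousOn (fun s => relPos f r s) (Ici r) := by
  intro t ht
  have hR : ContinuousWithinAt (fun s => relPos f r s) (Ici t) t := by
    rw [← continuousWithinAt_Ioi_iff_Ici]
    exact f.tendsto_relPos_right r t
  rcases eq_or_lt_of_le (show r ≤ t from ht) with e | h
  · rw [← e] at hR ⊢; exact hR
  · have hL : ContinuousWithinAt (fun s => relPos f r s) (Iic t) t := by
      rw [← continuousWithinAt_Iio_iff_Iic]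
      exact f.tendsto_relPos_left h
    exact (continuousAt_iff_continuous_left_right.2 ⟨hL, hR⟩).continuousWithinAt

/-- Upward jumps and right-continuity make an excursion upper semicontinuous, hence bounded. -/
theorem upperSemicontinuous : UpperSemicontinuous f := by
  intro t c hc
  rw [← nhdsLT_sup_nhdsGE, eventually_sup]
  refine ⟨?_, (f.right_continuous t).eventually_lt_const hc⟩
  rcases eq_or_lt_of_le (unitInterval.nonneg' : (0 : I) ≤ t) with e | h
  · rw [← e, nhdsLT_zero_eq_bot]; exact eventually_bot
  · exact (f.tendsto_left h).eventually_lt_const ((f.leftVal_le t).trans_lt hc)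

theorem exists_le : ∃ M, 0 ≤ M ∧ ∀ t, f t ≤ M := by
  obtain ⟨M, hM⟩ := (f.upperSemicontinuous.upperSemicontinuousOn univ).bddAbove_of_isCompact
    isCompact_univ
  refine ⟨M, (f.nonneg 0).trans (hM ⟨0, trivial, rfl⟩), fun t => hM ⟨t, trivial, rfl⟩⟩

theorem jump_le (t : I) : jump f t ≤ f t := by
  have := f.leftVal_nonneg t
  unfold jump; linarith

/-- An excursion goes down continuously: starting at `t`, it visits every level `c ≤ f t`. -/
theorem exists_first_hit {t : I} {c : ℝ} (h0 : 0 ≤ c) (hc : c ≤ f t) :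
    ∃ t', t ≤ t' ∧ f t' = c ∧ ∀ v, t ≤ v → v ≤ t' → c ≤ f v := by
  set A : Set I := {v | t ≤ v ∧ f v ≤ c} with hA
  have hne : A.Nonempty := ⟨1, unitInterval.le_one', by rw [f.map_one]; exact h0⟩
  have hglb : IsGLB A (sInf A) := isGLB_sInf A
  set t' := sInf A
  have htt' : t ≤ t' := hglb.2 fun v hv => hv.1
  -- `t'` is the first time after `t` at which `f` is at most `c`
  have hbefore : ∀ v, t ≤ v → v < t' → c < f v := fun v hv hv' => by
    by_contra! hle
    exact absurd (hglb.1 ⟨hv, hle⟩) (not_le.2 hv')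
  have hle : f t' ≤ c := by
    by_contra! hlt
    have hnot : t' ∉ A := fun h => absurd h.2 (not_le.2 hlt)
    rcases eq_or_lt_of_le (unitInterval.le_one' : t' ≤ 1) with e | ht1
    · rw [e, f.map_one] at hlt; linarith
    · obtain ⟨u, hu, hs⟩ := (mem_nhdsGT_iff_exists_Ioo_subset' ht1).1
        ((f.tendsto_right t').eventually_const_lt hlt)
      obtain ⟨w, hw, hwu⟩ := (isGLB_lt_iff hglb).1 hu
      have hw' : t' < w := lt_of_le_of_ne (hglb.1 hw) fun e => hnot (e ▸ hw)
      have : c < f w := hs ⟨hw', hwu⟩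
      linarith [hw.2]
  have hge : c ≤ f t' := by
    rcases eq_or_lt_of_le htt' with e | h
    · rw [← e]; exact hc
    · exact (f.le_leftVal h fun v hv hv' => (hbefore v hv hv').le).trans (f.leftVal_le t')
  refine ⟨t', htt', le_antisymm hle hge, fun v hv hv' => ?_⟩
  rcases eq_or_lt_of_le hv' with e | h
  · rw [e]; exact hge
  · exact (hbefore v hv h).le

/-- The jumps of an excursion accumulate nowhere, so only finitely many exceed a given level. -/
theorem finite_jump_ge {η : ℝ} (hη : 0 < η) : {t | η ≤ jump f t}.Finite := by
  have key : ∀ t : I, ∃ U ∈ 𝓝 t, ∀ r ∈ U, r ≠ t → jump f r < η := by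
    intro t
    have hR : ∀ᶠ r in 𝓝[>] t, jump f r < η := by
      rcases eq_or_lt_of_le (unitInterval.le_one' : t ≤ 1) with rfl | ht1
      · rw [nhdsGT_one_eq_bot]; exact eventually_bot
      obtain ⟨u, hu, hs⟩ := (mem_nhdsGT_iff_exists_Ioo_subset' ht1).1
        ((f.tendsto_right t).eventually (Metric.ball_mem_nhds (f t) (half_pos (half_pos hη))))
      filter_upwards [Ioo_mem_nhdsGT hu] with r hr
      have h1 : ∀ v, t < v → v ≤ r → |f v - f t| < η / 2 / 2 := fun v hv hv' =>
        hs ⟨hv, hv'.trans_lt hr.2⟩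
      obtain ⟨w, hw1, hw2⟩ := exists_between hr.1
      have h2 : f t - η / 2 / 2 ≤ leftVal f r := f.le_leftVal hw2 fun v hv hv' => by
        have := (abs_lt.1 (h1 v (hw1.trans_le hv) hv'.le)).1
        linarith
      have h3 := (abs_lt.1 (h1 r hr.1 le_rfl)).2
      unfold jump; linarith
    have hL : ∀ᶠ r in 𝓝[<] t, jump f r < η := by
      rcases eq_or_lt_of_le (unitInterval.nonneg' : (0 : I) ≤ t) with e | ht0
      · rw [← e, nhdsLT_zero_eq_bot]; exact eventually_bot
      obtain ⟨u, hu, hs⟩ := (mem_nhdsLT_iff_exists_Ioo_subset' ht0).1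
        ((f.tendsto_left ht0).eventually
          (Metric.ball_mem_nhds (leftVal f t) (half_pos (half_pos hη))))
      filter_upwards [Ioo_mem_nhdsLT hu] with r hr
      have h1 : ∀ v, u < v → v ≤ r → |f v - leftVal f t| < η / 2 / 2 := fun v hv hv' =>
        hs ⟨hv, hv'.trans_lt hr.2⟩
      obtain ⟨w, hw1, hw2⟩ := exists_between hr.1
      have h2 : leftVal f t - η / 2 / 2 ≤ leftVal f r := f.le_leftVal hw2 fun v hv hv' => by
        have := (abs_lt.1 (h1 v (hw1.trans_le hv) hv'.le)).1
        linarith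
      have h3 := (abs_lt.1 (h1 r hr.1 le_rfl)).2
      unfold jump; linarith
    have : ∀ᶠ r in 𝓝[≠] t, jump f r < η := by
      rw [← nhdsLT_sup_nhdsGT, eventually_sup]; exact ⟨hL, hR⟩
    rw [eventually_nhdsWithin_iff] at this
    exact ⟨_, this, fun r hr hne => hr hne⟩
  choose U hU hU' using key
  obtain ⟨S, -, hS⟩ := isCompact_univ.elim_nhds_subcover U fun t _ => hU t
  refine S.finite_toSet.subset fun r hr => ?_
  obtain ⟨t, ht, hrt⟩ := mem_iUnion₂.1 (hS (mem_univ r))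
  by_contra hne
  refine absurd (hU' t r hrt fun e => hne (e ▸ ht)) (not_lt.2 hr)

end Excursion

/-! ### Eliminating the most recent common ancestor -/

/-- The infimum of `g` over the interval with endpoints `s` and `t`, in either order. -/
def infBetween (g : I → ℝ) (s t : I) : ℝ := infOn g (min s t) (max s t)

theorem infBetween_comm (g : I → ℝ) (s t : I) : infBetween g s t = infBetween g t s := by
  rw [infBetween, infBetween, min_comm, max_comm]

theorem infBetween_of_le {g : I → ℝ} {s t : I} (h : s ≤ t) : infBetween g s t = infOn g s t := by
  rw [infBetween, min_eq_left h, max_eq_right h]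

theorem infBetween_self (g : I → ℝ) (t : I) : infBetween g t t = g t := by
  rw [infBetween_of_le le_rfl, infOn_self]

theorem abs_infBetween_sub_le {g h : I → ℝ} (hg : ∀ t, 0 ≤ g t) (hh : ∀ t, 0 ≤ h t) {ε : ℝ}
    (hε : ∀ t, |g t - h t| ≤ ε) (s t : I) : |infBetween g s t - infBetween h s t| ≤ ε :=
  abs_infOn_sub_le hg hh hε min_le_max

namespace Excursion

variable (f : Excursion)

theorem sum_abs_relPos_sub_le_between (s t : I) (T : Finset I) :
    ∑ r ∈ T, |relPos f r s - relPos f r t| ≤ f s + f t - 2 * infBetween f s t := by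
  rcases le_total s t with h | h
  · rw [infBetween_of_le h]
    exact f.sum_abs_relPos_sub_le h T
  · rw [infBetween_comm, infBetween_of_le h, add_comm (f s)]
    simp_rw [fun r => abs_sub_comm (relPos f r s)]
    exact f.sum_abs_relPos_sub_le h T

theorem anc_mrca_iff (s t r : I) : Anc f r (mrca f s t) ↔ Anc f r s ∧ Anc f r t :=
  (exists_mrca f s t).choose_spec r

theorem mrca_anc_left (s t : I) : Anc f (mrca f s t) s :=
  ((f.anc_mrca_iff s t _).1 (f.anc_refl _)).1

theorem mrca_anc_right (s t : I) : Anc f (mrca f s t) t :=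
  ((f.anc_mrca_iff s t _).1 (f.anc_refl _)).2

theorem mrca_comm (s t : I) : mrca f s t = mrca f t s :=
  le_antisymm
    ((f.anc_mrca_iff t s _).2 ⟨f.mrca_anc_right s t, f.mrca_anc_left s t⟩).1
    ((f.anc_mrca_iff s t _).2 ⟨f.mrca_anc_right t s, f.mrca_anc_left t s⟩).1

/-- The path from `s ∧ t` to `s` does not go below `inf_{[s,t]} f`. -/
theorem infOn_le_infOn_mrca {s t : I} (hst : s ≤ t) :
    infOn f s t ≤ infOn f (mrca f s t) s := by
  by_contra! hlt
  obtain ⟨c, hc1, hc2⟩ := exists_between hlt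
  have hus := (f.mrca_anc_left s t).1
  have hmax : ∀ r, Anc f r s → Anc f r t → r ≤ mrca f s t :=
    fun r h1 h2 => ((f.anc_mrca_iff s t r).2 ⟨h1, h2⟩).1
  set u := mrca f s t
  -- the last time before `s` at which `f` is below the level `c` is a common ancestor
  set A : Set I := {v | u ≤ v ∧ v ≤ s ∧ f v < c} with hA
  have hne : A.Nonempty := exists_lt_of_infOn_lt hus hc1
  have hlub : IsLUB A (sSup A) := isLUB_sSup A
  set r := sSup A
  have hrs : r ≤ s := hlub.2 fun v hv => hv.2.1
  have hur : u ≤ r := by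
    obtain ⟨v, hv⟩ := hne
    exact hv.1.trans (hlub.1 hv)
  have hafter : ∀ v, r < v → v ≤ s → c ≤ f v := fun v hv hvs => by
    by_contra! hlt
    exact absurd (hlub.1 ⟨hur.trans hv.le, hvs, hlt⟩) (not_le.2 hv)
  have hfs : c < f s := hc2.trans_le (infOn_le f.nonneg le_rfl hst)
  -- `f u < c` would persist on the right of `u`
  have hr_lt : u < r := by
    refine lt_of_le_of_ne hur fun e => ?_
    have hfu : f u < c := by
      obtain ⟨v, hv⟩ := hne
      have : v = u := le_antisymm ((hlub.1 hv).trans e.ge) hv.1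
      exact this ▸ hv.2.2
    have hus' : u < s := lt_of_le_of_ne hus fun e' => by rw [e'] at hfu; linarith
    obtain ⟨w, hw, hs⟩ := (mem_nhdsGT_iff_exists_Ioo_subset' hus').1
      ((f.tendsto_right u).eventually_lt_const hfu)
    obtain ⟨v, hv1, hv2⟩ := exists_between (lt_min hw hus')
    have h1 : f v < c := hs ⟨hv1, hv2.trans_le (min_le_left _ _)⟩
    have h2 := hafter v (e ▸ hv1) (hv2.le.trans (min_le_right _ _))
    linarith
  have hrc : leftVal f r ≤ c := by
    by_contra! hlt'
    obtain ⟨a, ha, hs⟩ := f.exists_lt_left (lt_of_le_of_lt u.2.1 hr_lt) hlt'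
    obtain ⟨w, hwA, haw⟩ := (lt_isLUB_iff hlub).1 ha
    rcases eq_or_lt_of_le (hlub.1 hwA) with e | e
    · have h1 := hwA.2.2
      rw [e] at h1
      linarith [f.leftVal_le r]
    · linarith [hs w haw e, hwA.2.2]
  -- hence `r` is a common ancestor beyond `u`, a contradiction
  have key : ∀ v, r ≤ v → v ≤ t → leftVal f r ≤ f v := fun v hv hvt => by
    rcases eq_or_lt_of_le hv with e | e
    · rw [← e]; exact f.leftVal_le r
    · rcases le_total v s with h | h
      · exact hrc.trans (hafter v e h)
      · exact hrc.trans (hc2.le.trans (infOn_le f.nonneg h hvt))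
  refine absurd (hmax r ?_ ?_) (not_le.2 hr_lt)
  · exact (anc_iff f).2 ⟨hrs, fun v hv hvs => key v hv (hvs.trans hst)⟩
  · exact (anc_iff f).2 ⟨hrs.trans hst, key⟩

theorem infOn_mrca {s t : I} (hst : s ≤ t) : infOn f (mrca f s t) t = infOn f s t := by
  rw [infOn_split f.nonneg (f.mrca_anc_left s t).1 hst]
  exact min_eq_right (f.infOn_le_infOn_mrca hst)

/-- A sum over the branches from `s ∧ t` to `s` and to `t` plus a term at `s ∧ t` is a sum over all
times: strict ancestors of `s ∧ t` see `s` and `t` at the same position, and every other time sees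
one of them at position `0`. -/
theorem mrca_sum_eq_tsum (E : I → ℝ → ℝ → ℝ) (h0 : ∀ r a, E r a a = 0)
    (hsymm : ∀ r a b, E r a b = E r b a) (s t : I)
    (hsum : Summable fun r => E r (relPos f r s) (relPos f r t)) :
    E (mrca f s t) (relPos f (mrca f s t) s) (relPos f (mrca f s t) t)
      + ∑' r : {r : I // StrictAnc f (mrca f s t) r ∧ Anc f r s}, E r 0 (relPos f r s)
      + ∑' r : {r : I // StrictAnc f (mrca f s t) r ∧ Anc f r t}, E r 0 (relPos f r t)
      = ∑' r, E r (relPos f r s) (relPos f r t) := by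
  classical
  have hspec := f.anc_mrca_iff s t
  have hus := f.mrca_anc_left s t
  have hut := f.mrca_anc_right s t
  set u := mrca f s t
  set G : I → ℝ := fun r => E r (relPos f r s) (relPos f r t) with hG
  set A : Set I := {r | StrictAnc f u r ∧ Anc f r s} with hA
  set B : Set I := {r | StrictAnc f u r ∧ Anc f r t} with hB
  have hAt : ∀ r ∈ A, ¬ Anc f r t := fun r hr hrt =>
    absurd ((hspec r).2 ⟨hr.2, hrt⟩).1 (not_le.2 hr.1.2)
  have hBs : ∀ r ∈ B, ¬ Anc f r s := fun r hr hrs =>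
    absurd ((hspec r).2 ⟨hrs, hr.2⟩).1 (not_le.2 hr.1.2)
  have e1 : ∑' r : {r : I // StrictAnc f u r ∧ Anc f r s}, E r 0 (relPos f r s)
      = ∑' r, A.indicator G r := by
    rw [← tsum_subtype A G]
    refine tsum_congr fun r => ?_
    rw [hG]
    simp only
    rw [relPos_of_not_anc (hAt r r.2), hsymm]
  have e2 : ∑' r : {r : I // StrictAnc f u r ∧ Anc f r t}, E r 0 (relPos f r t)
      = ∑' r, B.indicator G r := by
    rw [← tsum_subtype B G]
    refine tsum_congr fun r => ?_
    rw [hG]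
    simp only
    rw [relPos_of_not_anc (hBs r r.2)]
  have e3 : E u (relPos f u s) (relPos f u t) = ∑' r, ({u} : Set I).indicator G r := by
    rw [tsum_eq_single u]
    · simp [hG]
    · intro b hb
      exact indicator_of_notMem (s := ({u} : Set I)) hb G
  rw [e1, e2, e3, ← (hsum.indicator _).tsum_add (hsum.indicator _),
    ← ((hsum.indicator _).add (hsum.indicator _)).tsum_add (hsum.indicator _)]
  refine tsum_congr fun r => ?_
  by_cases hru : r = u
  · have hrA : r ∉ A := fun h => absurd h.1.2 (by rw [hru]; exact lt_irrefl _)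
    have hrB : r ∉ B := fun h => absurd h.1.2 (by rw [hru]; exact lt_irrefl _)
    rw [indicator_of_mem (show r ∈ ({u} : Set I) from hru), indicator_of_notMem hrA,
      indicator_of_notMem hrB, add_zero, add_zero]
  rw [indicator_of_notMem (show r ∉ ({u} : Set I) from hru), zero_add]
  have hup : ∀ w, Anc f u w → Anc f r w → ¬ Anc f r u → StrictAnc f u r := by
    intro w huw hrw hn
    have hlt : u < r := by
      by_contra! hle
      exact hn (f.anc_of_anc_le hrw hle huw.1)
    exact ⟨f.anc_of_anc_le huw hlt.le hrw.1, hlt⟩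
  by_cases hrs : Anc f r s
  · by_cases hrt : Anc f r t
    · have hru' := (hspec r).2 ⟨hrs, hrt⟩
      have hlt : r < u := lt_of_le_of_ne hru'.1 hru
      have hrA : r ∉ A := fun h => hAt r h hrt
      have hrB : r ∉ B := fun h => hBs r h hrs
      rw [indicator_of_notMem hrA, indicator_of_notMem hrB, add_zero]
      rw [f.relPos_eq_of_anc hlt hus hut, h0]
    · have hrA : r ∈ A := ⟨hup s hus hrs fun h => hrt ((hspec r).1 h).2, hrs⟩
      have hrB : r ∉ B := fun h => hrt h.2
      rw [indicator_of_mem hrA, indicator_of_notMem hrB, add_zero]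
  · have hrA : r ∉ A := fun h => hrs h.2
    by_cases hrt : Anc f r t
    · have hrB : r ∈ B := ⟨hup t hut hrt fun h => hrs ((hspec r).1 h).1, hrt⟩
      rw [indicator_of_notMem hrA, indicator_of_mem hrB, zero_add]
    · have hrB : r ∉ B := fun h => hrt h.2
      rw [indicator_of_notMem hrA, indicator_of_notMem hrB, add_zero, relPos_of_not_anc hrs,
        relPos_of_not_anc hrt, h0]

theorem treeDist_comm (s t : I) : treeDist f s t = treeDist f t s := by
  rw [treeDist, treeDist, f.mrca_comm s t, add_comm]

/-- The tree pseudo-distance without reference to common ancestors. -/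
theorem treeDist_eq (s t : I) : treeDist f s t
    = f s + f t - 2 * infBetween f s t - ∑' r, |relPos f r s - relPos f r t| := by
  wlog h : s ≤ t generalizing s t
  · rw [f.treeDist_comm, this t s (le_of_not_ge h), infBetween_comm]
    simp_rw [fun r => abs_sub_comm (relPos f r t)]
    ring
  have key := f.mrca_sum_eq_tsum (fun _ a b => |a - b|) (by simp) (fun _ a b => abs_sub_comm a b)
    s t (f.summable_abs_relPos_sub s t)
  rw [← key, infBetween_of_le h, treeDist, treeDist₀, treeDist₀]
  have e : ∀ r w, |0 - relPos f r w| = relPos f r w := fun r w => by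
    rw [zero_sub, abs_neg, abs_of_nonneg (relPos_nonneg _ _ _)]
  simp only [e]
  have hx := relPos_of_anc (f.mrca_anc_left s t)
  have hy := relPos_of_anc (f.mrca_anc_right s t)
  have h1 := f.infOn_mrca h
  have h2 := f.infOn_le_infOn_mrca h
  rw [hx, hy, h1, abs_of_nonneg (by linarith)]
  ring

/-! ### The tree pseudo-distance -/

/-- The excursion from which the parts of finitely many jumps below the current point have been
removed. -/
def cut (T : Finset I) (v : I) : ℝ := f v - ∑ r ∈ T, relPos f r v

theorem cut_nonneg (T : Finset I) (v : I) : 0 ≤ f.cut T v :=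
  sub_nonneg.2 (f.sum_relPos_le v T)

/-- Removing jumps from `f` lowers `inf_{[s,t]} f` by the parts of these jumps that `s` and `t` share;
so the cut excursion codes the real tree in which those jumps have been shrunk. -/
theorem infBetween_cut (T : Finset I) (s t : I) : infBetween (f.cut T) s t
    = infBetween f s t - ∑ r ∈ T, min (relPos f r s) (relPos f r t) := by
  wlog h : s ≤ t generalizing s t
  · rw [infBetween_comm, this t s (le_of_not_ge h), infBetween_comm]
    simp_rw [min_comm]
  rw [infBetween_of_le h, infBetween_of_le h]
  apply le_antisymm
  · have : infOn (f.cut T) s t + ∑ r ∈ T, min (relPos f r s) (relPos f r t) ≤ infOn f s t := by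
      refine le_infOn h fun v hv hv' => ?_
      have h1 := infOn_le (f.cut_nonneg T) hv hv'
      have h2 : ∑ r ∈ T, min (relPos f r s) (relPos f r t) ≤ ∑ r ∈ T, relPos f r v :=
        Finset.sum_le_sum fun r _ => f.min_relPos_le hv hv' r
      unfold cut at h1 ⊢
      linarith
    linarith
  · refine le_infOn h fun v hv hv' => ?_
    have := f.sum_relPos_sub_min_le hv hv' T
    rw [Finset.sum_sub_distrib] at this
    unfold cut
    linarith

end Excursion

theorem infBetween_add_le {g : I → ℝ} (hg : ∀ t, 0 ≤ g t) (r s t : I) :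
    infBetween g r s + infBetween g s t ≤ infBetween g r t + g s := by
  have h1 : infBetween g r s ≤ g s := infOn_le hg (min_le_right _ _) (le_max_right _ _)
  have h2 : infBetween g s t ≤ g s := infOn_le hg (min_le_left _ _) (le_max_left _ _)
  have h3 : min (infBetween g r s) (infBetween g s t) ≤ infBetween g r t := by
    refine le_infOn min_le_max fun v hv hv' => ?_
    have : (min r s ≤ v ∧ v ≤ max r s) ∨ (min s t ≤ v ∧ v ≤ max s t) := by
      rcases le_total v s with h | h
      · rcases min_le_iff.1 hv with h' | h'
        · exact Or.inl ⟨(min_le_left _ _).trans h', h.trans (le_max_right _ _)⟩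
        · exact Or.inr ⟨(min_le_right _ _).trans h', h.trans (le_max_left _ _)⟩
      · rcases le_max_iff.1 hv' with h' | h'
        · exact Or.inl ⟨(min_le_right _ _).trans h, h'.trans (le_max_left _ _)⟩
        · exact Or.inr ⟨(min_le_left _ _).trans h, h'.trans (le_max_right _ _)⟩
    rcases this with ⟨a, b⟩ | ⟨a, b⟩
    · exact (min_le_left _ _).trans (infOn_le hg a b)
    · exact (min_le_right _ _).trans (infOn_le hg a b)
  rcases min_choice (infBetween g r s) (infBetween g s t) with h | h <;> rw [h] at h3 <;> linarith

theorem Excursion.tendsto_sum_abs_relPos_sub (f : Excursion) (s t : I) :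
    Tendsto (fun T : Finset I => f s + f t - 2 * infBetween f s t
      - ∑ r ∈ T, |relPos f r s - relPos f r t|) atTop (𝓝 (treeDist f s t)) := by
  rw [f.treeDist_eq]
  exact tendsto_const_nhds.sub (f.summable_abs_relPos_sub s t).hasSum

theorem Excursion.treeDist_nonneg (f : Excursion) (s t : I) : 0 ≤ treeDist f s t := by
  refine ge_of_tendsto' (f.tendsto_sum_abs_relPos_sub s t) fun T => ?_
  linarith [f.sum_abs_relPos_sub_le_between s t T]

/-- The triangle inequality holds for the tree coded by each of the functions `f.cut T`, and passes to
the limit along the finite sets `T`. -/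
theorem isPseudoDist_treeDist (f : Excursion) : IsPseudoDist (treeDist f) where
  self s := by
    rw [f.treeDist_eq, infBetween_self]
    simp; ring
  comm := f.treeDist_comm
  triangle r s t := by
    refine le_of_tendsto_of_tendsto' (f.tendsto_sum_abs_relPos_sub r t)
      ((f.tendsto_sum_abs_relPos_sub r s).add (f.tendsto_sum_abs_relPos_sub s t)) fun T => ?_
    have h := infBetween_add_le (f.cut_nonneg T) r s t
    have e : ∀ a b : I, ∑ q ∈ T, |relPos f q a - relPos f q b|
        = ∑ q ∈ T, relPos f q a + ∑ q ∈ T, relPos f q b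
          - 2 * ∑ q ∈ T, min (relPos f q a) (relPos f q b) := fun a b => by
      rw [Finset.mul_sum, ← Finset.sum_add_distrib, ← Finset.sum_sub_distrib]
      refine Finset.sum_congr rfl fun q _ => ?_
      have h1 := min_add_max (relPos f q a) (relPos f q b)
      have h2 := max_sub_min_eq_abs (relPos f q a) (relPos f q b)
      rw [abs_sub_comm] at h2
      linarith
    rw [f.infBetween_cut, f.infBetween_cut, f.infBetween_cut, Excursion.cut] at h
    rw [e, e, e]
    linarith

/-! ### Loops of arbitrary shape -/

/-- A family of càglàd surjections `φ_D` of `[0,1]` onto the circle, one for each `D > 0`, with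
`δ(φ_D(0), φ_D(x)) = O(x)` locally uniformly in `D`. Shuffles are of this form, and so is the
constant family `x ↦ x mod 1`, for which the loops are the usual ones. The values at `D ≤ 0` are
irrelevant. -/
structure LoopShape where
  toFun : ℝ → I → UnitAddCircle
  left_continuous : ∀ D, 0 < D → ∀ x, ContinuousWithinAt (toFun D) (Iic x) x
  exists_right_limit : ∀ D, 0 < D → ∀ x, ∃ l, Tendsto (toFun D) (𝓝[>] x) (𝓝 l)
  surjective : ∀ D, 0 < D → Function.Surjective (toFun D)
  bounded : ∀ D, ∃ K : ℝ, 0 ≤ K ∧ ∀ u, 0 < u → u ≤ D → ∀ x : I,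
    dist (toFun u 0) (toFun u x) ≤ K * x

/-- The relative position `a / D`, clamped to `[0,1]`. -/
def clampDiv (D a : ℝ) : I := projIcc 0 1 zero_le_one (a / D)

theorem clampDiv_coe {D a : ℝ} (hD : 0 < D) (h0 : 0 ≤ a) (h1 : a ≤ D) :
    (clampDiv D a : ℝ) = a / D := by
  have : a / D ∈ Icc (0 : ℝ) 1 := ⟨div_nonneg h0 hD.le, (div_le_one hD).2 h1⟩
  rw [clampDiv, projIcc_of_mem _ this]

theorem clampDiv_zero (D : ℝ) : clampDiv D 0 = 0 := by
  rw [clampDiv, zero_div, projIcc_of_le_left _ le_rfl]; rfl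

theorem clampDiv_mul {D : ℝ} (hD : 0 < D) (x : I) : clampDiv D (D * x) = x := by
  rw [clampDiv, mul_div_cancel_left₀ _ hD.ne', projIcc_val]

theorem continuous_clampDiv (D : ℝ) : Continuous (clampDiv D) :=
  continuous_projIcc.comp (continuous_id.div_const D)

theorem monotone_clampDiv {D : ℝ} (hD : 0 ≤ D) : Monotone (clampDiv D) := fun _ _ h =>
  monotone_projIcc _ (div_le_div_of_nonneg_right h hD)

theorem clampDiv_lt {D a b : ℝ} (hD : 0 < D) (h0 : 0 ≤ a) (hab : a < b) (h1 : b ≤ D) :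
    clampDiv D a < clampDiv D b := by
  rw [← Subtype.coe_lt_coe, clampDiv_coe hD h0 (hab.le.trans h1),
    clampDiv_coe hD (h0.trans hab.le) h1]
  exact div_lt_div_of_pos_right hab hD

namespace LoopShape

variable (Φ : LoopShape)

/-- The distance between the points at positions `a` and `b` on a loop of length `D`. -/
def loopLength (D a b : ℝ) : ℝ :=
  D * dist (Φ.toFun D (clampDiv D a)) (Φ.toFun D (clampDiv D b))

theorem loopLength_nonneg {D : ℝ} (hD : 0 ≤ D) (a b : ℝ) : 0 ≤ Φ.loopLength D a b :=
  mul_nonneg hD dist_nonneg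

theorem loopLength_self (D a : ℝ) : Φ.loopLength D a a = 0 := by
  rw [loopLength, dist_self, mul_zero]

theorem loopLength_comm (D a b : ℝ) : Φ.loopLength D a b = Φ.loopLength D b a := by
  rw [loopLength, loopLength, dist_comm]

theorem loopLength_triangle {D : ℝ} (hD : 0 ≤ D) (a b c : ℝ) :
    Φ.loopLength D a c ≤ Φ.loopLength D a b + Φ.loopLength D b c := by
  rw [loopLength, loopLength, loopLength, ← mul_add]
  exact mul_le_mul_of_nonneg_left (dist_triangle _ _ _) hD

theorem exists_loopLength_le (M : ℝ) : ∃ C : ℝ, 0 ≤ C ∧ ∀ D, 0 ≤ D → D ≤ M → ∀ a, 0 ≤ a → a ≤ D →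
    Φ.loopLength D 0 a ≤ C * a := by
  obtain ⟨K, hK, H⟩ := Φ.bounded M
  refine ⟨K, hK, fun D hD hDM a ha haD => ?_⟩
  rcases eq_or_lt_of_le hD with e | h
  · rw [loopLength, ← e, zero_mul]; exact mul_nonneg hK ha
  · have := mul_le_mul_of_nonneg_left (H D h hDM (clampDiv D a)) hD
    rw [loopLength, clampDiv_zero]
    refine this.trans (le_of_eq ?_)
    rw [clampDiv_coe h ha haD]
    field_simp

/-- `C` bounds the ratio of loop distance to position on all the loops of `f`. -/
def LoopBound (f : Excursion) (C : ℝ) : Prop :=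
  0 ≤ C ∧ ∀ D, 0 ≤ D → (∃ t, D ≤ f t) → ∀ a, 0 ≤ a → a ≤ D → Φ.loopLength D 0 a ≤ C * a

theorem exists_loopBound (M : ℝ) : ∃ C, 0 ≤ C ∧ ∀ f : Excursion, (∀ t, f t ≤ M) →
    Φ.LoopBound f C := by
  obtain ⟨C, hC, H⟩ := Φ.exists_loopLength_le M
  exact ⟨C, hC, fun f hf => ⟨hC, fun D hD ⟨t, ht⟩ => H D hD (ht.trans (hf t))⟩⟩

/-- The distance on the loop of the jump at `r` between the positions seen from `s` and `t`. -/
def loopTerm (f : Excursion) (s t r : I) : ℝ :=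
  Φ.loopLength (jump f r) (relPos f r s) (relPos f r t)

variable {Φ} {f : Excursion}

theorem loopTerm_nonneg (s t r : I) : 0 ≤ Φ.loopTerm f s t r :=
  Φ.loopLength_nonneg (f.jump_nonneg r) _ _

theorem loopTerm_comm (s t r : I) : Φ.loopTerm f s t r = Φ.loopTerm f t s r :=
  Φ.loopLength_comm _ _ _

theorem loopTerm_triangle (s t u r : I) :
    Φ.loopTerm f s u r ≤ Φ.loopTerm f s t r + Φ.loopTerm f t u r :=
  Φ.loopLength_triangle (f.jump_nonneg r) _ _ _

theorem loopTerm_eq_zero {s t r : I} (h : relPos f r s = relPos f r t) :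
    Φ.loopTerm f s t r = 0 := by
  rw [loopTerm, h, loopLength_self]

theorem LoopBound.zero_le {C : ℝ} (hC : Φ.LoopBound f C) (r t : I) :
    Φ.loopLength (jump f r) 0 (relPos f r t) ≤ C * relPos f r t :=
  hC.2 _ (f.jump_nonneg r) ⟨r, f.jump_le r⟩ _ (relPos_nonneg _ _ _) (f.relPos_le_jump r t)

theorem LoopBound.loopTerm_le {C : ℝ} (hC : Φ.LoopBound f C) (s t r : I) :
    Φ.loopTerm f s t r ≤ C * (relPos f r s + relPos f r t) := by
  have h := Φ.loopLength_triangle (f.jump_nonneg r) (relPos f r s) 0 (relPos f r t)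
  rw [Φ.loopLength_comm _ (relPos f r s) 0] at h
  rw [loopTerm, mul_add]
  exact h.trans (add_le_add (hC.zero_le r s) (hC.zero_le r t))

variable (Φ f) in
theorem exists_loopBound_self : ∃ C, Φ.LoopBound f C := by
  obtain ⟨M, _, hM⟩ := f.exists_le
  obtain ⟨C, _, hC⟩ := Φ.exists_loopBound M
  exact ⟨C, hC f hM⟩

variable (Φ f) in
theorem summable_loopTerm (s t : I) : Summable (Φ.loopTerm f s t) := by
  obtain ⟨C, hC⟩ := exists_loopBound_self Φ f
  exact Summable.of_nonneg_of_le (loopTerm_nonneg s t) (hC.loopTerm_le s t)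
    (((f.summable_relPos s).add (f.summable_relPos t)).mul_left C)

variable (Φ f) in
/-- The loop distance between `s` and `t`, summed over all the jumps. -/
def circDist (s t : I) : ℝ := ∑' r, Φ.loopTerm f s t r

theorem circDist_nonneg (s t : I) : 0 ≤ Φ.circDist f s t := tsum_nonneg (loopTerm_nonneg s t)

variable (Φ f) in
theorem isPseudoDist_circDist : IsPseudoDist (Φ.circDist f) where
  self s := by
    rw [circDist]
    simp_rw [fun r => loopTerm_eq_zero (Φ := Φ) (rfl : relPos f r s = relPos f r s)]
    exact tsum_zero
  comm s t := tsum_congr fun r => loopTerm_comm s t r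
  triangle r s t := by
    rw [circDist, circDist, circDist,
      ← (summable_loopTerm Φ f r s).tsum_add (summable_loopTerm Φ f s t)]
    exact (summable_loopTerm Φ f r t).tsum_le_tsum (fun q => loopTerm_triangle r s t q)
      ((summable_loopTerm Φ f r s).add (summable_loopTerm Φ f s t))

variable (Φ f) in
/-- The combination `α d_T + β d_L` of the tree distance and of the loop distance. -/
def gdist (α β : ℝ) (s t : I) : ℝ := α * treeDist f s t + β * Φ.circDist f s t

theorem isPseudoDist_gdist {α β : ℝ} (hα : 0 ≤ α) (hβ : 0 ≤ β) :
    IsPseudoDist (Φ.gdist f α β) where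
  self s := by
    rw [gdist, (isPseudoDist_treeDist f).self, (isPseudoDist_circDist Φ f).self]; simp
  comm s t := by
    rw [gdist, gdist, (isPseudoDist_treeDist f).comm, (isPseudoDist_circDist Φ f).comm]
  triangle r s t := by
    have h1 := mul_le_mul_of_nonneg_left ((isPseudoDist_treeDist f).triangle r s t) hα
    have h2 := mul_le_mul_of_nonneg_left ((isPseudoDist_circDist Φ f).triangle r s t) hβ
    unfold gdist
    linarith

theorem gdist_nonneg {α β : ℝ} (hα : 0 ≤ α) (hβ : 0 ≤ β) (s t : I) : 0 ≤ Φ.gdist f α β s t :=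
  add_nonneg (mul_nonneg hα (f.treeDist_nonneg s t)) (mul_nonneg hβ (circDist_nonneg s t))

/-! ### One-sided limits of the projection -/

theorem treeDist_le (s t : I) : treeDist f s t ≤ f s + f t - 2 * infBetween f s t := by
  rw [f.treeDist_eq]
  have : 0 ≤ ∑' r, |relPos f r s - relPos f r t| := tsum_nonneg fun r => abs_nonneg _
  linarith

/-- Since `∑_r |x_r^s - x_r^t| ≤ f(s) + f(t) - 2 inf f`, the loops that contribute little at `t`
contribute little at nearby `s`; so convergence of each loop term suffices. -/
theorem tendsto_gdist {α β : ℝ} {l : Filter I} {t : I}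
    (h1 : Tendsto (fun s => f s + f t - 2 * infBetween f s t) l (𝓝 0))
    (h2 : ∀ r, Tendsto (fun s => Φ.loopTerm f s t r) l (𝓝 0)) :
    Tendsto (fun s => Φ.gdist f α β s t) l (𝓝 0) := by
  have hT : Tendsto (fun s => treeDist f s t) l (𝓝 0) :=
    squeeze_zero (fun s => f.treeDist_nonneg s t) (fun s => treeDist_le s t) h1
  have hC : Tendsto (fun s => Φ.circDist f s t) l (𝓝 0) := by
    obtain ⟨C, hC⟩ := exists_loopBound_self Φ f
    -- the loops of a finite set `S` are kept, and the others are bounded by the packing inequality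
    have hbound : ∀ (S : Finset I) (s : I), Φ.circDist f s t ≤ ∑ r ∈ S, Φ.loopTerm f s t r
        + C * ((f s + f t - 2 * infBetween f s t)
          + 2 * (∑' r, relPos f r t - ∑ r ∈ S, relPos f r t)) := by
      classical
      intro S s
      refine (summable_loopTerm Φ f s t).tsum_le_of_sum_le fun T => ?_
      have e1 : ∑ r ∈ T, Φ.loopTerm f s t r
          ≤ ∑ r ∈ S, Φ.loopTerm f s t r + ∑ r ∈ T \ S, Φ.loopTerm f s t r := by
        rw [← Finset.sum_union Finset.disjoint_sdiff]
        refine Finset.sum_le_sum_of_subset_of_nonneg ?_ fun r _ _ => loopTerm_nonneg s t r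
        rw [Finset.union_sdiff_self_eq_union]
        exact Finset.subset_union_right
      have e2 : ∑ r ∈ T \ S, Φ.loopTerm f s t r
          ≤ C * ∑ r ∈ T \ S, (|relPos f r s - relPos f r t| + 2 * relPos f r t) := by
        rw [Finset.mul_sum]
        refine Finset.sum_le_sum fun r _ => (hC.loopTerm_le s t r).trans ?_
        refine mul_le_mul_of_nonneg_left ?_ hC.1
        linarith [le_abs_self (relPos f r s - relPos f r t)]
      have e3 := f.sum_abs_relPos_sub_le_between s t (T \ S)
      have e4 : ∑ r ∈ T \ S, relPos f r t ≤ ∑' r, relPos f r t - ∑ r ∈ S, relPos f r t := by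
        rw [le_sub_iff_add_le, ← Finset.sum_union Finset.sdiff_disjoint]
        exact (f.summable_relPos t).sum_le_tsum _ fun r _ => relPos_nonneg _ _ _
      rw [Finset.sum_add_distrib, ← Finset.mul_sum] at e2
      have e5 := mul_le_mul_of_nonneg_left (add_le_add e3 (mul_le_mul_of_nonneg_left e4
        (zero_le_two (α := ℝ)))) hC.1
      linarith
    rw [tendsto_order]
    refine ⟨fun a ha => Eventually.of_forall fun s => ha.trans_le (circDist_nonneg s t),
      fun ε hε => ?_⟩
    have hS : Tendsto (fun S : Finset I => C * (2 * (∑' r, relPos f r t - ∑ r ∈ S, relPos f r t)))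
        atTop (𝓝 (C * (2 * (∑' r, relPos f r t - ∑' r, relPos f r t)))) :=
      ((tendsto_const_nhds.sub (f.summable_relPos t).hasSum).const_mul 2).const_mul C
    rw [sub_self, mul_zero, mul_zero] at hS
    obtain ⟨S, hSε⟩ := (hS.eventually_lt_const hε).exists
    have hlim : Tendsto (fun s => ∑ r ∈ S, Φ.loopTerm f s t r
        + C * ((f s + f t - 2 * infBetween f s t)
          + 2 * (∑' r, relPos f r t - ∑ r ∈ S, relPos f r t))) l
        (𝓝 (∑ r ∈ S, (0 : ℝ) + C * (0 + 2 * (∑' r, relPos f r t - ∑ r ∈ S, relPos f r t)))) :=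
      (tendsto_finsetSum _ fun r _ => h2 r).add ((h1.add_const _).const_mul C)
    rw [Finset.sum_const_zero, zero_add, zero_add] at hlim
    filter_upwards [hlim.eventually_lt_const hSε] with s hs
    exact (hbound S s).trans_lt hs
  have := (hT.const_mul α).add (hC.const_mul β)
  simpa [gdist] using this

/-- Between two descendants `s` and `t` of `r`, at heights close to the lowest levels reached since
`r`, the distance is close to that of their positions on the loop at `r`. -/
theorem gdist_le_of_anc {α β C : ℝ} (hα : 0 ≤ α) (hβ : 0 ≤ β) (hC : Φ.LoopBound f C) {r s t : I}
    (hs : Anc f r s) (ht : Anc f r t) :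
    Φ.gdist f α β s t ≤ β * Φ.loopTerm f s t r
      + (α + β * C) * ((f s - infOn f r s) + (f t - infOn f r t)) := by
  classical
  have hT : treeDist f s t ≤ (f s - infOn f r s) + (f t - infOn f r t) := by
    have h1 : treeDist f s t ≤ f s + f t - 2 * infBetween f s t
        - |relPos f r s - relPos f r t| := by
      rw [f.treeDist_eq]
      have := (f.summable_abs_relPos_sub s t).le_tsum r fun _ _ => abs_nonneg _
      linarith
    rw [relPos_of_anc hs, relPos_of_anc ht, sub_sub_sub_cancel_right] at h1
    have h2 : min (infOn f r s) (infOn f r t) ≤ infBetween f s t := by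
      refine le_infOn min_le_max fun v hv hv' => ?_
      have hrv : r ≤ v := (le_min hs.1 ht.1).trans hv
      rcases le_max_iff.1 hv' with h | h
      · exact (min_le_left _ _).trans (infOn_le f.nonneg hrv h)
      · exact (min_le_right _ _).trans (infOn_le f.nonneg hrv h)
    have h3 := min_add_max (infOn f r s) (infOn f r t)
    have h4 := max_sub_min_eq_abs (infOn f r s) (infOn f r t)
    rw [abs_sub_comm] at h4
    linarith
  have hL : Φ.circDist f s t
      ≤ Φ.loopTerm f s t r + C * ((f s - infOn f r s) + (f t - infOn f r t)) := by
    refine (summable_loopTerm Φ f s t).tsum_le_of_sum_le fun T => ?_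
    have h1 : ∀ q ∈ T, Φ.loopTerm f s t q ≤ (if q = r then Φ.loopTerm f s t r else 0)
        + if r < q then C * (relPos f q s + relPos f q t) else 0 := fun q _ => by
      rcases lt_trichotomy q r with h | h | h
      · rw [if_neg h.ne, if_neg (not_lt.2 h.le), add_zero,
          loopTerm_eq_zero (f.relPos_eq_of_anc h hs ht)]
      · rw [if_pos h, if_neg (by rw [h]; exact lt_irrefl _), add_zero, h]
      · rw [if_neg h.ne', if_pos h, zero_add]
        exact hC.loopTerm_le s t q
    refine (Finset.sum_le_sum h1).trans ?_
    rw [Finset.sum_add_distrib, Finset.sum_ite_eq', ← Finset.sum_filter, ← Finset.mul_sum,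
      Finset.sum_add_distrib]
    have hmem : ∀ q ∈ T.filter (fun q => r < q), r < q := fun q hq => (Finset.mem_filter.1 hq).2
    refine add_le_add ?_ (mul_le_mul_of_nonneg_left
      (add_le_add (f.sum_relPos_le_sub hs.1 _ hmem) (f.sum_relPos_le_sub ht.1 _ hmem)) hC.1)
    split_ifs
    · exact le_rfl
    · exact loopTerm_nonneg s t r
  have h1 := mul_le_mul_of_nonneg_left hT hα
  have h2 := mul_le_mul_of_nonneg_left hL hβ
  unfold gdist
  linarith

variable (Φ f) in
/-- The class of `s` is right-continuous in `s`: the position of `s` on a given loop decreases, and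
the loops are left-continuous. -/
theorem tendsto_gdist_right (α β : ℝ) (t : I) :
    Tendsto (fun s => Φ.gdist f α β s t) (𝓝[>] t) (𝓝 0) := by
  refine tendsto_gdist ?_ fun r => ?_
  · have h := ((f.tendsto_right t).add_const (f t)).sub
      ((f.tendsto_infOn_right (le_refl t)).const_mul 2)
    rw [infOn_self, ← two_mul, sub_self] at h
    refine h.congr' ?_
    filter_upwards [self_mem_nhdsWithin] with s hs
    rw [infBetween_comm, infBetween_of_le (le_of_lt hs)]
  · rcases le_or_gt r t with h | h
    · rcases eq_or_lt_of_le (f.jump_nonneg r) with e | hD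
      · simp only [loopTerm, loopLength, ← e, zero_mul]
        exact tendsto_const_nhds
      have hc : Tendsto (fun s => clampDiv (jump f r) (relPos f r s)) (𝓝[>] t)
          (𝓝[≤] (clampDiv (jump f r) (relPos f r t))) := by
        refine tendsto_nhdsWithin_iff.2 ⟨((continuous_clampDiv _).tendsto _).comp
          (f.tendsto_relPos_right r t), ?_⟩
        filter_upwards [self_mem_nhdsWithin] with s hs
        exact monotone_clampDiv hD.le (f.relPos_anti h (le_of_lt hs))
      have h1 := (Φ.left_continuous _ hD (clampDiv (jump f r) (relPos f r t))).tendsto.comp hc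
      have h2 := (tendsto_iff_dist_tendsto_zero.1 h1).const_mul (jump f r)
      rw [mul_zero] at h2
      exact h2
    · refine tendsto_const_nhds.congr' ?_
      filter_upwards [Ioo_mem_nhdsGT h] with s hs
      rw [loopTerm_eq_zero]
      rw [relPos_of_lt h, relPos_of_lt hs.2]

variable (Φ f) in
/-- As `s` increases to `t`, its class converges. If `s` moves along a loop of `f` just before `t`,
the limit is the point of this loop given by the right limit of `φ_D` at the position of `t`;
otherwise it is the class of the first time from `t` on at which `f` is at the level `f(t-)`. -/
theorem exists_tendsto_gdist_left {α β : ℝ} (hα : 0 ≤ α) (hβ : 0 ≤ β) (t : I) :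
    ∃ t', Tendsto (fun s => Φ.gdist f α β s t') (𝓝[<] t) (𝓝 0) := by
  rcases eq_or_lt_of_le (unitInterval.nonneg' : (0 : I) ≤ t) with e | ht0
  · refine ⟨0, ?_⟩
    rw [← e, nhdsLT_zero_eq_bot]; exact tendsto_bot
  have := nhdsLT_neBot ht0
  by_cases hcase : ∃ r < t, 0 < relPos f r t ∧
      ∀ s, r ≤ s → s < t → relPos f r t < relPos f r s
  · obtain ⟨r, hrt, hpos, hlt⟩ := hcase
    have hD : 0 < jump f r := hpos.trans_le (f.relPos_le_jump r t)
    set D := jump f r with hDdef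
    -- as `s` increases to `t`, its position on the loop at `r` decreases strictly to that of `t`; the
    -- limit on the circle is the point at some position `y`, visited by `f` on its way down from `r`
    obtain ⟨l, hl⟩ := Φ.exists_right_limit D hD (clampDiv D (relPos f r t))
    obtain ⟨y, hy⟩ := Φ.surjective D hD l
    have hanc := anc_of_relPos_pos hpos
    have hDy : D * y ≤ D := mul_le_of_le_one_right hD.le y.2.2
    have hDy0 : 0 ≤ D * y := mul_nonneg hD.le y.2.1
    obtain ⟨t', htt', hft', hge⟩ := f.exists_first_hit (t := r) (c := leftVal f r + D * y)
      (add_nonneg (f.leftVal_nonneg r) hDy0) (by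
        have : D = f r - leftVal f r := hDdef
        linarith)
    have hanc' : Anc f r t' := (anc_iff f).2 ⟨htt', fun v hv hv' => by linarith [hge v hv hv']⟩
    have hinf' : infOn f r t' = f t' :=
      le_antisymm (infOn_le f.nonneg htt' le_rfl) (le_infOn htt' fun v hv hv' => by
        rw [hft']; exact hge v hv hv')
    have hx' : relPos f r t' = D * y := by
      rw [relPos_of_anc hanc', hinf', hft']; ring
    -- the infimum since `r` would otherwise be constant just before `t`
    have hinf : infOn f r t = leftVal f t := by
      refine le_antisymm (f.infOn_le_leftVal hrt le_rfl) (not_lt.1 fun hlt' => ?_)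
      obtain ⟨c, hc1, hc2⟩ := exists_between hlt'
      obtain ⟨a, ha, hav⟩ := f.exists_lt_left ht0 hc2
      obtain ⟨b, hb1, hb2⟩ := exists_between (max_lt ha hrt)
      have hrb : r ≤ b := (le_max_right _ _).trans hb1.le
      have h1 : infOn f r b = infOn f r t := by
        rw [infOn_split f.nonneg hrb hb2.le, min_eq_left]
        by_contra! hcon
        have h2 : infOn f r t < c := hc1
        rw [infOn_split f.nonneg hrb hb2.le, min_eq_right hcon.le] at h2
        obtain ⟨v, hv1, hv2, hv3⟩ := exists_lt_of_infOn_lt hb2.le h2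
        rcases eq_or_lt_of_le hv2 with e | e
        · rw [e] at hv3; linarith [f.leftVal_le t]
        · linarith [hav v (((le_max_left _ _).trans_lt hb1).trans_le hv1) e]
      have h2 := hlt b hrb hb2
      rw [relPos_of_le hrb, relPos_of_le hrt.le, h1] at h2
      exact lt_irrefl _ h2
    obtain ⟨C, hC⟩ := exists_loopBound_self Φ f
    refine ⟨t', ?_⟩
    have hloop : Tendsto (fun s => Φ.loopTerm f s t' r) (𝓝[<] t) (𝓝 0) := by
      have hc : Tendsto (fun s => clampDiv D (relPos f r s)) (𝓝[<] t)
          (𝓝[>] (clampDiv D (relPos f r t))) := by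
        refine tendsto_nhdsWithin_iff.2 ⟨((continuous_clampDiv _).tendsto _).comp
          (f.tendsto_relPos_left hrt), ?_⟩
        filter_upwards [Ioo_mem_nhdsLT hrt] with s hs
        exact clampDiv_lt hD hpos.le (hlt s hs.1.le hs.2) (f.relPos_le_jump r s)
      have h2 := (tendsto_iff_dist_tendsto_zero.1 (hl.comp hc)).const_mul D
      rw [mul_zero] at h2
      refine h2.congr fun s => ?_
      rw [loopTerm, hx', loopLength, clampDiv_mul hD, hy]
      rfl
    have hlim : Tendsto (fun s => β * Φ.loopTerm f s t' r
        + (α + β * C) * ((f s - infOn f r s) + (f t' - infOn f r t'))) (𝓝[<] t)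
        (𝓝 (β * 0 + (α + β * C) * ((leftVal f t - infOn f r t) + (f t' - infOn f r t')))) :=
      (hloop.const_mul β).add ((((f.tendsto_left ht0).sub
        (f.tendsto_infOn_left hrt)).add_const _).const_mul _)
    rw [hinf, hinf', sub_self, sub_self, add_zero, mul_zero, mul_zero, add_zero] at hlim
    refine tendsto_of_tendsto_of_tendsto_of_le_of_le' tendsto_const_nhds hlim
      (Eventually.of_forall fun s => gdist_nonneg hα hβ s t') ?_
    filter_upwards [Ioo_mem_nhdsLT hrt] with s hs
    have := gdist_le_of_anc hα hβ hC (f.anc_of_anc_le hanc hs.1.le hs.2.le) hanc'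
    rwa [hinf', sub_self] at this
  · push Not at hcase
    -- every loop below `t` is seen from `s` at an eventually constant position, or at a position that
    -- tends to `0`, and `s` converges to the next time at which `f` is at level `f(t-)`
    obtain ⟨t', htt', hft', hge⟩ := f.exists_first_hit (f.leftVal_nonneg t) (f.leftVal_le t)
    have hinf : ∀ r < t, infOn f r t' = infOn f r t := fun r hr => by
      rw [infOn_split f.nonneg hr.le htt', min_eq_left]
      exact (f.infOn_le_leftVal hr le_rfl).trans (le_infOn htt' hge)
    refine ⟨t', tendsto_gdist ?_ fun r => ?_⟩
    · have hi : Tendsto (fun s => infOn f s t') (𝓝[<] t) (𝓝 (leftVal f t)) := by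
        rw [tendsto_order]
        constructor
        · intro a ha
          obtain ⟨b, hab, hb⟩ := exists_between ha
          obtain ⟨s₀, hs₀, hs⟩ := f.exists_lt_left ht0 hb
          filter_upwards [Ioo_mem_nhdsLT hs₀] with s hs'
          refine hab.trans_le (le_infOn (hs'.2.le.trans htt') fun v hv hv' => ?_)
          rcases lt_or_ge v t with h | h
          · exact (hs v (hs'.1.trans_le hv) h).le
          · exact hb.le.trans (hge v h hv')
        · intro a ha
          filter_upwards [self_mem_nhdsWithin] with s hs
          exact (infOn_le f.nonneg ((le_of_lt hs).trans htt') le_rfl).trans_lt (hft' ▸ ha)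
      have h := ((f.tendsto_left ht0).add_const (f t')).sub (hi.const_mul 2)
      rw [hft', ← two_mul, sub_self] at h
      refine h.congr' ?_
      filter_upwards [self_mem_nhdsWithin] with s hs
      rw [infBetween_of_le ((le_of_lt hs).trans htt'), hft']
    · rcases lt_trichotomy r t with h | h | h
      · have hx : relPos f r t' = relPos f r t := by
          rw [relPos_of_le (h.le.trans htt'), relPos_of_le h.le, hinf r h]
        rcases eq_or_lt_of_le (relPos_nonneg f r t) with e | hpos
        · obtain ⟨C, hC⟩ := exists_loopBound_self Φ f
          have h1 : Tendsto (fun s => C * (relPos f r s + relPos f r t')) (𝓝[<] t)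
              (𝓝 (C * (relPos f r t + relPos f r t'))) :=
            ((f.tendsto_relPos_left h).add_const _).const_mul _
          rw [hx, ← e, add_zero, mul_zero] at h1
          refine squeeze_zero (fun s => loopTerm_nonneg s t' r) (fun s => ?_) h1
          have := hC.loopTerm_le s t' r
          rwa [hx, ← e] at this
        · obtain ⟨s₀, h1, h2, h3⟩ := hcase r h hpos
          refine tendsto_const_nhds.congr' ?_
          filter_upwards [Ioo_mem_nhdsLT h2] with s hs
          rw [loopTerm_eq_zero]
          rw [hx]
          exact le_antisymm ((f.relPos_anti h1 hs.1.le).trans h3)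
            (f.relPos_anti (h1.trans hs.1.le) hs.2.le)
      · have hx : relPos f r t' = 0 := by
          rw [h, relPos_of_le htt', max_eq_right]
          linarith [infOn_le f.nonneg htt' (le_refl t')]
        refine tendsto_const_nhds.congr' ?_
        filter_upwards [self_mem_nhdsWithin] with s hs
        rw [loopTerm_eq_zero]
        rw [hx, h, relPos_of_lt hs]
      · have hx : relPos f r t' = 0 := by
          rcases le_or_gt r t' with h' | h'
          · rw [relPos_of_le h', max_eq_right]
            have h1 := infOn_le f.nonneg h' (le_refl t')
            have h2 : leftVal f t ≤ leftVal f r :=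
              f.le_leftVal h fun v hv hv' => hge v hv (hv'.le.trans h')
            linarith
          · exact relPos_of_lt h'
        refine tendsto_const_nhds.congr' ?_
        filter_upwards [self_mem_nhdsWithin] with s hs
        rw [loopTerm_eq_zero]
        rw [hx, relPos_of_lt (lt_trans hs h)]

end LoopShape

/-! ### Compactness and measurability of the quotients -/

/-- A pseudo-distance for which `[0,1]` is right-continuous with left limits in the quotient codes a
compact space: every ultrafilter on `[0,1]` approaches its limit from one side. -/
theorem isCode_of_tendsto {d : I → I → ℝ} (hd : IsPseudoDist d)
    (hR : ∀ t, Tendsto (fun s => d s t) (𝓝[>] t) (𝓝 0))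
    (hL : ∀ t, ∃ t', Tendsto (fun s => d s t') (𝓝[<] t) (𝓝 0)) : IsCode d where
  isPseudoDist := hd
  compactSpace := by
    have : CompactSpace (PseudoI d hd) := by
      refine ⟨isCompact_iff_ultrafilter_le_nhds.2 fun 𝒰 _ => ?_⟩
      let 𝒱 : Ultrafilter I := 𝒰
      have key : ∀ t : PseudoI d hd, Tendsto (fun s : I => d s t) (𝒱 : Filter I) (𝓝 0) →
          (𝒰 : Filter (PseudoI d hd)) ≤ 𝓝 t := fun t ht => by
        have : Tendsto (fun s : PseudoI d hd => s) 𝒰 (𝓝 t) :=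
          tendsto_iff_dist_tendsto_zero.2 ht
        exact this
      obtain ⟨t, -, ht⟩ := isCompact_iff_ultrafilter_le_nhds.1 (isCompact_univ (X := I)) 𝒱 (by simp)
      have hcases : Iio t ∈ 𝒱 ∨ {t} ∈ 𝒱 ∨ Ioi t ∈ 𝒱 := by
        have huniv : Iio t ∪ ({t} ∪ Ioi t) = univ := by
          ext s
          simp
        rw [← Ultrafilter.union_mem_iff, ← Ultrafilter.union_mem_iff, huniv]
        exact Filter.univ_mem
      rcases hcases with h | h | h
      · obtain ⟨t', ht'⟩ := hL t
        refine ⟨t', trivial, key t' (ht'.mono_left ?_)⟩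
        exact le_inf ht (le_principal_iff.2 h)
      · refine ⟨t, trivial, key t ?_⟩
        have h1 : Tendsto (fun s => d s t) (pure t) (𝓝 0) := by
          rw [tendsto_pure_left]
          intro s hs
          rw [hd.self]
          exact mem_of_mem_nhds hs
        refine h1.mono_left ?_
        rw [← principal_singleton]
        exact le_principal_iff.2 h
      · exact ⟨t, trivial, key t ((hR t).mono_left (le_inf ht (le_principal_iff.2 h)))⟩
    exact Quotient.compactSpace
  measurable := by
    refine @measurable_of_isOpen _ I _ (borel _) (@BorelSpace.mk _ _ (borel _) rfl) _ _ fun U hU => ?_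
    refine MeasurableSet.of_mem_nhdsGT fun t ht => ?_
    obtain ⟨ε, hε, hball⟩ := Metric.isOpen_iff.1 hU _ ht
    filter_upwards [(hR t).eventually_lt_const hε] with s hs
    exact hball hs

namespace LoopShape

theorem isCode_gdist (Φ : LoopShape) (f : Excursion) {α β : ℝ} (hα : 0 ≤ α) (hβ : 0 ≤ β) :
    IsCode (Φ.gdist f α β) :=
  isCode_of_tendsto (isPseudoDist_gdist hα hβ) (tendsto_gdist_right Φ f α β)
    (exists_tendsto_gdist_left Φ f hα hβ)

end LoopShape

/-! ### The standard and the shuffled loops -/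

theorem dist_coe_unitAddCircle (a b : I) :
    dist ((a : ℝ) : UnitAddCircle) ((b : ℝ) : UnitAddCircle)
      = min |(a : ℝ) - b| (1 - |(a : ℝ) - b|) := by
  wlog h : (b : ℝ) ≤ a generalizing a b
  · rw [dist_comm, this b a (le_of_not_ge h), abs_sub_comm]
  rw [dist_eq_norm, ← AddCircle.coe_sub, UnitAddCircle.norm_eq, abs_sub_round_eq_min,
    abs_of_nonneg (sub_nonneg.2 h)]
  rcases eq_or_lt_of_le (show (a : ℝ) - b ≤ 1 by linarith [a.2.2, b.2.1]) with e | e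
  · rw [e]; simp
  · rw [Int.fract_eq_self.2 ⟨sub_nonneg.2 h, e⟩]

/-- The usual loops, `φ_D(x) = x mod 1`. -/
def LoopShape.standard : LoopShape where
  toFun _ x := ((x : ℝ) : UnitAddCircle)
  left_continuous _ _ _ := by
    apply Continuous.continuousWithinAt
    exact (AddCircle.continuous_mk' (1 : ℝ)).comp continuous_subtype_val
  exists_right_limit _ _ x := ⟨_, (Continuous.tendsto
    ((AddCircle.continuous_mk' (1 : ℝ)).comp continuous_subtype_val) x).mono_left
      nhdsWithin_le_nhds⟩
  surjective _ _ y := by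
    induction y using QuotientAddGroup.induction_on with
    | H x =>
      refine ⟨⟨Int.fract x, Int.fract_nonneg x, (Int.fract_lt_one x).le⟩, ?_⟩
      refine (QuotientAddGroup.eq_iff_sub_mem.2 ?_)
      rw [AddSubgroup.mem_zmultiples_iff]
      refine ⟨-⌊x⌋, ?_⟩
      have := Int.self_sub_fract x
      simp only [zsmul_eq_mul, mul_one, Int.cast_neg]
      linarith
  bounded _ := ⟨1, zero_le_one, fun _ _ _ x => by
    rw [dist_coe_unitAddCircle]
    refine (min_le_left _ _).trans (le_of_eq ?_)
    simp [abs_of_nonneg x.2.1]⟩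

theorem LoopShape.standard_loopLength {D a b : ℝ} (hD : 0 ≤ D) (ha : 0 ≤ a) (haD : a ≤ D)
    (hb : 0 ≤ b) (hbD : b ≤ D) :
    LoopShape.standard.loopLength D a b = min |a - b| (D - |a - b|) := by
  rcases eq_or_lt_of_le hD with e | h
  · have h1 : a = 0 := by linarith
    have h2 : b = 0 := by linarith
    rw [loopLength, ← e, h1, h2]; simp
  · rw [loopLength, standard]
    simp only
    rw [dist_coe_unitAddCircle, clampDiv_coe h ha haD, clampDiv_coe h hb hbD, mul_min_of_nonneg _ _ hD,
      ← sub_div, abs_div, abs_of_pos h, mul_sub, mul_div_cancel₀ _ h.ne', mul_one]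

open Classical in
/-- The family of loops of a shuffle. -/
def Shuffle.shape (Φ : Shuffle) : LoopShape where
  toFun D := if h : 0 < D then Φ.toFun ⟨D, h⟩ else fun _ => 0
  left_continuous D hD x := by
    rw [dif_pos hD]
    exact (Φ.toFun ⟨D, hD⟩).left_continuous x
  exists_right_limit D hD x := by
    rw [dif_pos hD]
    exact (Φ.toFun ⟨D, hD⟩).exists_right_limit x
  surjective D hD := by
    rw [dif_pos hD]
    exact Φ.surjective ⟨D, hD⟩
  bounded D := by
    by_cases hD : 0 < D
    · obtain ⟨K, hK⟩ := Φ.bounded ⟨D, hD⟩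
      have hK0 : 0 ≤ K := (abs_nonneg _).trans (hK ⟨D, hD⟩ le_rfl 1 zero_lt_one)
      refine ⟨(K + 1) / 2, by positivity, fun u hu huD x => ?_⟩
      rw [dif_pos hu]
      rcases eq_or_lt_of_le (unitInterval.nonneg' : (0 : I) ≤ x) with e | hx
      · rw [← e, dist_self]; simp
      · have h1 := (abs_le.1 (hK ⟨u, hu⟩ huD x hx)).2
        have hx' : (0 : ℝ) < x := hx
        have h2 : 2 / (x : ℝ) * dist (Φ.toFun ⟨u, hu⟩ 0) (Φ.toFun ⟨u, hu⟩ x) ≤ K + 1 := by linarith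
        rw [div_mul_eq_mul_div, div_le_iff₀ hx'] at h2
        linarith
    · exact ⟨0, le_rfl, fun u hu huD => absurd (hu.trans_le huD) hD⟩

theorem Shuffle.shape_apply (Φ : Shuffle) {D : ℝ} (hD : 0 < D) :
    Φ.shape.toFun D = Φ.toFun ⟨D, hD⟩ := dif_pos hD

theorem shuffledDelta_eq (Φ : Shuffle) (f : Excursion) (t : I) (a b : ℝ) :
    shuffledDelta Φ f t a b = Φ.shape.loopLength (jump f t) a b := by
  rw [shuffledDelta, LoopShape.loopLength]
  split_ifs with h
  · rw [Φ.shape_apply h]; rfl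
  · rw [le_antisymm (not_lt.1 h) (f.jump_nonneg t), zero_mul]

theorem shuffledLoopDist_eq (Φ : Shuffle) (f : Excursion) (s t : I) :
    shuffledLoopDist Φ f s t = Φ.shape.circDist f s t := by
  rw [LoopShape.circDist]
  simp only [LoopShape.loopTerm]
  rw [← f.mrca_sum_eq_tsum (fun r a b => Φ.shape.loopLength (jump f r) a b)
    (fun r a => Φ.shape.loopLength_self _ a) (fun r a b => Φ.shape.loopLength_comm _ a b) s t
    (LoopShape.summable_loopTerm Φ.shape f s t)]
  simp only [shuffledLoopDist, shuffledLoopDist₀, shuffledDelta_eq]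

theorem loopDelta_eq (f : Excursion) (r : I) {a b : ℝ} (ha : 0 ≤ a) (haD : a ≤ jump f r)
    (hb : 0 ≤ b) (hbD : b ≤ jump f r) :
    loopDelta f r a b = LoopShape.standard.loopLength (jump f r) a b := by
  rw [LoopShape.standard_loopLength (f.jump_nonneg r) ha haD hb hbD, loopDelta]

theorem loopDist_eq (f : Excursion) (s t : I) :
    loopDist f s t = LoopShape.standard.circDist f s t := by
  rw [LoopShape.circDist]
  simp only [LoopShape.loopTerm]
  rw [← f.mrca_sum_eq_tsum (fun r a b => LoopShape.standard.loopLength (jump f r) a b)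
    (fun r a => LoopShape.loopLength_self _ _ a) (fun r a b => LoopShape.loopLength_comm _ _ a b)
    s t (LoopShape.summable_loopTerm LoopShape.standard f s t)]
  have e : ∀ r w, loopDelta f r 0 (relPos f r w)
      = LoopShape.standard.loopLength (jump f r) 0 (relPos f r w) := fun r w =>
    loopDelta_eq f r le_rfl (f.jump_nonneg r) (relPos_nonneg _ _ _) (f.relPos_le_jump _ _)
  simp only [loopDist, loopDist₀, e]
  rw [loopDelta_eq f _ (relPos_nonneg _ _ _) (f.relPos_le_jump _ _) (relPos_nonneg _ _ _)
    (f.relPos_le_jump _ _)]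

/-! ### Changes of time -/

namespace LoopShape

/-- If `F = f ∘ a` and every jump time `r` of `f` corresponds to the jump time `i r` of `F`, the
pseudo-distances coded by `F` are those coded by `f`, transported by `a`. -/
theorem gdist_timeChange (Φ : LoopShape) (α β : ℝ) {F f : Excursion} {a i : I → I}
    (hi : Function.Injective i) (hval : ∀ t, F t = f (a t))
    (hinf : ∀ s t, infBetween F s t = infBetween f (a s) (a t))
    (hjump : ∀ r, jump F (i r) = jump f r)
    (hpos : ∀ r t, relPos F (i r) t = relPos f r (a t))
    (hout : ∀ r, r ∉ range i → ∀ t, relPos F r t = 0) (s t : I) :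
    Φ.gdist F α β s t = Φ.gdist f α β (a s) (a t) := by
  have e1 : ∑' r, |relPos F r s - relPos F r t| = ∑' r, |relPos f r (a s) - relPos f r (a t)| := by
    rw [← hi.tsum_eq]
    · simp only [hpos]
    · intro r hr
      by_contra hn
      exact hr (by simp [hout r hn])
  have e2 : Φ.circDist F s t = Φ.circDist f (a s) (a t) := by
    rw [circDist, ← hi.tsum_eq]
    · simp only [loopTerm, hpos, hjump]
      rfl
    · intro r hr
      by_contra hn
      exact hr (loopTerm_eq_zero (by rw [hout r hn, hout r hn]))
  rw [gdist, gdist, e2, F.treeDist_eq, f.treeDist_eq, e1, hinf, hval, hval]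

end LoopShape

namespace Excursion

theorem leftVal_eq_of_tendsto {g : I → ℝ} {t : I} (ht : 0 < t) {l : ℝ}
    (h : Tendsto g (𝓝[<] t) (𝓝 l)) : leftVal g t = l := by
  have := nhdsLT_neBot ht
  rw [leftVal, if_neg ht.ne', leftLim_eq_of_tendsto h]

variable (f : Excursion)

theorem tendsto_orderIso_left (l : I ≃o I) (t : I) : Tendsto l (𝓝[<] t) (𝓝[<] (l t)) :=
  tendsto_nhdsWithin_iff.2 ⟨(l.continuous.tendsto t).mono_left nhdsWithin_le_nhds, by
    filter_upwards [self_mem_nhdsWithin] with s hs using l.lt_iff_lt.2 hs⟩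

theorem orderIso_pos (l : I ≃o I) {t : I} (ht : 0 < t) : 0 < l t := by
  have h := l.lt_iff_lt.2 ht
  exact lt_of_le_of_lt unitInterval.nonneg' h

theorem leftVal_comp (l : I ≃o I) (t : I) :
    leftVal (fun s => f (l s)) t = leftVal f (l t) := by
  rcases eq_or_lt_of_le (unitInterval.nonneg' : (0 : I) ≤ t) with e | ht
  · have : l 0 = 0 := l.map_bot
    rw [← e, this]; simp [leftVal]
  · exact leftVal_eq_of_tendsto ht ((f.tendsto_left (orderIso_pos l ht)).comp
      (tendsto_orderIso_left l t))

/-- The excursion `f ∘ l`. -/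
def comp (l : I ≃o I) : Excursion where
  toFun t := f (l t)
  right_continuous t := (f.right_continuous (l t)).comp l.continuous.continuousWithinAt
    fun _ hs => l.le_iff_le.2 hs
  exists_left_limit t := by
    obtain ⟨c, hc⟩ := f.exists_left_limit (l t)
    exact ⟨c, hc.comp (tendsto_orderIso_left l t)⟩
  nonneg t := f.nonneg _
  map_one := by
    have : l 1 = 1 := l.map_top
    simp only [this, f.map_one]
  jump_nonneg t := by
    have h := f.leftVal_comp l t
    have h' := f.jump_nonneg (l t)
    unfold jump at h' ⊢
    rwa [h]

theorem jump_comp (l : I ≃o I) (t : I) : jump (f.comp l) t = jump f (l t) := by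
  have h := f.leftVal_comp l t
  unfold jump
  exact congrArg (f (l t) - ·) h

theorem infOn_comp (l : I ≃o I) (s t : I) : infOn (f.comp l) s t = infOn f (l s) (l t) := by
  rw [infOn, infOn, ← l.image_Icc, image_image]
  rfl

theorem relPos_comp (l : I ≃o I) (r t : I) : relPos (f.comp l) r t = relPos f (l r) (l t) := by
  have h : leftVal (f.comp l) r = leftVal f (l r) := f.leftVal_comp l r
  rw [relPos, relPos, f.infOn_comp, h]
  simp only [l.le_iff_le]

theorem gdist_comp (Φ : LoopShape) (α β : ℝ) (l : I ≃o I) (s t : I) :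
    Φ.gdist (f.comp l) α β s t = Φ.gdist f α β (l s) (l t) := by
  refine Φ.gdist_timeChange α β (a := l) (i := l.symm) l.symm.injective (fun _ => rfl) (fun s t => ?_)
    (fun r => ?_) (fun r t => ?_) (fun r hr => ?_) s t
  · rw [infBetween, infOn_comp, l.monotone.map_min, l.monotone.map_max]; rfl
  · rw [jump_comp, l.apply_symm_apply]
  · rw [relPos_comp, l.apply_symm_apply]
  · exact absurd (l.symm.surjective r) hr

end Excursion

/-- The time `(1 + t) / 2`, at which `Theta f` takes the value `f t`. -/
def upperHalf (t : I) : I := ⟨(1 + t) / 2, by linarith [t.2.1], by linarith [t.2.2]⟩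

/-- The time of `f` that corresponds to the time `t` of `Theta f`: the first half of `[0,1]` is sent
to the final time `1`, where `f` vanishes. -/
def lowerTime (t : I) : I := if 1 ≤ 2 * (t : ℝ) then stretch t else 1

theorem stretch_upperHalf (t : I) : stretch (upperHalf t) = t := by
  ext
  rw [stretch_coe (by simp only [upperHalf]; linarith [t.2.1]), upperHalf]
  ring

theorem lowerTime_upperHalf (t : I) : lowerTime (upperHalf t) = t := by
  rw [lowerTime, if_pos (by simp only [upperHalf]; linarith [t.2.1]), stretch_upperHalf]

theorem upperHalf_stretch {t : I} (h : 1 ≤ 2 * (t : ℝ)) : upperHalf (stretch t) = t := by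
  ext
  rw [upperHalf]
  simp only [stretch_coe h]
  ring

theorem upperHalf_le_iff {s t : I} : upperHalf s ≤ upperHalf t ↔ s ≤ t := by
  rw [← Subtype.coe_le_coe, ← Subtype.coe_le_coe, upperHalf, upperHalf]
  constructor <;> intro h <;> linarith

theorem upperHalf_injective : Function.Injective upperHalf := fun s t h => by
  rw [← stretch_upperHalf s, h, stretch_upperHalf]

theorem two_mul_upperHalf (t : I) : 1 ≤ 2 * (upperHalf t : ℝ) := by
  rw [upperHalf]; linarith [t.2.1]

theorem lowerTime_one : lowerTime 1 = 1 := by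
  have h : upperHalf 1 = 1 := by ext; simp [upperHalf]
  nth_rw 1 [← h]
  exact lowerTime_upperHalf 1

namespace Excursion

variable (f : Excursion)

theorem Theta_apply (t : I) : Theta f.toCadlag t = f (lowerTime t) := by
  change (if 1 ≤ 2 * (t : ℝ) then f (stretch t) else 0) = _
  rw [lowerTime]
  split_ifs
  · rfl
  · exact f.map_one.symm

theorem leftVal_Theta_of_le {t : I} (h : 2 * (t : ℝ) ≤ 1) : leftVal (Theta f.toCadlag) t = 0 := by
  rcases eq_or_lt_of_le (unitInterval.nonneg' : (0 : I) ≤ t) with e | ht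
  · rw [← e]; simp [leftVal]
  · refine leftVal_eq_of_tendsto ht (tendsto_const_nhds.congr' ?_)
    filter_upwards [self_mem_nhdsWithin] with u hu
    have h1 : (u : ℝ) < t := hu
    exact (if_neg (by linarith)).symm

theorem leftVal_Theta_upperHalf (t : I) :
    leftVal (Theta f.toCadlag) (upperHalf t) = leftVal f t := by
  rcases eq_or_lt_of_le (unitInterval.nonneg' : (0 : I) ≤ t) with e | ht
  · rw [← e, f.leftVal_zero, leftVal_Theta_of_le]
    simp [upperHalf]
  · have ht' : (0 : ℝ) < t := ht
    have h1 : 1 < 2 * (upperHalf t : ℝ) := by rw [upperHalf]; linarith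
    have h0 : (0 : I) < upperHalf t := by
      rw [← Subtype.coe_lt_coe]; change (0 : ℝ) < upperHalf t; linarith
    refine leftVal_eq_of_tendsto h0 ?_
    have ho : ∀ᶠ u : I in 𝓝 (upperHalf t), 1 < 2 * (u : ℝ) :=
      (isOpen_lt continuous_const (by fun_prop)).mem_nhds h1
    have hs : Tendsto stretch (𝓝[<] (upperHalf t)) (𝓝[<] t) := by
      apply tendsto_nhdsWithin_iff.2
      refine ⟨?_, ?_⟩
      · have := continuous_stretch.continuousAt.tendsto (x := upperHalf t)
        rw [stretch_upperHalf] at this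
        exact this.mono_left nhdsWithin_le_nhds
      · filter_upwards [nhdsWithin_le_nhds ho, self_mem_nhdsWithin] with u hu hut
        have h1 : u < upperHalf t := hut
        rw [← upperHalf_stretch hu.le] at h1
        exact lt_of_not_ge fun h => absurd (upperHalf_le_iff.2 h) (not_le.2 h1)
    refine ((f.tendsto_left ht).comp hs).congr' ?_
    filter_upwards [nhdsWithin_le_nhds ho] with u hu
    exact (if_pos hu.le).symm

/-- `Theta f` as an excursion. -/
def theta : Excursion where
  toCadlag := Theta f.toCadlag
  nonneg t := by rw [Theta_apply]; exact f.nonneg _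
  map_one := by rw [Theta_apply, lowerTime_one, f.map_one]
  jump_nonneg t := by
    unfold jump
    by_cases h : 1 ≤ 2 * (t : ℝ)
    · rw [← upperHalf_stretch h, Theta_apply, lowerTime_upperHalf, leftVal_Theta_upperHalf]
      exact f.jump_nonneg _
    · rw [f.leftVal_Theta_of_le (not_le.1 h).le, Theta_apply, sub_zero]
      exact f.nonneg _

theorem theta_apply (t : I) : f.theta t = f (lowerTime t) := f.Theta_apply t

theorem leftVal_theta_upperHalf (t : I) : leftVal f.theta (upperHalf t) = leftVal f t :=
  f.leftVal_Theta_upperHalf t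

theorem theta_of_lt {t : I} (h : 2 * (t : ℝ) < 1) : f.theta t = 0 := by
  rw [theta_apply, lowerTime, if_neg (not_le.2 h), f.map_one]

theorem jump_theta_upperHalf (t : I) : jump f.theta (upperHalf t) = jump f t := by
  unfold jump
  rw [leftVal_theta_upperHalf, theta_apply, lowerTime_upperHalf]

theorem jump_theta_of_lt {t : I} (h : 2 * (t : ℝ) < 1) : jump f.theta t = 0 := by
  unfold jump
  rw [f.theta_of_lt h, show leftVal f.theta t = 0 from f.leftVal_Theta_of_le h.le, sub_zero]

theorem infOn_theta {s t : I} (hst : s ≤ t) :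
    infOn f.theta (upperHalf s) (upperHalf t) = infOn f s t := by
  apply le_antisymm
  · refine le_infOn hst fun v hv hv' => ?_
    have := infOn_le f.theta.nonneg (upperHalf_le_iff.2 hv) (upperHalf_le_iff.2 hv')
    rwa [theta_apply, lowerTime_upperHalf] at this
  · refine le_infOn (upperHalf_le_iff.2 hst) fun v hv hv' => ?_
    have h1 : 1 ≤ 2 * (v : ℝ) := by
      have h2 : (upperHalf s : ℝ) ≤ v := hv
      linarith [two_mul_upperHalf s]
    rw [← upperHalf_stretch h1] at hv hv' ⊢
    rw [theta_apply, lowerTime_upperHalf]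
    exact infOn_le f.nonneg (upperHalf_le_iff.1 hv) (upperHalf_le_iff.1 hv')

theorem relPos_theta (r t : I) : relPos f.theta (upperHalf r) t = relPos f r (lowerTime t) := by
  by_cases h : 1 ≤ 2 * (t : ℝ)
  · rw [← upperHalf_stretch h, lowerTime_upperHalf]
    by_cases hr : r ≤ stretch t
    · rw [relPos_of_le hr, relPos_of_le (upperHalf_le_iff.2 hr), f.infOn_theta hr,
        leftVal_theta_upperHalf]
    · rw [relPos_of_lt (not_le.1 hr), relPos_of_lt]
      exact lt_of_not_ge fun hc => hr (upperHalf_le_iff.1 hc)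
  · rw [lowerTime, if_neg h, relPos_one, relPos_of_lt]
    have : (t : ℝ) < upperHalf r := by linarith [two_mul_upperHalf r, not_le.1 h]
    exact this

theorem relPos_theta_of_lt {r : I} (h : 2 * (r : ℝ) < 1) (t : I) : relPos f.theta r t = 0 :=
  le_antisymm ((f.theta.relPos_le_jump r t).trans (f.jump_theta_of_lt h).le) (relPos_nonneg _ _ _)

theorem mem_range_upperHalf {r : I} : r ∈ range upperHalf ↔ 1 ≤ 2 * (r : ℝ) :=
  ⟨fun ⟨s, hs⟩ => hs ▸ two_mul_upperHalf s, fun h => ⟨stretch r, upperHalf_stretch h⟩⟩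

theorem gdist_theta (Φ : LoopShape) (α β : ℝ) (s t : I) :
    Φ.gdist f.theta α β s t = Φ.gdist f α β (lowerTime s) (lowerTime t) := by
  refine Φ.gdist_timeChange α β upperHalf_injective f.theta_apply (fun s t => ?_)
    f.jump_theta_upperHalf f.relPos_theta (fun r hr => ?_) s t
  · wlog hst : s ≤ t generalizing s t
    · rw [infBetween_comm, this t s (le_of_not_ge hst), infBetween_comm]
    by_cases hs : 1 ≤ 2 * (s : ℝ)
    · have hst' : (s : ℝ) ≤ t := hst
      have ht : 1 ≤ 2 * (t : ℝ) := by linarith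
      rw [← upperHalf_stretch hs, ← upperHalf_stretch ht, lowerTime_upperHalf,
        lowerTime_upperHalf]
      rw [← upperHalf_stretch hs, ← upperHalf_stretch ht] at hst
      rw [infBetween_of_le hst, infBetween_of_le (upperHalf_le_iff.1 hst),
        f.infOn_theta (upperHalf_le_iff.1 hst)]
    · have h1 : infBetween f.theta s t = 0 := by
        refine le_antisymm ?_ (infOn_nonneg f.theta.nonneg _ _)
        rw [← f.theta_of_lt (not_le.1 hs)]
        exact infOn_le f.theta.nonneg (min_le_left _ _) (le_max_left _ _)
      have h2 : infBetween f (lowerTime s) (lowerTime t) = 0 := by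
        refine le_antisymm ?_ (infOn_nonneg f.nonneg _ _)
        rw [← f.map_one, show lowerTime s = 1 from if_neg hs]
        exact infOn_le f.nonneg (min_le_left _ _) (le_max_left _ _)
      rw [h1, h2]
  · exact f.relPos_theta_of_lt (not_le.1 fun h => hr (mem_range_upperHalf.2 h))

end Excursion

/-! ### A sufficient condition for Gromov–Hausdorff–Prokhorov proximity -/

/-- If two families of points indexed by the same set are `ε`-dense, contain the roots, and have
mutual distances that differ by at most `ε`, the pairs of points with nearly the same distances to
both families form a compact correspondence of small distortion. -/
theorem ghpDist_le {X Y : PWSpace} {J : Type*} (a : J → X.carrier) (b : J → Y.carrier)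
    {pX : I → X.carrier} {pY : I → Y.carrier} (hpX : Measurable pX) (hpY : Measurable pY)
    (mX : X.measure = volume.map pX) (mY : Y.measure = volume.map pY) {ε : ℝ} (hε : 0 ≤ ε)
    (hdist : ∀ i j, |dist (a i) (a j) - dist (b i) (b j)| ≤ ε)
    (hX : ∀ x, ∃ i, dist x (a i) ≤ ε) (hY : ∀ y, ∃ i, dist y (b i) ≤ ε)
    (hroot : ∃ i, a i = X.root ∧ b i = Y.root) (M : Set I)
    (hM : ∀ t ∈ M, ∃ i, dist (pX t) (a i) ≤ ε ∧ dist (pY t) (b i) ≤ ε)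
    (hvol : volume Mᶜ ≤ ENNReal.ofReal ε) : ghpDist X Y ≤ 4 * ε := by
  set R : Set (X.carrier × Y.carrier) := {p | ∀ i, |dist p.1 (a i) - dist p.2 (b i)| ≤ 3 * ε}
    with hR
  -- two points close to corresponding points are in correspondence
  have hmem : ∀ x y i, dist x (a i) ≤ ε → dist y (b i) ≤ ε → (x, y) ∈ R := fun x y i hx hy j => by
    have h1 := abs_le.1 (hdist i j)
    have h2 := abs_le.1 (abs_dist_sub_le x (a i) (a j))
    have h3 := abs_le.1 (abs_dist_sub_le y (b i) (b j))
    rw [abs_le]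
    constructor <;> simp only <;> linarith
  have hclosed : IsClosed R := by
    rw [hR, Set.ofPred_forall]
    refine isClosed_iInter fun i => isClosed_le ?_ continuous_const
    fun_prop
  -- the coupling that identifies the points coded by the same time
  set ν : Measure (X.carrier × Y.carrier) := volume.map fun t => (pX t, pY t) with hν
  have hpm : Measurable fun t => (pX t, pY t) := hpX.prodMk hpY
  have hprob : IsProbabilityMeasure ν := Measure.isProbabilityMeasure_map hpm.aemeasurable
  have hνR : 1 - ν.real R ≤ ε := by
    have h1 : volume ((fun t => (pX t, pY t)) ⁻¹' R) ≤ ν R :=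
      Measure.le_map_apply hpm.aemeasurable R
    have h2 : (1 : ℝ≥0∞) ≤ ν R + ENNReal.ofReal ε := by
      rw [← measure_univ (μ := (volume : Measure I))]
      calc volume (univ : Set I) ≤ volume ((fun t => (pX t, pY t)) ⁻¹' R ∪ Mᶜ) := by
            refine measure_mono fun t _ => ?_
            by_cases ht : t ∈ M
            · obtain ⟨i, h1, h2⟩ := hM t ht
              exact Or.inl (hmem _ _ i h1 h2)
            · exact Or.inr ht
        _ ≤ _ := (measure_union_le _ _).trans (add_le_add h1 hvol)
    have h3 := ENNReal.toReal_mono (by finiteness) h2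
    rw [ENNReal.toReal_add (by finiteness) (by finiteness), ENNReal.toReal_ofReal hε,
      ENNReal.toReal_one] at h3
    rw [Measure.real]
    linarith
  have hdistR : distortion R ≤ 8 * ε := by
    refine Real.sSup_le ?_ (by linarith)
    rintro _ ⟨p, hp, q, hq, rfl⟩
    obtain ⟨i, hi⟩ := hX q.1
    have h1 := abs_le.1 (hp i)
    have h2 := abs_le.1 (hq i)
    have h3 := abs_le.1 (abs_dist_sub_le q.1 (a i) p.1)
    have h4 := abs_le.1 (abs_dist_sub_le q.2 (b i) p.2)
    rw [dist_comm q.1 p.1, dist_comm (a i) p.1] at h3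
    rw [dist_comm q.2 p.2, dist_comm (b i) p.2] at h4
    rw [abs_le]
    constructor <;> linarith
  have hle : ghpDist X Y ≤ max (distortion R / 2) (1 - ν.real R) := by
    refine csInf_le ⟨0, ?_⟩ ⟨R, ν, hclosed.isCompact, ⟨fun x => ?_, fun y => ?_⟩, ?_, ?_, ?_, rfl⟩
    · rintro c ⟨R', ν', -, -, -, -, -, rfl⟩
      refine le_max_of_le_left (div_nonneg (Real.sSup_nonneg ?_) zero_le_two)
      rintro _ ⟨p, -, q, -, rfl⟩
      exact abs_nonneg _
    · obtain ⟨i, hi⟩ := hX x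
      exact ⟨b i, hmem _ _ i hi (by rw [dist_self]; exact hε)⟩
    · obtain ⟨i, hi⟩ := hY y
      exact ⟨a i, hmem _ _ i (by rw [dist_self]; exact hε) hi⟩
    · obtain ⟨i, h1, h2⟩ := hroot
      exact hmem _ _ i (by rw [h1, dist_self]; exact hε) (by rw [h2, dist_self]; exact hε)
    · rw [hν, Measure.map_map measurable_fst hpm, mX]; rfl
    · rw [hν, Measure.map_map measurable_snd hpm, mY]; rfl
  exact hle.trans (max_le (by linarith) (by linarith))

theorem ghpDist_nonneg (X Y : PWSpace) : 0 ≤ ghpDist X Y := by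
  apply Real.sInf_nonneg
  rintro c ⟨R, ν, -, -, -, -, -, rfl⟩
  refine le_max_of_le_left (div_nonneg (Real.sSup_nonneg ?_) zero_le_two)
  rintro _ ⟨p, -, q, -, rfl⟩
  exact abs_nonneg _

/-! ### Oscillations of functions with one-sided limits -/

/-- If `P s s'` holds for `s` and `s'` close to `x`, unless `x` is an exceptional point that lies
between them, then it holds for all `s` and `s'` close to each other, unless one of finitely many
exceptional points lies between them. -/
theorem exists_finite_between (Q : I → Prop) {P : I → I → Prop}
    (h : ∀ x, ∃ U ∈ 𝓝 x, ∀ s ∈ U, ∀ s' ∈ U, (Q x → x ∉ uIcc s s') → P s s') :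
    ∃ Y : Set I, Y.Finite ∧ (∀ y ∈ Y, Q y) ∧ ∃ κ > 0, ∀ s s', dist s s' < κ →
      P s s' ∨ ∃ y ∈ Y, y ∈ uIcc s s' := by
  choose U hU hP using h
  obtain ⟨S, -, hS⟩ := isCompact_univ.elim_nhds_subcover (fun x => interior (U x))
    fun x _ => interior_mem_nhds.2 (hU x)
  obtain ⟨κ, hκ, hball⟩ := lebesgue_number_lemma_of_metric (isCompact_univ (X := I))
    (c := fun x : S => interior (U x)) (fun x => isOpen_interior) fun t ht => by
      obtain ⟨x, hx, hxt⟩ := mem_iUnion₂.1 (hS ht)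
      exact mem_iUnion.2 ⟨⟨x, hx⟩, hxt⟩
  refine ⟨{y | y ∈ S ∧ Q y}, S.finite_toSet.subset fun y hy => hy.1, fun y hy => hy.2, κ, hκ,
    fun s s' hs => ?_⟩
  obtain ⟨x, hx⟩ := hball s trivial
  by_cases hc : Q x ∧ (x : I) ∈ uIcc s s'
  · exact Or.inr ⟨x, ⟨x.2, hc.1⟩, hc.2⟩
  · refine Or.inl (hP x s (interior_subset (hx (Metric.mem_ball_self hκ))) s'
      (interior_subset (hx ?_)) fun hq hm => hc ⟨hq, hm⟩)
    rw [Metric.mem_ball, dist_comm]; exact hs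

theorem dist_le_of_mem_uIcc {s t y : I} (h : y ∈ uIcc s t) : dist y t ≤ dist s t := by
  rw [Subtype.dist_eq, Subtype.dist_eq, Real.dist_eq, Real.dist_eq]
  rcases mem_uIcc.1 h with ⟨h1, h2⟩ | ⟨h1, h2⟩
  · have h1' : (s : ℝ) ≤ y := h1
    have h2' : (y : ℝ) ≤ t := h2
    rw [abs_of_nonpos (by linarith), abs_of_nonpos (by linarith)]; linarith
  · have h1' : (t : ℝ) ≤ y := h1
    have h2' : (y : ℝ) ≤ s := h2
    rw [abs_of_nonneg (by linarith), abs_of_nonneg (by linarith)]; linarith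

/-- A function with one-sided limits oscillates by more than `ε` near finitely many times only. -/
theorem exists_finite_osc {d : I → I → ℝ} (hd : IsPseudoDist d)
    (hR : ∀ t, Tendsto (fun s => d s t) (𝓝[>] t) (𝓝 0))
    (hL : ∀ t, ∃ t', Tendsto (fun s => d s t') (𝓝[<] t) (𝓝 0)) {ε : ℝ} (hε : 0 < ε) :
    ∃ Y : Set I, Y.Finite ∧ ∃ κ > 0, ∀ s s', dist s s' < κ →
      d s s' ≤ ε ∨ ∃ y ∈ Y, y ∈ uIcc s s' := by
  obtain ⟨Y, hY, -, h⟩ := exists_finite_between (fun _ => True) (P := fun s s' => d s s' ≤ ε)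
    fun x => by
      obtain ⟨x', hx'⟩ := hL x
      have h1 := eventually_nhdsWithin_iff.1 ((hR x).eventually_lt_const (half_pos hε))
      have h2 := eventually_nhdsWithin_iff.1 (hx'.eventually_lt_const (half_pos hε))
      refine ⟨_, h1.and h2, fun s hs s' hs' hx => ?_⟩
      have hx := hx trivial
      have key : ∀ z, d s z < ε / 2 → d s' z < ε / 2 → d s s' ≤ ε := fun z h h' => by
        have := hd.triangle s z s'
        rw [hd.comm z s'] at this
        linarith
      rw [mem_uIcc, not_or, not_and_or, not_and_or, not_le, not_le, not_le, not_le] at hx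
      rcases lt_trichotomy s x with h | h | h
      · have h' : s' < x := hx.1.resolve_left (not_lt.2 h.le)
        exact key x' (hs.2 h) (hs'.2 h')
      · rcases hx.1 with h' | h'
        · exact absurd h' (by rw [h]; exact lt_irrefl _)
        · rcases hx.2 with h'' | h''
          · exact absurd h' (not_lt.2 h''.le)
          · exact absurd h'' (by rw [h]; exact lt_irrefl _)
      · have h' : x < s' := hx.2.resolve_right (not_lt.2 h.le)
        exact key x (hs.1 h) (hs'.1 h')
  exact ⟨Y, hY, h⟩

namespace LoopShape

variable (Φ : LoopShape)

/-! ### Discarding the small jumps -/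

/-- The error made at `t` when the loop of the jump at `r` is replaced by a segment. -/
def tailTerm (f : Excursion) (α β : ℝ) (t r : I) : ℝ :=
  β * Φ.loopLength (jump f r) 0 (relPos f r t) - α * relPos f r t

/-- The contribution of the jump at `r` to the distance between `s` and `t`, compared to a tree. -/
def gterm (f : Excursion) (α β : ℝ) (s t r : I) : ℝ :=
  β * Φ.loopTerm f s t r - α * |relPos f r s - relPos f r t|

variable {Φ} {f : Excursion}

theorem summable_gterm (α β : ℝ) (s t : I) : Summable (Φ.gterm f α β s t) :=
  ((summable_loopTerm Φ f s t).mul_left β).sub ((f.summable_abs_relPos_sub s t).mul_left α)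

/-- The distance as that of the real tree coded by `f`, corrected by one term for each jump. -/
theorem gdist_eq (α β : ℝ) (s t : I) : Φ.gdist f α β s t
    = α * (f s + f t - 2 * infBetween f s t) + ∑' r, Φ.gterm f α β s t r := by
  have h : ∑' r, Φ.gterm f α β s t r
      = β * Φ.circDist f s t - α * ∑' r, |relPos f r s - relPos f r t| := by
    rw [circDist, ← tsum_mul_left, ← tsum_mul_left]
    exact ((summable_loopTerm Φ f s t).mul_left β).tsum_sub
      ((f.summable_abs_relPos_sub s t).mul_left α)
  rw [h, gdist, f.treeDist_eq]
  ring

/-- If the loops outside `S` are small and close to segments on average, only those of `S` matter.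
At most one jump separates `s` and `t` at two positive positions; all the others contribute as
between `0` and `s` or between `0` and `t`. -/
theorem abs_gdist_sub_le {α β C η ε : ℝ} (hα : 0 ≤ α) (hβ : 0 ≤ β) (hC : Φ.LoopBound f C)
    (hη : 0 ≤ η) (S : Finset I) (hS : ∀ r, r ∉ S → jump f r ≤ η)
    (htail : ∀ t, ∀ T : Finset I, (∀ r ∈ T, r ∉ S) → ∑ r ∈ T, |Φ.tailTerm f α β t r| ≤ ε)
    (s t : I) :
    |Φ.gdist f α β s t
        - (α * (f s + f t - 2 * infBetween f s t) + ∑ r ∈ S, Φ.gterm f α β s t r)|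
      ≤ 2 * ε + (2 * β * C + α) * η := by
  classical
  set K := (2 * β * C + α) * η with hK
  have hK0 : 0 ≤ K := mul_nonneg (by have := hC.1; positivity) hη
  -- the jumps on which `s` and `t` have distinct positive positions: there is at most one
  set E : I → Prop := fun r => 0 < relPos f r s ∧ 0 < relPos f r t ∧ relPos f r s ≠ relPos f r t
    with hE
  have hEsub : ∀ r r', E r → E r' → r = r' := by
    have aux : ∀ r r', r < r' → E r → E r' → False := fun r r' h h1 h2 =>
      h1.2.2 (f.relPos_eq_of_anc h (anc_of_relPos_pos h2.1) (anc_of_relPos_pos h2.2.1))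
    intro r r' h1 h2
    rcases lt_trichotomy r r' with h | h | h
    · exact (aux r r' h h1 h2).elim
    · exact h
    · exact (aux r' r h h2 h1).elim
  have hterm : ∀ r, r ∉ S → |Φ.gterm f α β s t r|
      ≤ |Φ.tailTerm f α β s r| + |Φ.tailTerm f α β t r| + if E r then K else 0 := by
    intro r hr
    by_cases hEr : E r
    · rw [if_pos hEr]
      have hx := (f.relPos_le_jump r s).trans (hS r hr)
      have hy := (f.relPos_le_jump r t).trans (hS r hr)
      have hx0 := relPos_nonneg f r s
      have hy0 := relPos_nonneg f r t
      have h1 : |relPos f r s - relPos f r t| ≤ η := by rw [abs_le]; constructor <;> linarith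
      have h2 : Φ.loopTerm f s t r ≤ C * (2 * η) :=
        (hC.loopTerm_le s t r).trans (mul_le_mul_of_nonneg_left (by linarith) hC.1)
      have h3 := mul_le_mul_of_nonneg_left h1 hα
      have h4 := mul_le_mul_of_nonneg_left h2 hβ
      have h5 := mul_nonneg hα (abs_nonneg (relPos f r s - relPos f r t))
      have h6 := mul_nonneg hβ (loopTerm_nonneg (Φ := Φ) (f := f) s t r)
      have h7 : 0 ≤ α * η := mul_nonneg hα hη
      have h8 : 0 ≤ β * (C * (2 * η)) := h6.trans h4
      have h9 : |Φ.gterm f α β s t r| ≤ K := by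
        rw [gterm, hK, abs_le]; constructor <;> linarith
      linarith [abs_nonneg (Φ.tailTerm f α β s r), abs_nonneg (Φ.tailTerm f α β t r)]
    · rw [if_neg hEr, add_zero]
      by_cases hs0 : relPos f r s = 0
      · have : Φ.gterm f α β s t r = Φ.tailTerm f α β t r := by
          rw [gterm, tailTerm, loopTerm, hs0, zero_sub, abs_neg,
            abs_of_nonneg (relPos_nonneg _ _ _)]
        rw [this]
        linarith [abs_nonneg (Φ.tailTerm f α β s r)]
      by_cases ht0 : relPos f r t = 0
      · have : Φ.gterm f α β s t r = Φ.tailTerm f α β s r := by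
          rw [gterm, tailTerm, loopTerm_comm, loopTerm, ht0, sub_zero,
            abs_of_nonneg (relPos_nonneg _ _ _)]
        rw [this]
        linarith [abs_nonneg (Φ.tailTerm f α β t r)]
      have heq : relPos f r s = relPos f r t := by
        by_contra hne
        exact hEr ⟨lt_of_le_of_ne (relPos_nonneg _ _ _) (Ne.symm hs0),
          lt_of_le_of_ne (relPos_nonneg _ _ _) (Ne.symm ht0), hne⟩
      rw [gterm, loopTerm_eq_zero heq, heq, sub_self, abs_zero, mul_zero, mul_zero, sub_zero,
        abs_zero]
      positivity
  have hsum : ∀ T : Finset I, (∀ r ∈ T, r ∉ S) → |∑ r ∈ T, Φ.gterm f α β s t r| ≤ 2 * ε + K := by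
    intro T hT
    refine (Finset.abs_sum_le_sum_abs _ _).trans
      ((Finset.sum_le_sum fun r hr => hterm r (hT r hr)).trans ?_)
    rw [Finset.sum_add_distrib, Finset.sum_add_distrib, ← Finset.sum_filter, Finset.sum_const,
      nsmul_eq_mul]
    have hcard : (T.filter E).card ≤ 1 := Finset.card_le_one.2 fun a ha b hb =>
      hEsub a b (Finset.mem_filter.1 ha).2 (Finset.mem_filter.1 hb).2
    have hcard' : ((T.filter E).card : ℝ) * K ≤ 1 * K :=
      mul_le_mul_of_nonneg_right (by exact_mod_cast hcard) hK0
    linarith [htail s T hT, htail t T hT]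
  have hlim : Tendsto (fun T : Finset I => |∑ r ∈ T, Φ.gterm f α β s t r
      - ∑ r ∈ S, Φ.gterm f α β s t r|) atTop
      (𝓝 |∑' r, Φ.gterm f α β s t r - ∑ r ∈ S, Φ.gterm f α β s t r|) :=
    (Filter.Tendsto.sub (summable_gterm α β s t).hasSum tendsto_const_nhds).abs
  rw [gdist_eq, add_sub_add_left_eq_sub]
  refine le_of_tendsto hlim ?_
  filter_upwards [eventually_ge_atTop S] with T hT
  rw [← Finset.sum_sdiff hT, add_sub_cancel_right]
  exact hsum _ fun r hr => (Finset.mem_sdiff.1 hr).2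

end LoopShape

/-! ### Convergence of the positions on the loops -/

/-- Uniform convergence of excursions. -/
def UnifTendsto (F : ℕ → Excursion) (f : Excursion) : Prop :=
  ∀ δ > 0, ∀ᶠ n in atTop, ∀ t, |F n t - f t| ≤ δ

theorem UnifTendsto.exists_le {F : ℕ → Excursion} {f : Excursion} (h : UnifTendsto F f) :
    ∃ M, 0 ≤ M ∧ (∀ t, f t ≤ M) ∧ ∀ᶠ n in atTop, ∀ t, F n t ≤ M := by
  obtain ⟨M, hM0, hM⟩ := f.exists_le
  refine ⟨M + 1, by linarith, fun t => (hM t).trans (by linarith), ?_⟩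
  filter_upwards [h 1 one_pos] with n hn t
  linarith [(abs_le.1 (hn t)).2, hM t]

theorem abs_clampDiv_sub_le {D D' x x' δ : ℝ} (hD : 0 < D) (hD' : D / 2 ≤ D') (hx0 : 0 ≤ x)
    (hxD : x ≤ D) (hx0' : 0 ≤ x') (hxD' : x' ≤ D') (hx : |x' - x| ≤ δ) (hDD : |D' - D| ≤ δ) :
    dist (clampDiv D' x') (clampDiv D x) ≤ 4 * δ / D := by
  have hD'0 : 0 < D' := (half_pos hD).trans_le hD'
  have hδ : 0 ≤ δ := (abs_nonneg _).trans hx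
  rw [Subtype.dist_eq, Real.dist_eq, clampDiv_coe hD hx0 hxD, clampDiv_coe hD'0 hx0' hxD']
  have e : x' / D' - x / D = ((x' - x) + (D - D') * (x / D)) / D' := by
    field_simp
    ring
  rw [e, abs_div, abs_of_pos hD'0, div_le_div_iff₀ hD'0 hD]
  have h1 : |(D - D') * (x / D)| ≤ δ := by
    rw [abs_mul, abs_sub_comm]
    have h2 : |x / D| ≤ 1 := by
      rw [abs_of_nonneg (div_nonneg hx0 hD.le)]
      exact (div_le_one hD).2 hxD
    calc |D' - D| * |x / D| ≤ δ * 1 := mul_le_mul hDD h2 (abs_nonneg _) hδ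
      _ = δ := mul_one _
  have h2 : |x' - x + (D - D') * (x / D)| ≤ 2 * δ := (abs_add_le _ _).trans (by linarith)
  calc |x' - x + (D - D') * (x / D)| * D ≤ 2 * δ * D := mul_le_mul_of_nonneg_right h2 hD.le
    _ ≤ 4 * δ * D' := by nlinarith

namespace LoopShape

variable (Φ : LoopShape)

/-- Continuity at `D` of the family of loops for the Skorokhod topology. -/
def ContAt (D : ℝ) : Prop :=
  ∀ ε > 0, ∃ η > 0, ∀ u, 0 < u → |u - D| < η → ∃ l : I ≃o I, (∀ x, dist (l x) x ≤ ε) ∧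
    ∀ x, dist (Φ.toFun D x) (Φ.toFun u (l x)) ≤ ε

/-- The family of loops is continuous at the heights of the jumps of `f`, and a discontinuity of a
loop is seen from at most one time. -/
def Compatible (f : Excursion) : Prop :=
  ∀ r, 0 < jump f r → Φ.ContAt (jump f r) ∧ ∀ s t, s ≠ t → relPos f r t = relPos f r s →
    0 < relPos f r s → ContinuousAt (Φ.toFun (jump f r)) (clampDiv (jump f r) (relPos f r t))

/-- The point of the circle at which `t` is seen from the loop at `r`. -/
def pos (f : Excursion) (r t : I) : UnitAddCircle :=
  Φ.toFun (jump f r) (clampDiv (jump f r) (relPos f r t))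

/-- `p` is the only time at its position on the loop at `r`, away from the origin of the loop. -/
def IsCritical (f : Excursion) (r p : I) : Prop :=
  0 < relPos f r p ∧ relPos f r p < jump f r ∧ ∀ t, t ≠ p → relPos f r t ≠ relPos f r p

variable {Φ}

theorem continuousAt_zero {D : ℝ} (hD : 0 < D) : ContinuousAt (Φ.toFun D) 0 := by
  obtain ⟨K, hK, H⟩ := Φ.bounded D
  rw [ContinuousAt, tendsto_iff_dist_tendsto_zero]
  refine squeeze_zero (fun _ => dist_nonneg) (fun x => ?_)
    (show Tendsto (fun x : I => K * (x : ℝ)) (𝓝 0) (𝓝 0) from ?_)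
  · rw [dist_comm]; exact H D hD le_rfl x
  · have : Continuous fun x : I => K * (x : ℝ) := by fun_prop
    have h := this.tendsto 0
    simpa using h

/-- Loops are left-continuous, so that position `1` is never a discontinuity. -/
theorem continuousAt_one {D : ℝ} (hD : 0 < D) : ContinuousAt (Φ.toFun D) 1 := by
  have h := Φ.left_continuous D hD 1
  rwa [show Iic (1 : I) = univ from eq_univ_of_forall fun x => unitInterval.le_one',
    continuousWithinAt_univ] at h

/-- For large `n`, the point of the circle at which `t` is seen from the loop at `r` in `F n` is
close to the value of the limiting loop at some position close to that of `t`. -/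
theorem eventually_exists_near {F : ℕ → Excursion} {f : Excursion} (hF : UnifTendsto F f)
    (hc : Φ.Compatible f) {r : I} (hr : 0 < jump f r) {ε : ℝ} (hε : 0 < ε) :
    ∀ᶠ n in atTop, 0 < jump (F n) r ∧ ∀ t, ∃ v, dist (Φ.pos (F n) r t) (Φ.toFun (jump f r) v) ≤ ε ∧
      dist v (clampDiv (jump f r) (relPos f r t)) ≤ ε := by
  set D := jump f r with hDdef
  obtain ⟨η, hη, H⟩ := (hc r hr).1 (ε / 2) (half_pos hε)
  set δ := min (min (D / 4) (η / 4)) (ε * D / 16) with hδdef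
  have hδ : 0 < δ := by
    refine lt_min (lt_min ?_ ?_) ?_ <;> positivity
  filter_upwards [hF δ hδ] with n hn
  have h1 : |jump (F n) r - D| ≤ 2 * δ := abs_jump_sub_le _ _ hn r
  have hδ1 : δ ≤ D / 4 := (min_le_left _ _).trans (min_le_left _ _)
  have hδ2 : δ ≤ η / 4 := (min_le_left _ _).trans (min_le_right _ _)
  have hδ3 : δ ≤ ε * D / 16 := min_le_right _ _
  have h2 : D / 2 ≤ jump (F n) r := by linarith [(abs_le.1 h1).1]
  have h3 : 0 < jump (F n) r := by linarith
  obtain ⟨l, hl1, hl2⟩ := H (jump (F n) r) h3 (by linarith)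
  refine ⟨h3, fun t => ?_⟩
  set w' := clampDiv (jump (F n) r) (relPos (F n) r t) with hw'
  refine ⟨l.symm w', ?_, ?_⟩
  · have := hl2 (l.symm w')
    rw [l.apply_symm_apply, dist_comm] at this
    exact this.trans (by linarith)
  · have h4 := hl1 (l.symm w')
    rw [l.apply_symm_apply, dist_comm] at h4
    have h5 : dist w' (clampDiv D (relPos f r t)) ≤ 4 * (2 * δ) / D :=
      abs_clampDiv_sub_le hr h2 (relPos_nonneg _ _ _) (f.relPos_le_jump _ _) (relPos_nonneg _ _ _)
        ((F n).relPos_le_jump _ _) (abs_relPos_sub_le _ _ hn r t) h1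
    have h6 : 4 * (2 * δ) / D ≤ ε / 2 := by
      rw [div_le_iff₀ hr]; linarith
    exact (dist_triangle _ w' _).trans (by linarith)

/-- Away from finitely many critical times, the positions on the loop at `r` converge uniformly. -/
theorem exists_finite_pos_tendsto {F : ℕ → Excursion} {f : Excursion} (hF : UnifTendsto F f)
    (hc : Φ.Compatible f) {r : I} (hr : 0 < jump f r) {ε : ℝ} (hε : 0 < ε) :
    ∃ P : Set I, P.Finite ∧ (∀ p ∈ P, IsCritical f r p) ∧ ∀ κ > 0, ∀ᶠ n in atTop,
      ∀ t, (∀ p ∈ P, κ ≤ dist t p) → dist (Φ.pos (F n) r t) (Φ.pos f r t) ≤ ε := by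
  set D := jump f r with hDdef
  set w : I → I := fun t => clampDiv D (relPos f r t) with hw
  have hwcoe : ∀ t, (w t : ℝ) = relPos f r t / D := fun t =>
    clampDiv_coe hr (relPos_nonneg _ _ _) (f.relPos_le_jump r t)
  -- the limiting loop oscillates little away from finitely many of its discontinuities
  obtain ⟨Y, hY, hYQ, κ₀, hκ₀, hosc⟩ := exists_finite_between
    (fun y => ¬ ContinuousAt (Φ.toFun D) y)
    (P := fun v v' => dist (Φ.toFun D v) (Φ.toFun D v') ≤ ε / 2) fun x => by
      by_cases hx : ContinuousAt (Φ.toFun D) x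
      · refine ⟨_, hx (Metric.ball_mem_nhds _ (show 0 < ε / 4 by linarith)), fun s hs s' hs' _ => ?_⟩
        have h1 : dist (Φ.toFun D s) (Φ.toFun D x) < ε / 4 := hs
        have h2 : dist (Φ.toFun D s') (Φ.toFun D x) < ε / 4 := hs'
        exact (dist_triangle_right _ _ (Φ.toFun D x)).trans (by linarith)
      · obtain ⟨l, hl⟩ := Φ.exists_right_limit D hr x
        have h1 := eventually_nhdsWithin_iff.1
          (hl (Metric.ball_mem_nhds l (show 0 < ε / 4 by linarith)))
        have h2 := eventually_nhdsWithin_iff.1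
          (Φ.left_continuous D hr x (Metric.ball_mem_nhds _ (show 0 < ε / 4 by linarith)))
        refine ⟨_, h1.and h2, fun s hs s' hs' hm => ?_⟩
        have hm := hm hx
        have key : ∀ z, dist (Φ.toFun D s) z < ε / 4 → dist (Φ.toFun D s') z < ε / 4 →
            dist (Φ.toFun D s) (Φ.toFun D s') ≤ ε / 2 := fun z h h' =>
          (dist_triangle_right _ _ z).trans (by linarith)
        rw [mem_uIcc, not_or, not_and_or, not_and_or, not_le, not_le, not_le, not_le] at hm
        rcases le_or_gt s x with h | h
        · have h' : s' ≤ x := by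
            rcases hm.1 with h' | h'
            · exact absurd h' (not_lt.2 h)
            · exact h'.le
          exact key _ (hs.2 h) (hs'.2 h')
        · have h' : x < s' := hm.2.resolve_right (not_lt.2 h.le)
          exact key _ (hs.1 h) (hs'.1 h')
  -- by compatibility, each of these is the position of at most one time, which is critical
  have hY0 : ∀ y ∈ Y, y ≠ 0 := fun y hy e => hYQ y hy (e ▸ continuousAt_zero hr)
  have hY1 : ∀ y ∈ Y, y ≠ 1 := fun y hy e => hYQ y hy (e ▸ continuousAt_one hr)
  have hxpos : ∀ {t y}, y ∈ Y → w t = y → 0 < relPos f r t := fun {t y} hy e => by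
    refine lt_of_le_of_ne (relPos_nonneg _ _ _) fun h0 => hY0 y hy ?_
    rw [← e, hw]
    simp only [← h0]
    exact clampDiv_zero D
  have huniq : ∀ {t y s}, y ∈ Y → w t = y → relPos f r s = relPos f r t → s = t :=
    fun {t y s} hy e hst => by
      by_contra hne
      refine hYQ y hy ?_
      rw [← e]
      exact (hc r hr).2 s t hne hst.symm (hst ▸ hxpos hy e)
  have hinj : ∀ {s t}, w s = w t → relPos f r s = relPos f r t := fun {s t} h => by
    have h' := congrArg (fun z : I => (z : ℝ)) h
    simp only [hwcoe] at h'
    exact (div_left_inj' hr.ne').1 h'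
  refine ⟨⋃ y ∈ Y, {p | w p = y}, hY.biUnion fun y hy => Set.Subsingleton.finite ?_, ?_, ?_⟩
  · intro s hs t ht
    exact huniq hy ht (hinj (Eq.trans hs (Eq.symm ht)))
  · intro p hp
    obtain ⟨y, hy, hpy⟩ := mem_iUnion₂.1 hp
    refine ⟨hxpos hy hpy, lt_of_le_of_ne (f.relPos_le_jump r p) fun e => hY1 y hy ?_,
      fun t ht e => ht (huniq hy hpy e)⟩
    rw [← show w p = y from hpy, ← Subtype.coe_inj, hwcoe, e, div_self hr.ne']
    rfl
  · intro κ hκ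
    -- the positions of the times far from the critical ones stay away from the discontinuities
    set A : Set I := {t | r ≤ t ∧ ∀ p ∈ ⋃ y ∈ Y, {p | w p = y}, κ ≤ dist t p} with hA
    have hAc : IsCompact A := by
      refine IsClosed.isCompact ?_
      have : A = Ici r ∩ ⋂ p ∈ ⋃ y ∈ Y, {p | w p = y}, {t | κ ≤ dist t p} := by
        ext t
        exact ⟨fun h => ⟨h.1, mem_iInter₂.2 h.2⟩, fun h => ⟨h.1, mem_iInter₂.1 h.2⟩⟩
      rw [this]
      exact isClosed_Ici.inter (isClosed_biInter fun p _ =>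
        isClosed_le continuous_const (continuous_id.dist continuous_const))
    have hwA : IsCompact (w '' A) := hAc.image_of_continuousOn
      ((continuous_clampDiv D).comp_continuousOn ((f.continuousOn_relPos r).mono fun t ht => ht.1))
    have hK : IsCompact (w '' A ∪ {0}) := hwA.union isCompact_singleton
    have hsub : Y ⊆ (w '' A ∪ {0})ᶜ := by
      rintro y hy (⟨t, ht, e⟩ | h)
      · have := ht.2 t (mem_iUnion₂.2 ⟨y, hy, e⟩)
        rw [dist_self] at this
        exact absurd this (not_le.2 hκ)
      · exact hY0 y hy h
    obtain ⟨κ', hκ', hthick⟩ :=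
      hY.isCompact.exists_thickening_subset_open hK.isClosed.isOpen_compl hsub
    set ε' := min (ε / 2) (min (κ₀ / 2) (κ' / 2)) with hε'
    have hε'0 : 0 < ε' := lt_min (by linarith) (lt_min (by linarith) (by linarith))
    filter_upwards [eventually_exists_near hF hc hr hε'0] with n hn t ht
    obtain ⟨v, hv1, hv2⟩ := hn.2 t
    have b1 : ε' ≤ ε / 2 := min_le_left _ _
    have b2 : ε' ≤ κ₀ / 2 := (min_le_right _ _).trans (min_le_left _ _)
    have b3 : ε' ≤ κ' / 2 := (min_le_right _ _).trans (min_le_right _ _)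
    have hmain : dist (Φ.toFun D v) (Φ.toFun D (w t)) ≤ ε / 2 := by
      refine (hosc v (w t) (by change dist v (w t) ≤ ε' at hv2; linarith)).resolve_right ?_
      rintro ⟨y, hy, hym⟩
      have h1 : dist (w t) y < κ' := by
        rw [dist_comm]
        have := dist_le_of_mem_uIcc hym
        change dist v (w t) ≤ ε' at hv2
        linarith
      have h2 : w t ∈ (w '' A ∪ {0})ᶜ := hthick (Metric.mem_thickening_iff.2 ⟨y, hy, h1⟩)
      by_cases hrt : r ≤ t
      · exact h2 (Or.inl ⟨t, ⟨hrt, ht⟩, rfl⟩)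
      · refine h2 (Or.inr ?_)
        rw [mem_singleton_iff, hw]
        simp only
        rw [relPos_of_lt (not_le.1 hrt), clampDiv_zero]
    exact (dist_triangle _ _ _).trans (by
      change dist (Φ.pos (F n) r t) (Φ.toFun D v) + dist (Φ.toFun D v) (Φ.toFun D (w t)) ≤ ε
      linarith)

/-! ### Density near the critical times -/

theorem IsCritical.lt {f : Excursion} {r p : I} (h : IsCritical f r p) : r < p := by
  refine lt_of_le_of_ne (anc_of_relPos_pos h.1).1 fun e => ?_
  have := h.2.1
  rw [← e, f.relPos_self] at this
  exact lt_irrefl _ this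

theorem IsCritical.lt_one {f : Excursion} {r p : I} (h : IsCritical f r p) : p < 1 := by
  refine lt_of_le_of_ne unitInterval.le_one' fun e => ?_
  have := h.1
  rw [e, f.relPos_one] at this
  exact lt_irrefl _ this

/-- At a critical time the excursion is continuous and at its lowest level since `r`. -/
theorem IsCritical.tendsto {f : Excursion} {r p : I} (h : IsCritical f r p) :
    Tendsto (fun t => f t - infOn f r t) (𝓝 p) (𝓝 0) ∧
      Tendsto (fun t => relPos f r t) (𝓝 p) (𝓝 (relPos f r p)) := by
  have hanc := anc_of_relPos_pos h.1
  have hinf : f p = infOn f r p := by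
    refine le_antisymm (not_lt.1 fun hlt => ?_) (infOn_le f.nonneg hanc.1 le_rfl)
    obtain ⟨u, hu, hs⟩ := (mem_nhdsGT_iff_exists_Ioo_subset' h.lt_one).1
      ((f.tendsto_right p).eventually_const_lt hlt)
    obtain ⟨t, ht1, ht2⟩ := exists_between (show p < u from hu)
    refine h.2.2 t ht1.ne' ?_
    rw [relPos_of_le (hanc.1.trans ht1.le), relPos_of_le hanc.1,
      infOn_split f.nonneg hanc.1 ht1.le, min_eq_left]
    refine le_infOn ht1.le fun v hv hv' => ?_
    rcases eq_or_lt_of_le hv with e | e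
    · rw [← e]; exact hlt.le
    · exact le_of_lt (hs ⟨e, hv'.trans_lt ht2⟩ : infOn f r p < f v)
  have hleft : leftVal f p = f p :=
    le_antisymm (f.leftVal_le p) (hinf ▸ f.infOn_le_leftVal h.lt le_rfl)
  have hfL : Tendsto f (𝓝[<] p) (𝓝 (f p)) :=
    hleft ▸ f.tendsto_left (lt_of_le_of_lt unitInterval.nonneg' h.lt)
  have two_sided : ∀ {g : I → ℝ} {c : ℝ}, g p = c → Tendsto g (𝓝[<] p) (𝓝 c) →
      Tendsto g (𝓝[>] p) (𝓝 c) → Tendsto g (𝓝 p) (𝓝 c) := fun {g c} e h1 h2 => by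
    subst e
    exact continuousAt_iff_continuous_left'_right'.2 ⟨h1, h2⟩
  constructor
  · refine two_sided (by rw [hinf, sub_self]) ?_ ?_
    · have := hfL.sub (f.tendsto_infOn_left h.lt)
      rwa [hinf, sub_self] at this
    · have := (f.tendsto_right p).sub (f.tendsto_infOn_right hanc.1)
      rwa [hinf, sub_self] at this
  · exact two_sided rfl (f.tendsto_relPos_left h.lt) (f.tendsto_relPos_right r p)

/-- For large `n`, the times close to a critical time `p` are close, for the distance coded by
`F n`, to one of any two given times on either side of `p`. -/
theorem IsCritical.eventually_gdist_le {α β : ℝ} (hα : 0 ≤ α) (hβ : 0 ≤ β) {F : ℕ → Excursion}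
    {f : Excursion} (hF : UnifTendsto F f) (hc : Φ.Compatible f) {r p : I}
    (hp : IsCritical f r p) {ε : ℝ} (hε : 0 < ε) :
    ∃ κ > 0, ∀ q q', q < p → p < q' → dist q p < κ → dist q' p < κ → ∀ᶠ n in atTop,
      ∀ t, q ≤ t → t ≤ q' → Φ.gdist (F n) α β t q ≤ ε ∨ Φ.gdist (F n) α β t q' ≤ ε := by
  have hr : 0 < jump f r := hp.1.trans hp.2.1
  obtain ⟨M, hM0, hM, hFM⟩ := hF.exists_le
  obtain ⟨C, hC0, hC⟩ := Φ.exists_loopBound M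
  set D := jump f r with hDdef
  set w : I → I := fun t => clampDiv D (relPos f r t) with hw
  set A := 3 * β * M + 6 * (α + β * C) + 1 with hA
  have hA0 : 0 < A := by positivity
  set ε₁ := ε / A with hε₁
  have hε₁0 : 0 < ε₁ := div_pos hε hA0
  have hcontw : Tendsto w (𝓝 p) (𝓝 (w p)) := ((continuous_clampDiv D).tendsto _).comp hp.tendsto.2
  -- the limiting loop has small oscillation on either side of the position of `p`
  obtain ⟨l, hl⟩ := Φ.exists_right_limit D hr (w p)
  have h1 := eventually_nhdsWithin_iff.1
    (hl (Metric.ball_mem_nhds l (show 0 < ε₁ / 2 by linarith)))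
  have h2 := eventually_nhdsWithin_iff.1
    (Φ.left_continuous D hr (w p) (Metric.ball_mem_nhds _ (show 0 < ε₁ / 2 by linarith)))
  obtain ⟨ρ, hρ, hball⟩ := Metric.eventually_nhds_iff.1 (h1.and h2)
  have hright : ∀ v v', dist v (w p) < ρ → dist v' (w p) < ρ → w p < v → w p < v' →
      dist (Φ.toFun D v) (Φ.toFun D v') ≤ ε₁ := fun v v' a a' b b' => by
    have c : dist (Φ.toFun D v) l < ε₁ / 2 := (hball a).1 b
    have c' : dist (Φ.toFun D v') l < ε₁ / 2 := (hball a').1 b'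
    exact (dist_triangle_right _ _ l).trans (by linarith)
  have hleft : ∀ v v', dist v (w p) < ρ → dist v' (w p) < ρ → v ≤ w p → v' ≤ w p →
      dist (Φ.toFun D v) (Φ.toFun D v') ≤ ε₁ := fun v v' a a' b b' => by
    have c : dist (Φ.toFun D v) (Φ.toFun D (w p)) < ε₁ / 2 := (hball a).2 b
    have c' : dist (Φ.toFun D v') (Φ.toFun D (w p)) < ε₁ / 2 := (hball a').2 b'
    exact (dist_triangle_right _ _ (Φ.toFun D (w p))).trans (by linarith)
  -- a neighbourhood of `p` on which `f` stays close to its running infimum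
  obtain ⟨κ, hκ, hnhds⟩ := Metric.eventually_nhds_iff.1
    (((hp.tendsto.1.eventually_lt_const hε₁0).and
      (hp.tendsto.2.eventually_const_lt (half_lt_self hp.1))).and
      (hcontw (Metric.ball_mem_nhds _ (half_pos hρ))))
  refine ⟨κ, hκ, fun q q' hqp hpq' hq hq' => ?_⟩
  have hnear : ∀ t, q ≤ t → t ≤ q' → dist t p < κ := fun t h h' => by
    rw [Subtype.dist_eq, Real.dist_eq] at hq hq' ⊢
    have a : (q : ℝ) ≤ t := h
    have b : (t : ℝ) ≤ q' := h'
    rw [abs_lt] at hq hq' ⊢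
    exact ⟨by linarith, by linarith⟩
  have hqq' : q ≤ q' := (hqp.trans hpq').le
  have hdq := hnhds (hnear q le_rfl hqq')
  have hdq' := hnhds (hnear q' hqq' le_rfl)
  have hrq : r ≤ q := (anc_of_relPos_pos ((half_pos hp.1).trans hdq.1.2)).1
  have hwq : w p < w q := clampDiv_lt hr hp.1.le (lt_of_le_of_ne (f.relPos_anti hrq hqp.le)
    (hp.2.2 q hqp.ne).symm) (f.relPos_le_jump r q)
  have hwq' : w q' < w p := clampDiv_lt hr (relPos_nonneg _ _ _)
    (lt_of_le_of_ne (f.relPos_anti hp.lt.le hpq'.le) (hp.2.2 q' hpq'.ne')) hp.2.1.le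
  -- the positions of `q` and `q'` lie strictly on either side of that of `p`, at distance at least `γ`
  set γ := min (dist (w q) (w p)) (dist (w q') (w p)) with hγ
  have hγ0 : 0 < γ := lt_min (dist_pos.2 hwq.ne') (dist_pos.2 hwq'.ne)
  set ε₂ := min ε₁ (min (ρ / 2) (γ / 2)) with hε₂
  have hε₂0 : 0 < ε₂ := lt_min hε₁0 (lt_min (by linarith) (by linarith))
  have b1 : ε₂ ≤ ε₁ := min_le_left _ _
  have b2 : ε₂ ≤ ρ / 2 := (min_le_right _ _).trans (min_le_left _ _)
  have b3 : ε₂ ≤ γ / 2 := (min_le_right _ _).trans (min_le_right _ _)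
  set δ := min ε₁ (relPos f r p / 8) with hδ
  have hδ0 : 0 < δ := lt_min hε₁0 (by have := hp.1; positivity)
  filter_upwards [eventually_exists_near hF hc hr hε₂0, hF δ hδ0, hFM] with n hn hFn hMn t hqt htq'
  have hDn : jump (F n) r ≤ M := ((F n).jump_le r).trans (hMn r)
  have hancn : ∀ s, q ≤ s → s ≤ q' → Anc (F n) r s := fun s a b => by
    refine anc_of_relPos_pos ?_
    have := (abs_le.1 (abs_relPos_sub_le _ _ hFn r s)).1
    have h3 := (hnhds (hnear s a b)).1.2
    have h4 : δ ≤ relPos f r p / 8 := min_le_right _ _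
    linarith [hp.1]
  have hlow : ∀ s, q ≤ s → s ≤ q' → F n s - infOn (F n) r s ≤ 3 * ε₁ := fun s a b => by
    have c1 := (abs_le.1 (hFn s)).2
    have c2 := (abs_le.1 (abs_infOn_sub_le (F n).nonneg f.nonneg hFn (hancn s a b).1)).1
    have c3 := (hnhds (hnear s a b)).1.1
    have c4 : δ ≤ ε₁ := min_le_left _ _
    linarith
  have hfinal : ∀ s, q ≤ s → s ≤ q' → dist (Φ.pos (F n) r t) (Φ.pos (F n) r s) ≤ 3 * ε₁ →
      Φ.gdist (F n) α β t s ≤ ε := fun s a b c => by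
    refine (gdist_le_of_anc hα hβ (hC (F n) hMn) (hancn t hqt htq') (hancn s a b)).trans ?_
    have d1 : Φ.loopTerm (F n) t s r ≤ M * (3 * ε₁) :=
      mul_le_mul hDn c dist_nonneg hM0
    have d2 := mul_le_mul_of_nonneg_left d1 hβ
    have d3 := mul_le_mul_of_nonneg_left (add_le_add (hlow t hqt htq') (hlow s a b))
      (show 0 ≤ α + β * C by positivity)
    have d4 : A * ε₁ = ε := mul_div_cancel₀ _ hA0.ne'
    rw [hA] at d4
    linarith
  obtain ⟨v, hv1, hv2⟩ := hn.2 t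
  have hvρ : dist v (w p) < ρ := by
    have e1 := dist_triangle v (w t) (w p)
    have e2 : dist (w t) (w p) < ρ / 2 := (hnhds (hnear t hqt htq')).2
    change dist v (w t) ≤ ε₂ at hv2
    linarith
  -- `t` is close to `q` or to `q'` according to the side of the discontinuity on which `F n` places it
  rcases lt_or_ge (w p) v with hlt | hge
  · refine Or.inl (hfinal q le_rfl hqq' ?_)
    obtain ⟨u, hu1, hu2⟩ := hn.2 q
    change dist u (w q) ≤ ε₂ at hu2
    have huρ : dist u (w p) < ρ := by
      have e1 := dist_triangle u (w q) (w p)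
      have e2 : dist (w q) (w p) < ρ / 2 := hdq.2
      linarith
    have hup : w p < u := by
      have hγq : γ ≤ dist (w q) (w p) := min_le_left _ _
      rw [Subtype.dist_eq, Real.dist_eq] at hu2 hγq
      have e0 : (w p : ℝ) < w q := hwq
      rw [abs_of_pos (sub_pos.2 e0)] at hγq
      have e1 := (abs_le.1 hu2).1
      have : (w p : ℝ) < u := by linarith
      exact this
    have e1 := hright v u hvρ huρ hlt hup
    have e2 := dist_triangle4 (Φ.pos (F n) r t) (Φ.toFun D v) (Φ.toFun D u) (Φ.pos (F n) r q)
    rw [dist_comm (Φ.toFun D u)] at e2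
    linarith
  · refine Or.inr (hfinal q' hqq' le_rfl ?_)
    obtain ⟨u, hu1, hu2⟩ := hn.2 q'
    change dist u (w q') ≤ ε₂ at hu2
    have huρ : dist u (w p) < ρ := by
      have e1 := dist_triangle u (w q') (w p)
      have e2 : dist (w q') (w p) < ρ / 2 := hdq'.2
      linarith
    have hup : u ≤ w p := by
      have hγq : γ ≤ dist (w q') (w p) := min_le_right _ _
      rw [Subtype.dist_eq, Real.dist_eq] at hu2 hγq
      have e0 : (w q' : ℝ) < w p := hwq'
      rw [abs_of_neg (sub_neg.2 e0)] at hγq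
      have e1 := (abs_le.1 hu2).2
      have : (u : ℝ) ≤ w p := by linarith
      exact this
    have e1 := hleft v u hvρ huρ hge hup
    have e2 := dist_triangle4 (Φ.pos (F n) r t) (Φ.toFun D v) (Φ.toFun D u) (Φ.pos (F n) r q')
    rw [dist_comm (Φ.toFun D u)] at e2
    linarith

end LoopShape

/-! ### Uniform convergence of the distances away from the critical times -/

namespace LoopShape

variable (Φ : LoopShape)

/-- The loops of small jumps are close to segments on average, uniformly along the sequence. -/
def TailControl (F : ℕ → Excursion) (f : Excursion) (α β : ℝ) : Prop :=
  ∀ ε > 0, ∃ η > 0,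
    (∀ t, ∀ T : Finset I, (∀ r ∈ T, jump f r < η) → ∑ r ∈ T, |Φ.tailTerm f α β t r| ≤ ε) ∧
    ∀ᶠ n in atTop, ∀ t, ∀ T : Finset I, (∀ r ∈ T, jump (F n) r < η) →
      ∑ r ∈ T, |Φ.tailTerm (F n) α β t r| ≤ ε

variable {Φ}

theorem abs_loopTerm_sub_le (F f : Excursion) (s t r : I) :
    |Φ.loopTerm F s t r - Φ.loopTerm f s t r| ≤ |jump F r - jump f r|
      + jump F r * (dist (Φ.pos F r s) (Φ.pos f r s) + dist (Φ.pos F r t) (Φ.pos f r t)) := by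
  have e1 : Φ.loopTerm F s t r = jump F r * dist (Φ.pos F r s) (Φ.pos F r t) := rfl
  have e2 : Φ.loopTerm f s t r = jump f r * dist (Φ.pos f r s) (Φ.pos f r t) := rfl
  have h1 : dist (Φ.pos f r s) (Φ.pos f r t) ≤ 1 := by
    rw [dist_eq_norm]
    exact (AddCircle.norm_le_half_period 1 one_ne_zero).trans (by norm_num)
  have h2 : |dist (Φ.pos F r s) (Φ.pos F r t) - dist (Φ.pos f r s) (Φ.pos f r t)|
      ≤ dist (Φ.pos F r s) (Φ.pos f r s) + dist (Φ.pos F r t) (Φ.pos f r t) := by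
    rw [← Real.dist_eq]
    exact dist_dist_dist_le _ _ _ _
  have h3 := mul_le_mul_of_nonneg_left h2 (F.jump_nonneg r)
  have h4 := mul_le_mul_of_nonneg_left h1 (abs_nonneg (jump F r - jump f r))
  rw [e1, e2, show jump F r * dist (Φ.pos F r s) (Φ.pos F r t)
      - jump f r * dist (Φ.pos f r s) (Φ.pos f r t)
    = (jump F r - jump f r) * dist (Φ.pos f r s) (Φ.pos f r t)
      + jump F r * (dist (Φ.pos F r s) (Φ.pos F r t) - dist (Φ.pos f r s) (Φ.pos f r t)) by ring]
  refine (abs_add_le _ _).trans ?_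
  rw [abs_mul, abs_mul, abs_of_nonneg (F.jump_nonneg r), abs_of_nonneg (dist_nonneg (x := Φ.pos f r s))]
  linarith

/-- Away from finitely many critical times, the distances coded by `F n` converge uniformly. -/
theorem exists_finite_gdist_tendsto {α β : ℝ} (hα : 0 ≤ α) (hβ : 0 ≤ β) {F : ℕ → Excursion}
    {f : Excursion} (hF : UnifTendsto F f) (hc : Φ.Compatible f)
    (htail : Φ.TailControl F f α β) {ε : ℝ} (hε : 0 < ε) :
    ∃ P : Set I, P.Finite ∧ (∀ p ∈ P, ∃ r, IsCritical f r p) ∧ ∀ κ > 0, ∀ᶠ n in atTop,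
      ∀ s t, (∀ p ∈ P, κ ≤ dist s p) → (∀ p ∈ P, κ ≤ dist t p) →
        |Φ.gdist (F n) α β s t - Φ.gdist f α β s t| ≤ ε := by
  classical
  obtain ⟨ε₀, hε₀0, hε₀⟩ : ∃ ε₀, 0 < ε₀ ∧ 7 * ε₀ = ε := ⟨ε / 7, by positivity, by ring⟩
  obtain ⟨M, hM0, hM, hFM⟩ := hF.exists_le
  obtain ⟨C, hC0, hC⟩ := Φ.exists_loopBound M
  obtain ⟨η, hη, ht1, ht2⟩ := htail ε₀ hε₀0
  have hBC : 0 ≤ 2 * β * C + α := by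
    have := mul_nonneg hβ hC0
    linarith
  obtain ⟨θ₁, hθ₁0, hθ₁⟩ := exists_pos_mul_lt hε₀0 ((2 * β * C + α) * 2)
  obtain ⟨θ, hθ0, hθle⟩ : ∃ θ, 0 < θ ∧ θ ≤ min (η / 2) θ₁ :=
    ⟨_, lt_min (by linarith) hθ₁0, le_rfl⟩
  have hθη : θ ≤ η / 2 := hθle.trans (min_le_left _ _)
  have h3 : (2 * β * C + α) * (2 * θ) ≤ ε₀ := by
    rw [← mul_assoc]
    exact (mul_le_mul_of_nonneg_left (hθle.trans (min_le_right _ _)) (by linarith)).trans hθ₁.le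
  -- the big jumps; the jumps outside `S` are small in `f` and in `F n`
  set S := (f.finite_jump_ge hθ0).toFinset with hS
  have hSmem : ∀ r, r ∈ S ↔ θ ≤ jump f r := fun r => by simp [hS]
  set N := (S.card : ℝ) with hN
  have hN0 : 0 ≤ N := Nat.cast_nonneg _
  -- the accuracy required for the positions on each of the big loops
  obtain ⟨ε₃, hε₃0, hε₃'⟩ := exists_pos_mul_lt (half_pos hε₀0) (N * (β * (M * 2)))
  choose! P hPfin hPcrit hPtend using fun r (hr : r ∈ S) =>
    exists_finite_pos_tendsto hF hc (hθ0.trans_le ((hSmem r).1 hr)) hε₃0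
  refine ⟨⋃ r ∈ S, P r, S.finite_toSet.biUnion fun r hr => hPfin r hr, ?_, fun κ hκ => ?_⟩
  · intro p hp
    obtain ⟨r, hr, hpr⟩ := mem_iUnion₂.1 hp
    exact ⟨r, hPcrit r hr p hpr⟩
  obtain ⟨δ₁, hδ₁0, hδ₁⟩ := exists_pos_mul_lt (half_pos hε₀0) (N * (2 * β + 4 * α) + 4 * α)
  obtain ⟨δ, hδ0, hδle⟩ : ∃ δ, 0 < δ ∧ δ ≤ min (θ / 2) δ₁ :=
    ⟨_, lt_min (by linarith) hδ₁0, le_rfl⟩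
  have hδθ : δ ≤ θ / 2 := hδle.trans (min_le_left _ _)
  have hδ' : (N * (2 * β + 4 * α) + 4 * α) * δ ≤ ε₀ / 2 := by
    refine le_trans (mul_le_mul_of_nonneg_left (hδle.trans (min_le_right _ _)) ?_) hδ₁.le
    have := mul_nonneg hN0 (show 0 ≤ 2 * β + 4 * α by linarith)
    linarith
  have hall : ∀ᶠ n in atTop, ∀ r ∈ S, ∀ t, (∀ p ∈ P r, κ ≤ dist t p) →
      dist (Φ.pos (F n) r t) (Φ.pos f r t) ≤ ε₃ :=
    (Filter.eventually_all_finset S).2 fun r hr => hPtend r hr κ hκ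
  filter_upwards [hall, hF δ hδ0, hFM, ht2] with n hn hFn hMn htn s t hs ht
  have hs' : ∀ r ∈ S, ∀ p ∈ P r, κ ≤ dist s p := fun r hr p hp =>
    hs p (mem_iUnion₂.2 ⟨r, hr, hp⟩)
  have ht' : ∀ r ∈ S, ∀ p ∈ P r, κ ≤ dist t p := fun r hr p hp =>
    ht p (mem_iUnion₂.2 ⟨r, hr, hp⟩)
  have hjump : ∀ r, |jump (F n) r - jump f r| ≤ 2 * δ := fun r => abs_jump_sub_le _ _ hFn r
  have hjf : ∀ r, r ∉ S → jump f r < θ := fun r hr => not_le.1 fun h => hr ((hSmem r).2 h)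
  have hjF : ∀ r, r ∉ S → jump (F n) r < 2 * θ := fun r hr => by
    have := (abs_le.1 (hjump r)).2
    linarith [hjf r hr]
  have h1 := abs_gdist_sub_le hα hβ (hC f hM) (by linarith : 0 ≤ 2 * θ) S
    (fun r hr => ((hjf r hr).le.trans (by linarith)))
    (fun t T hT => ht1 t T fun r hr => (hjf r (hT r hr)).trans_le (by linarith)) s t
  have h2 := abs_gdist_sub_le hα hβ (hC (F n) hMn) (by linarith : 0 ≤ 2 * θ) S
    (fun r hr => (hjF r hr).le)
    (fun t T hT => htn t T fun r hr => (hjF r (hT r hr)).trans_le (by linarith)) s t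
  have h4 : |∑ r ∈ S, Φ.gterm (F n) α β s t r - ∑ r ∈ S, Φ.gterm f α β s t r|
      ≤ N * (β * (2 * δ + M * (2 * ε₃)) + α * (4 * δ)) := by
    rw [← Finset.sum_sub_distrib, hN, ← nsmul_eq_mul]
    refine (Finset.abs_sum_le_sum_abs _ _).trans (Finset.sum_le_card_nsmul _ _ _ fun r hr => ?_)
    have k1 := abs_loopTerm_sub_le (Φ := Φ) (F n) f s t r
    have k2 : jump (F n) r * (dist (Φ.pos (F n) r s) (Φ.pos f r s)
        + dist (Φ.pos (F n) r t) (Φ.pos f r t)) ≤ M * (2 * ε₃) :=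
      mul_le_mul (((F n).jump_le r).trans (hMn r))
        (by linarith [hn r hr s (hs' r hr), hn r hr t (ht' r hr)])
        (add_nonneg dist_nonneg dist_nonneg) hM0
    have k3 : |Φ.loopTerm (F n) s t r - Φ.loopTerm f s t r| ≤ 2 * δ + M * (2 * ε₃) := by
      linarith [hjump r]
    have k4 : |(|relPos (F n) r s - relPos (F n) r t|) - (|relPos f r s - relPos f r t|)|
        ≤ 4 * δ := by
      refine (abs_abs_sub_abs_le_abs_sub _ _).trans ?_
      have a := abs_le.1 (abs_relPos_sub_le _ _ hFn r s)
      have b := abs_le.1 (abs_relPos_sub_le _ _ hFn r t)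
      rw [abs_le]
      constructor <;> linarith
    have k5 := abs_le.1 k3
    have k6 := abs_le.1 k4
    have m1 := mul_le_mul_of_nonneg_left k5.1 hβ
    have m2 := mul_le_mul_of_nonneg_left k5.2 hβ
    have m3 := mul_le_mul_of_nonneg_left k6.1 hα
    have m4 := mul_le_mul_of_nonneg_left k6.2 hα
    rw [gterm, gterm, abs_le]
    constructor <;> linarith
  have h5 : |α * (F n s + F n t - 2 * infBetween (F n) s t)
      - α * (f s + f t - 2 * infBetween f s t)| ≤ α * (4 * δ) := by
    rw [← mul_sub, abs_mul, abs_of_nonneg hα]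
    refine mul_le_mul_of_nonneg_left ?_ hα
    have a := abs_le.1 (hFn s)
    have b := abs_le.1 (hFn t)
    have c := abs_le.1 (abs_infBetween_sub_le (F n).nonneg f.nonneg hFn s t)
    rw [abs_le]
    constructor <;> linarith
  have e1 := abs_le.1 h1
  have e2 := abs_le.1 h2
  have e4 := abs_le.1 h4
  have e5 := abs_le.1 h5
  have h6 : N * (β * (2 * δ + M * (2 * ε₃)) + α * (4 * δ)) + α * (4 * δ) ≤ ε₀ := by
    have : N * (β * (2 * δ + M * (2 * ε₃)) + α * (4 * δ)) + α * (4 * δ)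
      = (N * (2 * β + 4 * α) + 4 * α) * δ + N * (β * (M * 2)) * ε₃ := by ring
    linarith
  rw [abs_le]
  constructor <;> linarith

end LoopShape

/-! ### From the distances on `[0,1]` to the quotient spaces -/

/-- The times close to one of finitely many given times have small measure. -/
theorem exists_volume_le {Z : Set I} (hZ : Z.Finite) {ε : ℝ} (hε : 0 < ε) :
    ∃ κ > 0, volume {t : I | ∀ p ∈ Z, κ ≤ dist (upperHalf t) p}ᶜ ≤ ENNReal.ofReal ε := by
  have hm : Measurable upperHalf := by
    apply Continuous.measurable
    unfold upperHalf
    fun_prop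
  have := Measure.isProbabilityMeasure_map (μ := (volume : Measure I)) hm.aemeasurable
  have h := tendsto_measure_thickening_of_isClosed (μ := (volume : Measure I).map upperHalf)
    ⟨1, one_pos, measure_ne_top _ _⟩ hZ.isClosed
  rw [Measure.map_apply hm hZ.measurableSet,
    (hZ.preimage upperHalf_injective.injOn).measure_zero] at h
  obtain ⟨κ, h1, h2⟩ := ((h.eventually_lt_const (ENNReal.ofReal_pos.2 hε)).and
    self_mem_nhdsWithin).exists
  refine ⟨κ, h2, le_trans (le_of_eq ?_) h1.le⟩
  rw [Measure.map_apply hm Metric.isOpen_thickening.measurableSet]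
  congr 1
  ext t
  rw [mem_preimage, Metric.mem_thickening_iff, mem_compl_iff, mem_ofPred_eq]
  push Not
  rfl

theorem exists_mem_left {p : I} (hp : 0 < p) {P : Set I} (hP : P.Finite) {κ : ℝ} (hκ : 0 < κ) :
    ∃ q < p, dist q p < κ ∧ q ∉ P := by
  have := nhdsLT_neBot hp
  have h1 : ∀ᶠ q in 𝓝[<] p, q ∉ P \ {p} := nhdsWithin_le_nhds
    ((hP.subset sdiff_subset).isClosed.isOpen_compl.mem_nhds fun h => h.2 rfl)
  have h2 : ∀ᶠ q in 𝓝[<] p, dist q p < κ := nhdsWithin_le_nhds (Metric.ball_mem_nhds p hκ)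
  obtain ⟨q, ⟨a, b⟩, c⟩ := ((h1.and h2).and self_mem_nhdsWithin).exists
  exact ⟨q, c, b, fun h => a ⟨h, ne_of_lt c⟩⟩

theorem exists_mem_right {p : I} (hp : p < 1) {P : Set I} (hP : P.Finite) {κ : ℝ} (hκ : 0 < κ) :
    ∃ q, p < q ∧ dist q p < κ ∧ q ∉ P := by
  have := nhdsGT_neBot hp
  have h1 : ∀ᶠ q in 𝓝[>] p, q ∉ P \ {p} := nhdsWithin_le_nhds
    ((hP.subset sdiff_subset).isClosed.isOpen_compl.mem_nhds fun h => h.2 rfl)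
  have h2 : ∀ᶠ q in 𝓝[>] p, dist q p < κ := nhdsWithin_le_nhds (Metric.ball_mem_nhds p hκ)
  obtain ⟨q, ⟨a, b⟩, c⟩ := ((h1.and h2).and self_mem_nhdsWithin).exists
  exact ⟨q, c, b, fun h => a ⟨h, ne_of_gt c⟩⟩

theorem dist_proj {d : I → I → ℝ} (h : IsPseudoDist d) (s t : I) :
    dist (proj d h s) (proj d h t) = d s t :=
  SeparationQuotient.dist_mk (α := PseudoI d h) s t

theorem proj_surjective {d : I → I → ℝ} (h : IsPseudoDist d) (x : QuotientI d h) :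
    ∃ t, proj d h t = x :=
  SeparationQuotient.surjective_mk x

/-- The class of a time close to `p` is close to that of one of any two nearby times on either side of
`p`; at `p` itself, by right-continuity, to that of the later one. -/
theorem exists_dist_le_of_regular {d : I → I → ℝ} (hd : IsPseudoDist d)
    (hR : ∀ t, Tendsto (fun s => d s t) (𝓝[>] t) (𝓝 0))
    (hL : ∀ t, ∃ t', Tendsto (fun s => d s t') (𝓝[<] t) (𝓝 0)) {ε : ℝ} (hε : 0 < ε) (p : I) :
    ∃ κ > 0, ∀ q q', q < p → p < q' → dist q p < κ → dist q' p < κ →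
      ∀ t, q ≤ t → t ≤ q' → d t q ≤ ε ∨ d t q' ≤ ε := by
  obtain ⟨p', hp'⟩ := hL p
  obtain ⟨κ, hκ, H⟩ := Metric.eventually_nhds_iff.1
    ((eventually_nhdsWithin_iff.1 ((hR p).eventually_lt_const (half_pos hε))).and
      (eventually_nhdsWithin_iff.1 (hp'.eventually_lt_const (half_pos hε))))
  refine ⟨κ, hκ, fun q q' h1 h2 h3 h4 t ht ht' => ?_⟩
  rcases lt_trichotomy t p with h | h | h
  · left
    have hq : dist t p < κ := by
      rw [Subtype.dist_eq, Real.dist_eq] at h3 ⊢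
      have a : (q : ℝ) ≤ t := ht
      have b : (t : ℝ) < p := h
      rw [abs_lt] at h3 ⊢
      exact ⟨by linarith, by linarith⟩
    have := hd.triangle t p' q
    rw [hd.comm p' q] at this
    linarith [(H hq).2 h, (H h3).2 h1]
  · right
    rw [h, hd.comm]
    linarith [(H h4).1 h2]
  · right
    have hq : dist t p < κ := by
      rw [Subtype.dist_eq, Real.dist_eq] at h4 ⊢
      have a : (t : ℝ) ≤ q' := ht'
      have b : (p : ℝ) < t := h
      rw [abs_lt] at h4 ⊢
      exact ⟨by linarith, by linarith⟩
    have := hd.triangle t p q'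
    rw [hd.comm p q'] at this
    linarith [(H hq).1 h, (H h4).1 h2]

namespace LoopShape

/-- Convergence of the coded spaces. After a change of time the excursions converge uniformly; the
times at distance at least `κ` from the critical times are in correspondence, the others are close
to them in both spaces, and times that the changes of time move little keep nearly the same class,
except near finitely many of them. -/
theorem tendsto_ghpDist {Φ : LoopShape} {α β : ℝ} (hα : 0 ≤ α) (hβ : 0 ≤ β) {fn : ℕ → Excursion}
    {f : Excursion} {l : ℕ → I ≃o I} (hl : ∀ δ > 0, ∀ᶠ n in atTop, ∀ t, dist (l n t) t ≤ δ)
    (hF : UnifTendsto (fun n => (fn n).theta.comp (l n)) f.theta) (hc : Φ.Compatible f.theta)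
    (htail : Φ.TailControl (fun n => (fn n).theta.comp (l n)) f.theta α β) :
    Tendsto (fun n => ghpDist (quotientSpace (Φ.gdist (fn n) α β) (Φ.isCode_gdist (fn n) hα hβ))
      (quotientSpace (Φ.gdist f α β) (Φ.isCode_gdist f hα hβ))) atTop (𝓝 0) := by
  set F : ℕ → Excursion := fun n => (fn n).theta.comp (l n) with hFdef
  have hdF : ∀ n s t, Φ.gdist (F n) α β s t
      = Φ.gdist (fn n) α β (lowerTime (l n s)) (lowerTime (l n t)) := fun n s t => by
    rw [hFdef, Excursion.gdist_comp, Excursion.gdist_theta]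
  have hdf := f.gdist_theta Φ α β
  have hpd := isPseudoDist_gdist (Φ := Φ) (f := f.theta) hα hβ
  rw [tendsto_order]
  refine ⟨fun a ha => Eventually.of_forall fun n => ha.trans_le (ghpDist_nonneg _ _),
    fun ε' hε' => ?_⟩
  set ε := ε' / 8 with hε
  have hε0 : 0 < ε := by positivity
  obtain ⟨P, hP, hPcrit, hPtend⟩ := exists_finite_gdist_tendsto hα hβ hF hc htail hε0
  obtain ⟨Y, hY, κY, hκY, hosc⟩ := exists_finite_osc hpd (tendsto_gdist_right Φ f.theta α β)
    (exists_tendsto_gdist_left Φ f.theta hα hβ) hε0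
  -- on either side of every critical time, a noncritical time that represents its neighbours
  have hsides : ∀ p ∈ P, ∃ q q', q < p ∧ p < q' ∧ q ∉ P ∧ q' ∉ P ∧
      (∀ t, q ≤ t → t ≤ q' → Φ.gdist f.theta α β t q ≤ ε ∨ Φ.gdist f.theta α β t q' ≤ ε) ∧
      ∀ᶠ n in atTop, ∀ t, q ≤ t → t ≤ q' →
        Φ.gdist (F n) α β t q ≤ ε ∨ Φ.gdist (F n) α β t q' ≤ ε := fun p hp => by
    obtain ⟨r, hr⟩ := hPcrit p hp
    obtain ⟨κ₁, hκ₁, H₁⟩ := hr.eventually_gdist_le hα hβ hF hc hε0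
    obtain ⟨κ₂, hκ₂, H₂⟩ := exists_dist_le_of_regular hpd (tendsto_gdist_right Φ f.theta α β)
      (exists_tendsto_gdist_left Φ f.theta hα hβ) hε0 p
    obtain ⟨q, a1, a2, a3⟩ := exists_mem_left (lt_of_le_of_lt unitInterval.nonneg' hr.lt) hP
      (lt_min hκ₁ hκ₂)
    obtain ⟨q', b1, b2, b3⟩ := exists_mem_right hr.lt_one hP (lt_min hκ₁ hκ₂)
    exact ⟨q, q', a1, b1, a3, b3,
      H₂ q q' a1 b1 (a2.trans_le (min_le_right _ _)) (b2.trans_le (min_le_right _ _)),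
      H₁ q q' a1 b1 (a2.trans_le (min_le_left _ _)) (b2.trans_le (min_le_left _ _))⟩
  choose! q q' hq hq' hqP hq'P hdens hdensn using hsides
  obtain ⟨κ₂, hκ₂, hvol⟩ := exists_volume_le (hP.union hY) hε0
  -- a distance to the critical times that is smaller than all those involved
  obtain ⟨κ, ⟨hκ1, hκ2⟩, hκ0⟩ : ∃ κ : ℝ, ((∀ p ∈ P, ∀ x ∈ P, κ ≤ dist (q p) x ∧
      κ ≤ dist (q' p) x ∧ κ ≤ dist 1 x) ∧ κ ≤ κ₂ / 2) ∧ 0 < κ := by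
    have hle : ∀ {c : ℝ}, 0 < c → ∀ᶠ κ in 𝓝[>] (0 : ℝ), κ ≤ c := fun {c} hc =>
      nhdsWithin_le_nhds (ge_mem_nhds hc)
    refine (((?_ : ∀ᶠ κ in 𝓝[>] (0 : ℝ), _).and (hle (half_pos hκ₂))).and
      self_mem_nhdsWithin).exists
    refine (Filter.eventually_all_finite hP).2 fun p hp =>
      (Filter.eventually_all_finite hP).2 fun x hx => ?_
    obtain ⟨r, hr⟩ := hPcrit x hx
    exact (hle (dist_pos.2 fun e => hqP p hp (by rw [e]; exact hx))).and
      ((hle (dist_pos.2 fun e => hq'P p hp (by rw [e]; exact hx))).and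
        (hle (dist_pos.2 hr.lt_one.ne')))
  have hdensn' : ∀ᶠ n in atTop, ∀ p ∈ P, ∀ t, q p ≤ t → t ≤ q' p →
      Φ.gdist (F n) α β t (q p) ≤ ε ∨ Φ.gdist (F n) α β t (q' p) ≤ ε :=
    (Filter.eventually_all_finite hP).2 hdensn
  have hG1 : ∀ p ∈ P, ∀ x ∈ P, κ ≤ dist (q p) x := fun p hp x hx => (hκ1 p hp x hx).1
  have hG2 : ∀ p ∈ P, ∀ x ∈ P, κ ≤ dist (q' p) x := fun p hp x hx => (hκ1 p hp x hx).2.1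
  -- the times at distance at least `κ` from the critical times are `ε`-dense
  have hdense : ∀ d : I → I → ℝ, (∀ t, d t t = 0) → (∀ p ∈ P, ∀ t, q p ≤ t → t ≤ q' p →
      d t (q p) ≤ ε ∨ d t (q' p) ≤ ε) → ∀ t, ∃ i, (∀ p ∈ P, κ ≤ dist i p) ∧ d t i ≤ ε := by
    intro d hself H t
    by_cases ht : ∀ p ∈ P, κ ≤ dist t p
    · exact ⟨t, ht, by rw [hself]; exact hε0.le⟩
    · push Not at ht
      obtain ⟨p, hp, hlt⟩ := ht
      have h1 := hG1 p hp p hp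
      have h2 := hG2 p hp p hp
      have a : ((q p : I) : ℝ) < p := hq p hp
      have b : (p : ℝ) < q' p := hq' p hp
      rw [Subtype.dist_eq, Real.dist_eq] at h1 h2 hlt
      rw [abs_of_neg (sub_neg.2 a)] at h1
      rw [abs_of_pos (sub_pos.2 b)] at h2
      rw [abs_lt] at hlt
      have c : q p ≤ t := by
        have : ((q p : I) : ℝ) ≤ t := by linarith
        exact this
      have c' : t ≤ q' p := by
        have : (t : ℝ) ≤ q' p := by linarith
        exact this
      rcases H p hp t c c' with h | h
      · exact ⟨q p, hG1 p hp, h⟩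
      · exact ⟨q' p, hG2 p hp, h⟩
  set δ := min (κ₂ / 2) (κY / 2) with hδ
  have hδ0 : 0 < δ := lt_min (by linarith) (by linarith)
  have hδ1 : δ ≤ κ₂ / 2 := min_le_left _ _
  have hδ2 : δ ≤ κY / 2 := min_le_right _ _
  filter_upwards [hPtend κ hκ0, hdensn', hl δ hδ0] with n hn hdn hln
  have hpdn := isPseudoDist_gdist (Φ := Φ) (f := F n) hα hβ
  have hcode := Φ.isCode_gdist f hα hβ
  have hcoden := Φ.isCode_gdist (fn n) hα hβ
  refine lt_of_le_of_lt (ghpDist_le (J := {i : I // ∀ p ∈ P, κ ≤ dist i p}) (ε := ε)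
    (X := quotientSpace (Φ.gdist (fn n) α β) hcoden) (Y := quotientSpace (Φ.gdist f α β) hcode)
    (fun i => proj _ hcoden.isPseudoDist (lowerTime (l n i)))
    (fun i => proj _ hcode.isPseudoDist (lowerTime i)) hcoden.measurable hcode.measurable rfl rfl
    hε0.le (fun i j => ?_) (fun x => ?_) (fun y => ?_) ?_
    {t : I | ∀ p ∈ P ∪ Y, κ₂ ≤ dist (upperHalf t) p} (fun t ht => ?_) hvol) (by linarith)
  · have h := hn i j i.2 j.2
    rw [hdF, hdf] at h
    have e1 := dist_proj hcoden.isPseudoDist (lowerTime (l n i)) (lowerTime (l n j))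
    have e2 := dist_proj hcode.isPseudoDist (lowerTime i) (lowerTime j)
    rw [← e1, ← e2] at h
    exact h
  · obtain ⟨s, rfl⟩ := proj_surjective hcoden.isPseudoDist x
    obtain ⟨i, hi, hd⟩ := hdense _ hpdn.self hdn ((l n).symm (upperHalf s))
    rw [hdF, OrderIso.apply_symm_apply, lowerTime_upperHalf,
      ← dist_proj hcoden.isPseudoDist] at hd
    exact ⟨⟨i, hi⟩, hd⟩
  · obtain ⟨s, rfl⟩ := proj_surjective hcode.isPseudoDist y
    obtain ⟨i, hi, hd⟩ := hdense _ hpd.self hdens (upperHalf s)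
    rw [hdf, lowerTime_upperHalf, ← dist_proj hcode.isPseudoDist] at hd
    exact ⟨⟨i, hi⟩, hd⟩
  · refine ⟨⟨1, fun p hp => (hκ1 p hp p hp).2.2⟩, ?_, ?_⟩
    · have h : l n 1 = 1 := (l n).map_top
      change proj _ hcoden.isPseudoDist (lowerTime (l n 1)) = proj _ hcoden.isPseudoDist 1
      rw [h, lowerTime_one]
    · change proj _ hcode.isPseudoDist (lowerTime 1) = proj _ hcode.isPseudoDist 1
      rw [lowerTime_one]
  · -- outside a set of small measure, the time `t` of `fn n` corresponds to the time `i` of `F n`, and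
    -- `i` is close to `t` in the limiting space as well
    set i := (l n).symm (upperHalf t) with hi
    have hdi : dist i (upperHalf t) ≤ δ := by
      have := hln i
      rwa [hi, OrderIso.apply_symm_apply, dist_comm] at this
    have hiG : ∀ p ∈ P, κ ≤ dist i p := fun p hp => by
      have h1 := ht p (Or.inl hp)
      have h2 := dist_triangle (upperHalf t) i p
      rw [dist_comm (upperHalf t) i] at h2
      linarith
    refine ⟨⟨i, hiG⟩, ?_, ?_⟩
    · change dist (proj _ hcoden.isPseudoDist t) (proj _ hcoden.isPseudoDist (lowerTime (l n i))) ≤ ε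
      rw [hi, OrderIso.apply_symm_apply, lowerTime_upperHalf, dist_self]
      exact hε0.le
    · change dist (proj _ hcode.isPseudoDist t) (proj _ hcode.isPseudoDist (lowerTime i)) ≤ ε
      rw [dist_comm, dist_proj]
      have e := hdf i (upperHalf t)
      rw [lowerTime_upperHalf] at e
      rw [← e]
      refine (hosc i (upperHalf t) (by linarith)).resolve_right ?_
      rintro ⟨y, hy, hym⟩
      have h1 := dist_le_of_mem_uIcc hym
      have h2 := ht y (Or.inr hy)
      rw [dist_comm] at h2
      linarith

end LoopShape

/-! ### Changes of time for the relaxed Skorokhod topology -/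

/-- Relaxed Skorokhod convergence is uniform convergence after changes of time that tend to the
identity. -/
theorem RelaxedTendsto.exists_timeChange {fn : ℕ → Excursion} {f : Excursion}
    (h : RelaxedTendsto fn f) : ∃ l : ℕ → I ≃o I,
      (∀ δ > 0, ∀ᶠ n in atTop, ∀ t, dist (l n t) t ≤ δ) ∧
      UnifTendsto (fun n => (fn n).theta.comp (l n)) f.theta := by
  -- `1 / n` is added because the infimum over the changes of time need not be attained
  have h1 : Tendsto (fun n => skorokhodEDist (Theta (fn n).toCadlag) (Theta f.toCadlag)
      + ((n : ℝ≥0∞))⁻¹) atTop (𝓝 (0 + 0)) :=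
    (tendsto_iff_edist_tendsto_0.1 h).add ENNReal.tendsto_inv_nat_nhds_zero
  rw [add_zero] at h1
  have h2 : ∀ n : ℕ, ∃ l : I ≃o I, max (⨆ t, edist (l t) t)
      (⨆ t, edist (Theta (fn n).toCadlag t) (Theta f.toCadlag (l t)))
      ≤ skorokhodEDist (Theta (fn n).toCadlag) (Theta f.toCadlag) + ((n : ℝ≥0∞))⁻¹ := fun n => by
    by_cases htop : skorokhodEDist (Theta (fn n).toCadlag) (Theta f.toCadlag) = ⊤
    · exact ⟨OrderIso.refl I, by rw [htop, top_add]; exact le_top⟩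
    · obtain ⟨l, hl⟩ := iInf_lt_iff.1 (ENNReal.lt_add_right htop
        (ENNReal.inv_ne_zero.2 (ENNReal.natCast_ne_top n)))
      exact ⟨l, hl.le⟩
  choose l hl using h2
  have h3 : ∀ δ > 0, ∀ᶠ n in atTop, ∀ t, dist (l n t) t ≤ δ ∧
      |(fn n).theta t - f.theta (l n t)| ≤ δ := fun δ hδ => by
    filter_upwards [h1.eventually_le_const (ENNReal.ofReal_pos.2 hδ)] with n hn t
    have h4 := (hl n).trans hn
    constructor
    · rw [← edist_le_ofReal hδ.le]
      exact (le_iSup (fun t => edist (l n t) t) t).trans ((le_max_left _ _).trans h4)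
    · rw [← Real.dist_eq, ← edist_le_ofReal hδ.le]
      exact (le_iSup (fun t => edist (Theta (fn n).toCadlag t) (Theta f.toCadlag (l n t))) t).trans
        ((le_max_right _ _).trans h4)
  refine ⟨fun n => (l n).symm, fun δ hδ => ?_, fun δ hδ => ?_⟩
  · filter_upwards [h3 δ hδ] with n hn t
    have := (hn ((l n).symm t)).1
    rwa [OrderIso.apply_symm_apply, dist_comm] at this
  · filter_upwards [h3 δ hδ] with n hn t
    have := (hn ((l n).symm t)).2
    rwa [OrderIso.apply_symm_apply] at this

/-! ### Compatibility of the excursion with the loops -/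

theorem compatible_standard (f : Excursion) : LoopShape.standard.Compatible f := by
  intro r _
  refine ⟨fun ε hε => ⟨1, one_pos, fun u _ _ => ⟨OrderIso.refl I, fun x => ?_, fun x => ?_⟩⟩,
    fun s t _ _ _ => ?_⟩
  · simpa using hε.le
  · change dist ((x : ℝ) : UnitAddCircle) ((x : ℝ) : UnitAddCircle) ≤ ε
    rw [dist_self]; exact hε.le
  · exact ((AddCircle.continuous_mk' (1 : ℝ)).comp continuous_subtype_val).continuousAt

theorem Shuffle.contAt_shape {Φ : Shuffle} {D : ℝ} (hD : 0 < D)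
    (h : ContinuousAt Φ.toFun ⟨D, hD⟩) : Φ.shape.ContAt D := by
  intro ε hε
  have h1 : ∀ᶠ u in 𝓝 (⟨D, hD⟩ : Ioi (0 : ℝ)), edist (Φ.toFun u) (Φ.toFun ⟨D, hD⟩)
      < ENNReal.ofReal ε := by
    have := tendsto_iff_edist_tendsto_0.1 h.tendsto
    exact this.eventually_lt_const (ENNReal.ofReal_pos.2 hε)
  obtain ⟨η, hη, H⟩ := Metric.eventually_nhds_iff.1 h1
  refine ⟨η, hη, fun u hu huD => ?_⟩
  have h2 := @H ⟨u, hu⟩ huD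
  rw [edist_comm] at h2
  obtain ⟨l, hl⟩ := iInf_lt_iff.1 (show skorokhodEDist _ _ < _ from h2)
  refine ⟨l, fun x => ?_, fun x => ?_⟩
  · rw [← edist_le_ofReal hε.le]
    exact ((le_iSup (fun t => edist (l t) t) x).trans (le_max_left _ _)).trans hl.le
  · rw [Φ.shape_apply hD, Φ.shape_apply hu, ← edist_le_ofReal hε.le]
    exact ((le_iSup (fun t => edist (Φ.toFun ⟨D, hD⟩ t) (Φ.toFun ⟨u, hu⟩ (l t))) x).trans
      (le_max_right _ _)).trans hl.le

/-- In the excursion with an initial rest, two times at the same positive position on a loop both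
belong to the second half of `[0,1]`, so the condition on the bad sets of `f` applies to them. -/
theorem compatible_shape {Φ : Shuffle} {f : Excursion}
    (h : excursionBadSet f ∩ shuffleBadSet Φ = ∅) : Φ.shape.Compatible f.theta := by
  intro r hr
  obtain ⟨r, rfl⟩ : r ∈ range upperHalf := by
    by_contra hn
    rw [f.jump_theta_of_lt (not_le.1 fun h => hn (Excursion.mem_range_upperHalf.2 h))] at hr
    exact lt_irrefl _ hr
  rw [f.jump_theta_upperHalf] at hr ⊢
  constructor
  · refine Shuffle.contAt_shape hr ?_
    by_contra hn
    have hmem : (Sum.inl (jump f r) : ℝ ⊕ ℝ × ℝ) ∈ excursionBadSet f ∩ shuffleBadSet Φ :=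
      ⟨Or.inl ⟨_, ⟨r, hr, rfl⟩, rfl⟩, Or.inl ⟨_, ⟨hr, hn⟩, rfl⟩⟩
    rw [h] at hmem
    exact hmem
  · intro s t hst hts hs
    have hge : ∀ {w}, 0 < relPos f.theta (upperHalf r) w → 1 ≤ 2 * (w : ℝ) := fun {w} hw => by
      have h1 : (upperHalf r : ℝ) ≤ w := (anc_of_relPos_pos hw).1
      linarith [two_mul_upperHalf r]
    have hs' := hge hs
    have ht' := hge (hts ▸ hs)
    rw [f.relPos_theta, f.relPos_theta] at hts
    rw [f.relPos_theta] at hs ⊢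
    have hne : lowerTime s ≠ lowerTime t := fun e => by
      rw [lowerTime, lowerTime, if_pos hs', if_pos ht'] at e
      exact hst (by rw [← upperHalf_stretch hs', e, upperHalf_stretch ht'])
    rw [Φ.shape_apply hr]
    by_contra hn
    have hmem : (Sum.inr (jump f r, relPos f r (lowerTime t) / jump f r) : ℝ ⊕ ℝ × ℝ) ∈
        excursionBadSet f ∩ shuffleBadSet Φ :=
      ⟨Or.inr ⟨_, ⟨r, lowerTime s, lowerTime t, hne, hr, hts, hs, rfl⟩, rfl⟩,
        Or.inr ⟨_, ⟨hr, _, (clampDiv_coe hr (relPos_nonneg _ _ _) (f.relPos_le_jump _ _)).symm,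
          hn⟩, rfl⟩⟩
    rw [h] at hmem
    exact hmem

/-! ### Control of the small jumps -/

theorem Shuffle.abs_tailTerm_le {Φ : Shuffle} {f : Excursion} {ε : ℝ} {r : I}
    (h : ∀ hr : 0 < jump f r, ∀ x : I, 0 < x → |2 / (x : ℝ) * dist (Φ.toFun ⟨jump f r, hr⟩ 0)
      (Φ.toFun ⟨jump f r, hr⟩ x) - 1| ≤ ε) (t : I) :
    |Φ.shape.tailTerm f 1 2 t r| ≤ ε * relPos f r t := by
  rcases eq_or_lt_of_le (relPos_nonneg f r t) with e | hx
  · rw [LoopShape.tailTerm, ← e, LoopShape.loopLength_self]; simp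
  · have hr := hx.trans_le (f.relPos_le_jump r t)
    have hcoe := clampDiv_coe hr hx.le (f.relPos_le_jump r t)
    have hw : (0 : I) < clampDiv (jump f r) (relPos f r t) := by
      rw [← Subtype.coe_lt_coe, hcoe]
      exact div_pos hx hr
    have h1 := mul_le_mul_of_nonneg_right (h hr _ hw) hx.le
    rw [LoopShape.tailTerm, LoopShape.loopLength, clampDiv_zero, Φ.shape_apply hr]
    rw [hcoe] at h1
    refine le_trans (le_of_eq ?_) h1
    rw [← abs_of_pos hx, ← abs_mul, abs_of_pos hx]
    congr 1
    field_simp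

/-- For a shuffle, twice the loop distance from the origin to a position on a small loop is this
position up to a small relative error, and the positions sum up to at most the height. -/
theorem Shuffle.tailControl (Φ : Shuffle) {F : ℕ → Excursion} {f : Excursion}
    (hF : UnifTendsto F f) : Φ.shape.TailControl F f 1 2 := by
  intro ε hε
  obtain ⟨M, hM0, hM, hFM⟩ := hF.exists_le
  obtain ⟨ε', hε', hle⟩ := exists_pos_mul_lt hε M
  obtain ⟨η, hη, H⟩ := Φ.small ε' hε'
  have key : ∀ g : Excursion, (∀ t, g t ≤ M) → ∀ t, ∀ T : Finset I, (∀ r ∈ T, jump g r < η) →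
      ∑ r ∈ T, |Φ.shape.tailTerm g 1 2 t r| ≤ ε := fun g hg t T hT => by
    calc ∑ r ∈ T, |Φ.shape.tailTerm g 1 2 t r| ≤ ∑ r ∈ T, ε' * relPos g r t :=
          Finset.sum_le_sum fun r hr => Shuffle.abs_tailTerm_le
            (fun hr' x hx => H ⟨jump g r, hr'⟩ (hT r hr) x hx) t
      _ = ε' * ∑ r ∈ T, relPos g r t := by rw [Finset.mul_sum]
      _ ≤ ε' * M := mul_le_mul_of_nonneg_left ((g.sum_relPos_le t T).trans (hg t)) hε'.le
      _ ≤ ε := by linarith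
  refine ⟨η, hη, key f hM, ?_⟩
  filter_upwards [hFM] with n hn using key (F n) hn

/-- The small jumps contribute little to the height of any point, uniformly along the sequence. -/
def SmallJumps (F : ℕ → Excursion) (f : Excursion) : Prop :=
  ∀ ε > 0, ∃ η > 0,
    (∀ t, ∀ T : Finset I, (∀ r ∈ T, jump f r < η) → ∑ r ∈ T, relPos f r t ≤ ε) ∧
    ∀ᶠ n in atTop, ∀ t, ∀ T : Finset I, (∀ r ∈ T, jump (F n) r < η) →
      ∑ r ∈ T, relPos (F n) r t ≤ ε

theorem abs_tailTerm_standard_le {α β : ℝ} (hα : 0 ≤ α) (hβ : 0 ≤ β) (f : Excursion) (t r : I) :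
    |LoopShape.standard.tailTerm f α β t r| ≤ (α + β) * relPos f r t := by
  have hx := relPos_nonneg f r t
  have hxD := f.relPos_le_jump r t
  have h1 : LoopShape.standard.loopLength (jump f r) 0 (relPos f r t) ≤ relPos f r t := by
    rw [LoopShape.standard_loopLength (f.jump_nonneg r) le_rfl (f.jump_nonneg r) hx hxD, zero_sub,
      abs_neg, abs_of_nonneg hx]
    exact min_le_left _ _
  have h2 := LoopShape.standard.loopLength_nonneg (f.jump_nonneg r) 0 (relPos f r t)
  have h3 := mul_le_mul_of_nonneg_left h1 hβ
  have h4 := mul_nonneg hβ h2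
  have h5 := mul_nonneg hα hx
  have h6 := mul_nonneg hβ hx
  rw [LoopShape.tailTerm, abs_le]
  constructor <;> linarith

theorem SmallJumps.tailControl {F : ℕ → Excursion} {f : Excursion} (h : SmallJumps F f) {α β : ℝ}
    (hα : 0 ≤ α) (hβ : 0 ≤ β) : LoopShape.standard.TailControl F f α β := by
  intro ε hε
  obtain ⟨ε', hε', hle⟩ := exists_pos_mul_lt hε (α + β)
  obtain ⟨η, hη, h1, h2⟩ := h ε' hε'
  have key : ∀ g : Excursion, ∀ t, ∀ T : Finset I, ∑ r ∈ T, relPos g r t ≤ ε' →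
      ∑ r ∈ T, |LoopShape.standard.tailTerm g α β t r| ≤ ε := fun g t T hT => by
    calc ∑ r ∈ T, |LoopShape.standard.tailTerm g α β t r| ≤ ∑ r ∈ T, (α + β) * relPos g r t :=
          Finset.sum_le_sum fun r _ => abs_tailTerm_standard_le hα hβ g t r
      _ = (α + β) * ∑ r ∈ T, relPos g r t := by rw [Finset.mul_sum]
      _ ≤ (α + β) * ε' := mul_le_mul_of_nonneg_left hT (add_nonneg hα hβ)
      _ ≤ ε := hle.le
  refine ⟨η, hη, fun t T hT => key f t T (h1 t T hT), ?_⟩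
  filter_upwards [h2] with n hn t T hT using key (F n) t T (hn t T hT)

theorem UnifTendsto.tendsto_relPos {F : ℕ → Excursion} {f : Excursion} (hF : UnifTendsto F f)
    (r t : I) : Tendsto (fun n => relPos (F n) r t) atTop (𝓝 (relPos f r t)) := by
  rw [Metric.tendsto_nhds]
  intro ε hε
  filter_upwards [hF (ε / 3) (by linarith)] with n hn
  rw [Real.dist_eq]
  exact (abs_relPos_sub_le _ _ hn r t).trans_lt (by linarith)

/-- If there are at most `N` jumps, those below `ε / N` contribute at most `ε`; the limit inherits this
bound for each finite set of small jumps. -/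
theorem smallJumps_of_encard_le {F : ℕ → Excursion} {f : Excursion} (hF : UnifTendsto F f) {N : ℕ}
    (hN : ∀ n, {t | 0 < jump (F n) t}.encard ≤ N) : SmallJumps F f := by
  classical
  intro ε hε
  obtain ⟨η, hη, hle⟩ := exists_pos_mul_lt hε N
  have key : ∀ n t, ∀ T : Finset I, (∀ r ∈ T, jump (F n) r < η) →
      ∑ r ∈ T, relPos (F n) r t ≤ ε := fun n t T hT => by
    have h1 : ∀ r ∈ T, relPos (F n) r t ≤ if 0 < jump (F n) r then η else 0 := fun r hr => by
      split_ifs with h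
      · exact ((F n).relPos_le_jump r t).trans (hT r hr).le
      · exact ((F n).relPos_le_jump r t).trans (not_lt.1 h)
    refine (Finset.sum_le_sum h1).trans ?_
    rw [← Finset.sum_filter, Finset.sum_const, nsmul_eq_mul]
    have h2 : ((T.filter fun r => 0 < jump (F n) r).card : ℕ∞) ≤ N := by
      rw [← Set.encard_coe_eq_coe_finsetCard]
      exact (Set.encard_le_encard fun r hr => (Finset.mem_filter.1 hr).2).trans (hN n)
    have h3 : ((T.filter fun r => 0 < jump (F n) r).card : ℝ) ≤ N := by exact_mod_cast h2
    exact (mul_le_mul_of_nonneg_right h3 hη.le).trans hle.le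
  refine ⟨η, hη, fun t T hT => ?_, Eventually.of_forall key⟩
  -- the small jumps of the limit are small for large `n`, where the bound holds
  have hlim : Tendsto (fun n => ∑ r ∈ T, relPos (F n) r t) atTop (𝓝 (∑ r ∈ T, relPos f r t)) :=
    tendsto_finsetSum _ fun r _ => hF.tendsto_relPos r t
  refine le_of_tendsto hlim ?_
  have hj : ∀ᶠ n in atTop, ∀ r ∈ T, jump (F n) r < η := by
    refine (Filter.eventually_all_finset T).2 fun r hr => ?_
    filter_upwards [hF ((η - jump f r) / 3) (by linarith [hT r hr])] with n hn
    have := (abs_le.1 (abs_jump_sub_le _ _ hn r)).2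
    linarith [hT r hr]
  filter_upwards [hj] with n hn using key n t T hn

theorem encard_jump_timeChange_le (f : Excursion) (l : I ≃o I) :
    {t | 0 < jump (f.theta.comp l) t}.encard ≤ {t | 0 < jump f t}.encard := by
  refine le_trans (Set.encard_le_encard (t := (fun t => l.symm (upperHalf t)) '' {t | 0 < jump f t})
    fun t ht => ?_) (Set.encard_image_le _ _)
  have ht' : 0 < jump f.theta (l t) := by rw [← f.theta.jump_comp]; exact ht
  obtain ⟨r, hr⟩ : l t ∈ range upperHalf := by
    by_contra hn
    rw [f.jump_theta_of_lt (not_le.1 fun h => hn (Excursion.mem_range_upperHalf.2 h))] at ht'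
    exact lt_irrefl _ ht'
  refine ⟨r, ?_, by simp only [hr, OrderIso.symm_apply_apply]⟩
  rw [← hr, f.jump_theta_upperHalf] at ht'
  exact ht'

/-! ### Pure jump growth -/

namespace Excursion

variable (f : Excursion)

/-- Removing jumps preserves upper semicontinuity, because the jump of `f` at `t` is at least the part
of it that is removed at `t`. -/
theorem upperSemicontinuous_cut (S : Finset I) : UpperSemicontinuous (f.cut S) := by
  classical
  intro t c hc
  rw [← nhdsLT_sup_nhdsGE, eventually_sup]
  constructor
  · rcases eq_or_lt_of_le (unitInterval.nonneg' : (0 : I) ≤ t) with e | ht0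
    · rw [← e, nhdsLT_zero_eq_bot]; exact eventually_bot
    have hlim : Tendsto (f.cut S) (𝓝[<] t)
        (𝓝 (leftVal f t - ∑ r ∈ S, if r = t then 0 else relPos f r t)) := by
      refine (f.tendsto_left ht0).sub (tendsto_finsetSum _ fun r _ => ?_)
      rcases lt_trichotomy r t with h | h | h
      · rw [if_neg h.ne]; exact f.tendsto_relPos_left h
      · rw [if_pos h]
        refine tendsto_const_nhds.congr' ?_
        filter_upwards [self_mem_nhdsWithin] with s hs
        rw [relPos_of_lt (h ▸ hs)]
      · rw [if_neg h.ne', relPos_of_lt h]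
        refine tendsto_const_nhds.congr' ?_
        filter_upwards [self_mem_nhdsWithin] with s hs
        rw [relPos_of_lt (lt_trans hs h)]
    refine hlim.eventually_lt_const (lt_of_le_of_lt ?_ hc)
    have h1 : ∑ r ∈ S, relPos f r t ≤ (∑ r ∈ S, if r = t then 0 else relPos f r t) + jump f t := by
      have h2 : ∑ r ∈ S, relPos f r t = (∑ r ∈ S, if r = t then 0 else relPos f r t)
          + ∑ r ∈ S, if r = t then jump f t else 0 := by
        rw [← Finset.sum_add_distrib]
        refine Finset.sum_congr rfl fun r _ => ?_
        split_ifs with h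
        · rw [h, f.relPos_self, zero_add]
        · rw [add_zero]
      rw [h2, Finset.sum_ite_eq']
      split_ifs
      · exact le_rfl
      · linarith [f.jump_nonneg t]
    unfold cut
    unfold jump at h1
    linarith
  · have hlim : ContinuousWithinAt (f.cut S) (Ioi t) t :=
      (f.tendsto_right t).sub (tendsto_finsetSum _ fun r _ => f.tendsto_relPos_right r t)
    exact (continuousWithinAt_Ioi_iff_Ici.1 hlim).eventually_lt_const hc

variable {f}

theorem hasSum_of_isPJG (h : IsPJG f) (t : I) : HasSum (fun r => relPos f r t) (f t) := by
  refine (hasSum_subtype_iff_of_support_subset (s := {r | Anc f r t}) fun r hr => ?_).1 (h t)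
  by_contra hn
  exact hr (relPos_of_not_anc hn)

theorem hasSum_theta (h : IsPJG f) (t : I) : HasSum (fun r => relPos f.theta r t) (f.theta t) := by
  rw [← upperHalf_injective.hasSum_iff fun r hr =>
    f.relPos_theta_of_lt (not_le.1 fun h => hr (mem_range_upperHalf.2 h)) t, f.theta_apply]
  simp only [Function.comp_def, f.relPos_theta]
  exact hasSum_of_isPJG h _

/-- By a compactness argument in the manner of Dini, finitely many jumps account for the heights of
all points at once, up to a small error, which persists along the sequence. -/
theorem exists_cut_le {f : Excursion} (h : ∀ t, HasSum (fun r => relPos f r t) (f t))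
    {F : ℕ → Excursion} (hF : UnifTendsto F f) {ε : ℝ} (hε : 0 < ε) :
    ∃ S : Finset I, (∀ r ∈ S, 0 < jump f r) ∧ (∀ t, f.cut S t ≤ ε) ∧
      ∀ᶠ n in atTop, ∀ t, (F n).cut S t ≤ ε := by
  classical
  have hpt : ∀ t, ∃ S : Finset I, f.cut S t < ε / 2 := fun t => by
    have h1 : Tendsto (fun S : Finset I => f.cut S t) atTop (𝓝 (f t - f t)) :=
      Filter.Tendsto.sub tendsto_const_nhds (h t)
    rw [sub_self] at h1
    exact (h1.eventually_lt_const (half_pos hε)).exists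
  -- at each time finitely many jumps suffice, and so do they nearby by upper semicontinuity
  choose S hS using hpt
  obtain ⟨A, -, hA⟩ := isCompact_univ.elim_nhds_subcover
    (fun t => {s | f.cut (S t) s < ε / 2}) fun t _ => f.upperSemicontinuous_cut (S t) t _ (hS t)
  set B := (A.biUnion S).filter fun r => 0 < jump f r with hB
  have hcut : ∀ t, f.cut B t ≤ ε / 2 := fun t => by
    obtain ⟨s, hs, hst⟩ := mem_iUnion₂.1 (hA (mem_univ t))
    have hst' : f.cut (S s) t < ε / 2 := hst
    refine le_trans ?_ hst'.le
    unfold cut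
    refine sub_le_sub_left ?_ _
    have h1 : ∑ r ∈ S s, relPos f r t ≤ ∑ r ∈ A.biUnion S, relPos f r t :=
      Finset.sum_le_sum_of_subset_of_nonneg (Finset.subset_biUnion_of_mem S hs)
        fun r _ _ => relPos_nonneg _ _ _
    refine h1.trans (le_of_eq ?_)
    rw [hB, Finset.sum_filter]
    refine Finset.sum_congr rfl fun r _ => ?_
    split_ifs with hr
    · rfl
    · exact le_antisymm ((f.relPos_le_jump r t).trans (not_lt.1 hr)) (relPos_nonneg _ _ _)
  obtain ⟨δ, hδ, hle⟩ := exists_pos_mul_lt (half_pos hε) (1 + B.card * 2 : ℝ)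
  refine ⟨B, fun r hr => (Finset.mem_filter.1 hr).2, fun t => (hcut t).trans (by linarith), ?_⟩
  filter_upwards [hF δ hδ] with n hn t
  have h1 : ∑ r ∈ B, relPos f r t ≤ ∑ r ∈ B, relPos (F n) r t + B.card * (2 * δ) := by
    rw [← nsmul_eq_mul, ← Finset.sum_const, ← Finset.sum_add_distrib]
    refine Finset.sum_le_sum fun r _ => ?_
    linarith [(abs_le.1 (abs_relPos_sub_le _ _ hn r t)).1]
  have h2 := hcut t
  have h3 := (abs_le.1 (hn t)).2
  unfold cut at h2 ⊢
  linarith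

/-- For a limit of pure jump growth, finitely many jumps account for almost all of every height, and
jumps below the smallest of these are not among them. -/
theorem smallJumps_of_hasSum {f : Excursion} (h : ∀ t, HasSum (fun r => relPos f r t) (f t))
    {F : ℕ → Excursion} (hF : UnifTendsto F f) : SmallJumps F f := by
  classical
  intro ε hε
  obtain ⟨S, hS, h1, h2⟩ := exists_cut_le h hF hε
  obtain ⟨η, hη1, hη0⟩ : ∃ η, (∀ r ∈ S, η ≤ jump f r) ∧ 0 < η := by
    refine (((Filter.eventually_all_finset S).2 fun r hr => ?_ :
      ∀ᶠ η in 𝓝[>] (0 : ℝ), ∀ r ∈ S, η ≤ jump f r).and self_mem_nhdsWithin).exists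
    exact nhdsWithin_le_nhds (ge_mem_nhds (hS r hr))
  have key : ∀ g : Excursion, ∀ t, g.cut S t ≤ ε → ∀ T : Finset I, (∀ r ∈ T, r ∉ S) →
      ∑ r ∈ T, relPos g r t ≤ ε := fun g t hg T hT => by
    have h3 := g.sum_relPos_le t (T ∪ S)
    rw [Finset.sum_union (Finset.disjoint_left.2 hT)] at h3
    unfold cut at hg
    linarith
  refine ⟨η / 2, by linarith, fun t T hT => key f t (h1 t) T fun r hr hrS => ?_, ?_⟩
  · linarith [hT r hr, hη1 r hrS]
  · filter_upwards [h2, hF (η / 4) (by linarith)] with n hn hFn t T hT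
    refine key (F n) t (hn t) T fun r hr hrS => ?_
    linarith [hT r hr, hη1 r hrS, (abs_le.1 (abs_jump_sub_le _ _ hFn r)).1]

theorem treeDist_le_cut (f : Excursion) (S : Finset I) (s t : I) :
    treeDist f s t ≤ f.cut S s + f.cut S t := by
  have h1 : treeDist f s t ≤ f s + f t - 2 * infBetween f s t
      - ∑ r ∈ S, |relPos f r s - relPos f r t| := by
    rw [f.treeDist_eq]
    have := (f.summable_abs_relPos_sub s t).sum_le_tsum S fun _ _ => abs_nonneg _
    linarith
  have h2 : 0 ≤ infBetween (f.cut S) s t := infOn_nonneg (f.cut_nonneg S) _ _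
  rw [f.infBetween_cut] at h2
  have h3 : ∑ r ∈ S, |relPos f r s - relPos f r t| = ∑ r ∈ S, relPos f r s + ∑ r ∈ S, relPos f r t
      - 2 * ∑ r ∈ S, min (relPos f r s) (relPos f r t) := by
    rw [Finset.mul_sum, ← Finset.sum_add_distrib, ← Finset.sum_sub_distrib]
    refine Finset.sum_congr rfl fun q _ => ?_
    have a := min_add_max (relPos f q s) (relPos f q t)
    have b := max_sub_min_eq_abs (relPos f q s) (relPos f q t)
    rw [abs_sub_comm] at b
    linarith
  unfold cut
  linarith

end Excursion

/-! ### Convergence of the looptrees, trees and vernation trees -/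

theorem shuffledVernDist_eq (Φ : Shuffle) (f : Excursion) :
    shuffledVernDist Φ f = Φ.shape.gdist f 1 2 := by
  funext s t
  rw [shuffledVernDist, shuffledLoopDist_eq, LoopShape.gdist, one_mul]

theorem loopDist_eq_gdist (f : Excursion) : loopDist f = LoopShape.standard.gdist f 0 1 := by
  funext s t
  rw [loopDist_eq, LoopShape.gdist, one_mul, zero_mul, zero_add]

theorem treeDist_eq_gdist (f : Excursion) : treeDist f = LoopShape.standard.gdist f 1 0 := by
  funext s t
  rw [LoopShape.gdist, one_mul, zero_mul, add_zero]

theorem vernDist_eq_gdist (f : Excursion) : vernDist f = LoopShape.standard.gdist f 1 2 := by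
  funext s t
  rw [vernDist, loopDist_eq, LoopShape.gdist, one_mul]

theorem quotientsTendsto_shuffled {f : Excursion} {fn : ℕ → Excursion} (h : RelaxedTendsto fn f)
    {Φ : Shuffle} (hΦ : excursionBadSet f ∩ shuffleBadSet Φ = ∅) :
    QuotientsTendsto (fun n => shuffledVernDist Φ (fn n)) (shuffledVernDist Φ f) := by
  obtain ⟨l, hl, hF⟩ := h.exists_timeChange
  simp only [shuffledVernDist_eq]
  exact ⟨_, _, LoopShape.tendsto_ghpDist zero_le_one zero_le_two hl hF (compatible_shape hΦ)
    (Φ.tailControl hF)⟩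

theorem quotientsTendsto_standard {f : Excursion} {fn : ℕ → Excursion} {l : ℕ → I ≃o I}
    (hl : ∀ δ > 0, ∀ᶠ n in atTop, ∀ t, dist (l n t) t ≤ δ)
    (hF : UnifTendsto (fun n => (fn n).theta.comp (l n)) f.theta)
    (hJ : SmallJumps (fun n => (fn n).theta.comp (l n)) f.theta) {α β : ℝ} (hα : 0 ≤ α)
    (hβ : 0 ≤ β) : QuotientsTendsto (fun n => LoopShape.standard.gdist (fn n) α β)
      (LoopShape.standard.gdist f α β) :=
  ⟨_, _, LoopShape.tendsto_ghpDist hα hβ hl hF (compatible_standard _) (hJ.tailControl hα hβ)⟩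

theorem ghpTendsto_onePoint {dn : ℕ → I → I → ℝ} (hn : ∀ n, IsCode (dn n))
    (h : ∀ ε > 0, ∀ᶠ n in atTop, ∀ s t, dn n s t ≤ ε) : GHPTendsto dn onePoint := by
  refine ⟨hn, ?_⟩
  rw [tendsto_order]
  refine ⟨fun a ha => Eventually.of_forall fun n => ha.trans_le (ghpDist_nonneg _ _),
    fun ε hε => ?_⟩
  filter_upwards [h (ε / 8) (by positivity)] with n hdn
  refine lt_of_le_of_lt (ghpDist_le (J := Unit) (ε := ε / 8) (X := quotientSpace (dn n) (hn n))
    (Y := onePoint) (fun _ => proj _ (hn n).isPseudoDist 1) (fun _ => ()) (pY := fun _ => ())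
    (hn n).measurable measurable_const rfl ?_ (by positivity) (fun i j => ?_) (fun x => ?_)
    (fun y => ?_) ⟨(), rfl, rfl⟩ univ (fun t _ => ⟨(), ?_, ?_⟩) ?_) (by linarith)
  · refine Eq.symm ((@Measure.map_const _ _ _ (borel Unit) (volume : Measure I) ()).trans ?_)
    rw [measure_univ, one_smul]
    rfl
  · have e : |dist (proj (dn n) (hn n).isPseudoDist 1) (proj (dn n) (hn n).isPseudoDist 1)
        - dist (α := Unit) () ()| ≤ ε / 8 := by
      rw [dist_self, dist_self, sub_zero, abs_zero]
      positivity
    exact e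
  · obtain ⟨s, rfl⟩ := proj_surjective (hn n).isPseudoDist x
    exact ⟨(), (dist_proj (hn n).isPseudoDist s 1).trans_le (hdn s 1)⟩
  · exact ⟨(), (dist_self (α := Unit) ()).trans_le (by positivity)⟩
  · exact (dist_proj (hn n).isPseudoDist t 1).trans_le (hdn t 1)
  · exact (dist_self (α := Unit) ()).trans_le (by positivity)
  · simp

/-- Two points of the tree are at distance at most the sum of their heights, not counting any given
finite set of jumps; for a limit of pure jump growth, these heights tend to `0` uniformly. -/
theorem ghpTendsto_treeDist_onePoint {f : Excursion} {fn : ℕ → Excursion} {l : ℕ → I ≃o I}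
    (hF : UnifTendsto (fun n => (fn n).theta.comp (l n)) f.theta) (hf : IsPJG f) :
    GHPTendsto (fun n => treeDist (fn n)) onePoint := by
  refine ghpTendsto_onePoint (fun n => ?_) fun ε hε => ?_
  · rw [treeDist_eq_gdist]
    exact LoopShape.isCode_gdist _ _ zero_le_one le_rfl
  · obtain ⟨S, -, -, hS⟩ := Excursion.exists_cut_le (Excursion.hasSum_theta hf) hF (half_pos hε)
    filter_upwards [hS] with n hn s t
    have e : ∀ s t, treeDist ((fn n).theta.comp (l n)) s t
        = treeDist (fn n) (lowerTime (l n s)) (lowerTime (l n t)) := fun s t => by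
      rw [treeDist_eq_gdist, treeDist_eq_gdist, Excursion.gdist_comp, Excursion.gdist_theta]
    have h1 := e ((l n).symm (upperHalf s)) ((l n).symm (upperHalf t))
    rw [OrderIso.apply_symm_apply, OrderIso.apply_symm_apply, lowerTime_upperHalf,
      lowerTime_upperHalf] at h1
    rw [← h1]
    refine (Excursion.treeDist_le_cut _ S _ _).trans ?_
    linarith [hn ((l n).symm (upperHalf s)), hn ((l n).symm (upperHalf t))]

end Vernation

end

theorem mainTheorem1 (f : Vernation.Excursion) (fn : ℕ → Vernation.Excursion)
    (hconv : Vernation.RelaxedTendsto fn f) :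
    -- (i) shuffled vernation trees
    (∀ Φ : Vernation.Shuffle,
      Vernation.excursionBadSet f ∩ Vernation.shuffleBadSet Φ = ∅ →
        Vernation.QuotientsTendsto (fun n => Vernation.shuffledVernDist Φ (fn n))
          (Vernation.shuffledVernDist Φ f)) ∧
    -- (ii) bounded number of jumps
    ((∃ N : ℕ, ∀ n, {t | 0 < Vernation.jump (fn n) t}.encard ≤ N) →
      Vernation.QuotientsTendsto (fun n => Vernation.loopDist (fn n)) (Vernation.loopDist f) ∧
      Vernation.QuotientsTendsto (fun n => Vernation.treeDist (fn n)) (Vernation.treeDist f) ∧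
      Vernation.QuotientsTendsto (fun n => Vernation.vernDist (fn n)) (Vernation.vernDist f)) ∧
    -- (iii) pure jump growth limit
    (Vernation.IsPJG f →
      Vernation.QuotientsTendsto (fun n => Vernation.loopDist (fn n)) (Vernation.loopDist f) ∧
      Vernation.GHPTendsto (fun n => Vernation.treeDist (fn n)) Vernation.onePoint ∧
      Vernation.QuotientsTendsto (fun n => Vernation.vernDist (fn n)) (Vernation.vernDist f)) := by
  obtain ⟨l, hl, hF⟩ := hconv.exists_timeChange
  have hL : Vernation.loopDist = fun g => Vernation.LoopShape.standard.gdist g 0 1 :=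
    funext Vernation.loopDist_eq_gdist
  have hT : Vernation.treeDist = fun g => Vernation.LoopShape.standard.gdist g 1 0 :=
    funext Vernation.treeDist_eq_gdist
  have hV : Vernation.vernDist = fun g => Vernation.LoopShape.standard.gdist g 1 2 :=
    funext Vernation.vernDist_eq_gdist
  refine ⟨fun Φ hΦ => Vernation.quotientsTendsto_shuffled hconv hΦ, ?_, fun hf => ?_⟩
  · rintro ⟨N, hN⟩
    have hJ := Vernation.smallJumps_of_encard_le hF (N := N)
      fun n => (Vernation.encard_jump_timeChange_le (fn n) (l n)).trans (hN n)
    rw [hL, hT, hV]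
    exact ⟨Vernation.quotientsTendsto_standard hl hF hJ le_rfl zero_le_one,
      Vernation.quotientsTendsto_standard hl hF hJ zero_le_one le_rfl,
      Vernation.quotientsTendsto_standard hl hF hJ zero_le_one zero_le_two⟩
  · have hJ := Vernation.Excursion.smallJumps_of_hasSum (Vernation.Excursion.hasSum_theta hf) hF
    refine ⟨?_, Vernation.ghpTendsto_treeDist_onePoint hF hf, ?_⟩
    · rw [hL]
      exact Vernation.quotientsTendsto_standard hl hF hJ le_rfl zero_le_one
    · rw [hV]
      exact Vernation.quotientsTendsto_standard hl hF hJ zero_le_one zero_le_two
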